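/- Let $\tau\in\mathbb H$, $q=e^{2\pi i\tau}$, $q\frac{d}{dq}=\frac1{2\pi i}\frac{d}{d\tau}$, $E_2(q)=1-24\sum_{n\ge1}\frac{nq^n}{1-q^n}$, $(a;q)_\infty=\prod_{k\ge0}(1-aq^k)$ and $(a_1,\dots,a_r;q)_\infty=\prod_j(a_j;q)_\infty$. For $\gamma=\begin{pmatrix}\gamma_{11}&\gamma_{12}\\ \gamma_{21}&\gamma_{22}\end{pmatrix}\in\Gamma_0(p)\subset SL(2,\mathbb Z)$ and a function $f$ of weight $k$ put $\langle\gamma\rangle_k f(\tau)=(\gamma_{21}\tau+\gamma_{22})^{-k}f(\gamma\tau)$. For a prime $5\le p\le 19$ let $$\mathcal E_p=\frac{2}{p-1}\sum_{\chi}E_{1,\chi},\qquad E_{1,\chi}(\tau)=1+\frac{2}{L(0,\chi)}\sum_{n\ge1}\chi(n)\frac{q^n}{1-q^n},$$ the sum being over the odd primitive Dirichlet characters modulo $p$. For $a\in(\mathbb Z/p\mathbb Z)^*$ let $\mathcal E_{a,p}=\langle\gamma\rangle_1\mathcal E_p$, where $\gamma\in\Gamma_0(p)$ and $\gamma_{22}\equiv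 a\pmod p$. Let $(a_1,\dots,a_{(p-1)/2})$ be $(1,2)$, $(1,2,3)$, $(1,2,3,5,7)$, $(1,2,3,4,5,7)$, $(1,2,3,5,7,8,11,13)$, $(1,2,3,4,5,7,9,11,13)$ for $p=5,7,11,13,17,19$ respectively, and define $$\mathcal F_5=-5x_1^2+66x_1x_2+7x_2^2,\qquad \mathcal F_7=-7x_1^2+5x_2^2+5x_3^2-20x_2x_3+52x_1x_2,$$ $$\mathcal F_{11}=-11x_1^2+x_2^2+13x_3^2+x_4^2+x_5^2+34x_1x_3+42x_2x_4-40x_2x_5+38x_3x_5-10x_4x_5,$$ $$\mathcal F_{13}=-13x_1^2+11x_2^2-x_3^2-x_4^2-x_5^2+11x_6^2+16x_1x_2+38x_1x_5+2x_2x_3-20x_2x_4+40x_2x_5-8x_2x_6+14x_4x_6,$$ $$\begin{aligned}\mathcal F_{17}=&-17x_1^2+19x_2^2+7x_3^2-5x_4^2-5x_5^2-5x_6^2-5x_7^2+19x_8^2-12x_2x_3+54x_2x_5+12x_5x_6\\&+30x_2x_7-42x_5x_7-60x_2x_8+12x_3x_8-54x_5x_8-12x_7x_8,\end{aligned}$$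 $$\begin{aligned}\mathcal F_{19}=&-19x_1^2+41x_2^2+5x_3^2-7x_4^2-7x_5^2+5x_6^2+5x_7^2-7x_8^2-7x_9^2+16x_2x_5-36x_3x_5+8x_4x_5\\&+32x_5x_6+12x_4x_7-16x_5x_7+28x_5x_8-12x_6x_8-4x_2x_9+68x_3x_9+16x_5x_9-28x_8x_9.\end{aligned}$$ (1) For every prime $5\le p\le19$ and every $a\in(\mathbb Z/p\mathbb Z)^*$, $\mathcal E_{a,p}$ is holomorphic and has no zero on $\mathbb H$, and $$\frac{12}{\mathcal E_{a,p}}\,q\frac{d}{dq}\mathcal E_{a,p}=\mathcal F_p\bigl(\mathcal E_{a a_1,p},\dots,\mathcal E_{a a_{(p-1)/2},p}\bigr)+pE_2(q^p).$$ (2) The system is invariant under $\Gamma_0(p)$. Write $L_a=\frac{12}{\mathcal E_{a,p}}q\frac{d}{dq}\mathcal E_{a,p}-pE_2(q^p)$ and $R_a=\mathcal F_p(\mathcal E_{aa_1,p},\dots,\mathcal E_{aa_{(p-1)/2},p})$. For all $\gamma\in\Gamma_0(p)$ and $a\in(\mathbb Z/p\mathbb Z)^*$: $\langle\gamma\rangle_1\mathcal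 E_p=\mathcal E_{\gamma_{22},p}$ (so $\mathcal E_{a,p}$ does not depend on the choice of matrix), $\langle\gamma\rangle_1\mathcal E_{a,p}=\mathcal E_{a\gamma_{22},p}$, $\langle\gamma\rangle_2L_a=L_{a\gamma_{22}}$ and $\langle\gamma\rangle_2R_a=R_{a\gamma_{22}}$. Moreover $\mathcal E_{-a,p}=-\mathcal E_{a,p}$, and $(L_a,R_a)=(L_b,R_b)$ if and only if $b=\pm a$. There is a homomorphism $\rho$ from $(\mathbb Z/p\mathbb Z)^*$ to the permutations of $\{1,\dots,(p-1)/2\}$, with kernel $\{\pm1\}$, such that for all $\gamma\in\Gamma_0(p)$ and all $k$, with $j=\rho(\gamma_{22})(k)$: $\langle\gamma\rangle_1\mathcal E_{a_k,p}=\pm\mathcal E_{a_j,p}$, $\langle\gamma\rangle_2L_{a_k}=L_{a_j}$ and $\langle\gamma\rangle_2R_{a_k}=R_{a_j}$. (3) Level 5. One has $$\frac{q(q;q)_\infty^2}{(q^2,q^3;q^5)_\infty^5}=\mathcal E_{2,5},\qquad \frac{(q;q)_\infty^2}{(q,q^4;q^5)_\infty^5}=\mathcal E_{1,5}.$$ There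 are holomorphic functions $A,B$ of $\tau\in\mathbb H$ whose fifth powers are these two products, respectively, and for all such $A,B$ and $\mathscr P=E_2(q^5)$, which is holomorphic on $\mathbb H$, $$q\tfrac{d}{dq}A=\tfrac1{60}A\bigl(-5A^{10}-66A^5B^5+7B^{10}+5\mathscr P\bigr),\qquad q\tfrac{d}{dq}B=\tfrac1{60}B\bigl(-5B^{10}+66A^5B^5+7A^{10}+5\mathscr P\bigr),$$ $$q\tfrac{d}{dq}\mathscr P=\tfrac5{12}\bigl(\mathscr P^2-B^{20}+12B^{15}A^5-14B^{10}A^{10}-12B^5A^{15}-A^{20}\bigr).$$ (4) Level 7. The functions $$x=q\frac{(q^2,q^5,q^7,q^7;q^7)_\infty}{(q^3,q^4;q^7)_\infty^2},\quad y=-q\frac{(q,q^6,q^7,q^7;q^7)_\infty}{(q^2,q^5;q^7)_\infty^2},\quad z=\frac{(q^3,q^4,q^7,q^7;q^7)_\infty}{(q,q^6;q^7)_\infty^2}$$ equal $\mathcal E_{2,7},\mathcal E_{4,7},\mathcal E_{1,7}$, respectively. They and $\mathcal P=E_2(q^7)$ are holomorphic on $\mathbb H$, and $$q\tfrac{d}{dq}x=\tfrac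 x{12}\bigl(5y^2+5z^2-7x^2+20yz+52xy+7\mathcal P\bigr),\qquad q\tfrac{d}{dq}y=\tfrac y{12}\bigl(5z^2+5x^2-7y^2+20xz+52yz+7\mathcal P\bigr),$$ $$q\tfrac{d}{dq}z=\tfrac z{12}\bigl(5x^2+5y^2-7z^2+20xy+52xz+7\mathcal P\bigr),$$ $$q\tfrac{d}{dq}\mathcal P=\tfrac7{12}\bigl(\mathcal P^2-x^4-4x^3y-12xy^3-y^4-12x^3z-4y^3z-4xz^3-12yz^3-z^4\bigr).$$ -/

import Mathlib

open scoped UpperHalfPlane ModularForm MatrixGroups Manifold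

noncomputable section

/-- The nome `q = e^{2 π i τ}`. -/
def nome (τ : ℍ) : ℂ := Complex.exp (2 * Real.pi * Complex.I * (τ : ℂ))

/-- The operator `q d/dq = (2 π i)⁻¹ d/dτ` on functions of `τ` in the upper half plane. -/
def qDiff (f : ℍ → ℂ) : ℍ → ℂ := Derivative.normalizedDerivOfComplex f

/-- Holomorphy of a function on the upper half plane. -/
def Holo (f : ℍ → ℂ) : Prop := MDifferentiable 𝓘(ℂ) 𝓘(ℂ) f

/-- The infinite product `(a; q)_∞ = ∏_{k ≥ 0} (1 - a q ^ k)`. -/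
def qPoch (a q : ℂ) : ℂ := ∏' k : ℕ, (1 - a * q ^ k)

/-- `(a₁, …, a_r; q)_∞ = ∏_j (a_j; q)_∞`. -/
def qPochList (l : List ℂ) (q : ℂ) : ℂ := (l.map fun a => qPoch a q).prod

/-- `E₂(q) = 1 - 24 ∑_{n ≥ 1} n q ^ n / (1 - q ^ n)`, as a function of `q`, `|q| < 1`. -/
def eisTwo (q : ℂ) : ℂ := 1 - 24 * ∑' n : ℕ+, (n : ℂ) * q ^ (n : ℕ) / (1 - q ^ (n : ℕ))

/-- The Hecke Eisenstein series
`E_{k,χ}(τ) = 1 + 2 / L(1 - k, χ) ∑_{n ≥ 1} χ(n) n ^ (k - 1) q ^ n / (1 - q ^ n)`, `k ≥ 1`. -/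
def heckeEis {p : ℕ} [NeZero p] (k : ℕ) (χ : DirichletCharacter ℂ p) (τ : ℍ) : ℂ :=
  1 + 2 / DirichletCharacter.LFunction χ (1 - (k : ℂ)) *
    ∑' n : ℕ+, χ ((n : ℕ) : ZMod p) * ((n : ℂ) ^ (k - 1) * nome τ ^ (n : ℕ)) /
      (1 - nome τ ^ (n : ℕ))

/-- The normalized sum `2 / (p - 1) ∑_χ E_{1,χ}` over the odd primitive characters modulo `p`. -/
def eisSum (p : ℕ) [NeZero p] (τ : ℍ) : ℂ :=
  2 / ((p : ℂ) - 1) *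
    ∑ᶠ (χ : DirichletCharacter ℂ p) (_ : χ.Odd ∧ χ.IsPrimitive), heckeEis 1 χ τ

/-- A unit modulo `p` is the lower right entry of some matrix in `Γ₀(p)`. -/
theorem exists_gamma0_lower_right (p : ℕ) (d : (ZMod p)ˣ) :
    ∃ γ : SL(2, ℤ), γ ∈ CongruenceSubgroup.Gamma0 p ∧ ((γ 1 1 : ℤ) : ZMod p) = d := by
  obtain ⟨m, hm⟩ := ZMod.intCast_surjective (d : ZMod p)
  obtain ⟨n, hn⟩ := ZMod.intCast_surjective ((d⁻¹ : (ZMod p)ˣ) : ZMod p)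
  have h : ((n * m - 1 : ℤ) : ZMod p) = 0 := by
    push_cast
    rw [hm, hn, Units.inv_mul, sub_self]
  obtain ⟨c, hc⟩ := (ZMod.intCast_zmod_eq_zero_iff_dvd _ p).mp h
  have hdet : (!![n, c; (p : ℤ), m] : Matrix (Fin 2) (Fin 2) ℤ).det = 1 := by
    rw [Matrix.det_fin_two_of]
    linarith
  have h10 : (((p : ℤ) : ℤ) : ZMod p) = 0 := by simp
  exact ⟨(⟨!![n, c; (p : ℤ), m], hdet⟩ : SL(2, ℤ)), CongruenceSubgroup.Gamma0_mem.mpr h10, hm⟩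

/-- A matrix in `Γ₀(p)` with lower right entry congruent to `d` (for `d` a unit modulo `p`). -/
def diamondRep (p : ℕ) (d : ZMod p) : SL(2, ℤ) :=
  Classical.epsilon fun γ : SL(2, ℤ) =>
    γ ∈ CongruenceSubgroup.Gamma0 p ∧ ((γ 1 1 : ℤ) : ZMod p) = d

theorem diamondRep_spec (p : ℕ) (d : (ZMod p)ˣ) :
    diamondRep p d ∈ CongruenceSubgroup.Gamma0 p ∧
      ((diamondRep p d 1 1 : ℤ) : ZMod p) = d :=
  Classical.epsilon_spec (exists_gamma0_lower_right p d)

/-- The generator `𝓔_{d,p} = ⟨d⟩ 𝓔_p`, where `⟨γ⟩ f (τ) = (γ₂₁ τ + γ₂₂)⁻¹ f (γ τ)` in weight one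
and `⟨d⟩ = ⟨γ⟩` for a matrix `γ` in `Γ₀(p)` with `γ₂₂ ≡ d` modulo `p`. -/
def gen (p : ℕ) [NeZero p] (d : ZMod p) : ℍ → ℂ :=
  eisSum p ∣[(1 : ℤ)] diamondRep p d

/-- The integers `a_k = a_{k,p}`, `1 ≤ k ≤ (p - 1) / 2`. -/
def genIndex (p k : ℕ) : ℕ :=
  (match p with
    | 5 => [1, 2]
    | 7 => [1, 2, 3]
    | 11 => [1, 2, 3, 5, 7]
    | 13 => [1, 2, 3, 4, 5, 7]
    | 17 => [1, 2, 3, 5, 7, 8, 11, 13]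
    | 19 => [1, 2, 3, 4, 5, 7, 9, 11, 13]
    | _ => []).getD (k - 1) 0

/-- The quadratic forms `𝓕_p(x₁, …, x_{(p-1)/2})`. -/
def quadForm (p : ℕ) (x : ℕ → ℂ) : ℂ :=
  match p with
  | 5 => -5 * x 1 ^ 2 + 66 * x 1 * x 2 + 7 * x 2 ^ 2
  | 7 => -7 * x 1 ^ 2 + 5 * x 2 ^ 2 + 5 * x 3 ^ 2 - 20 * x 2 * x 3 + 52 * x 1 * x 2
  | 11 =>
    -11 * x 1 ^ 2 + x 2 ^ 2 + 13 * x 3 ^ 2 + x 4 ^ 2 + x 5 ^ 2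
      + 34 * x 3 * x 1 + 42 * x 2 * x 4 - 40 * x 2 * x 5 + 38 * x 3 * x 5 - 10 * x 4 * x 5
  | 13 =>
    -13 * x 1 ^ 2 + 11 * x 2 ^ 2 - x 3 ^ 2 - x 4 ^ 2 - x 5 ^ 2 + 11 * x 6 ^ 2
      + 16 * x 2 * x 1 + 38 * x 1 * x 5 + 2 * x 2 * x 3 - 20 * x 2 * x 4 + 40 * x 2 * x 5
      - 8 * x 2 * x 6 + 14 * x 4 * x 6
  | 17 =>
    -17 * x 1 ^ 2 + 19 * x 2 ^ 2 + 7 * x 3 ^ 2 - 5 * x 4 ^ 2 - 5 * x 5 ^ 2 - 5 * x 6 ^ 2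
      - 5 * x 7 ^ 2 + 19 * x 8 ^ 2
      - 12 * x 2 * x 3 + 54 * x 2 * x 5 + 12 * x 5 * x 6 + 30 * x 2 * x 7 - 42 * x 5 * x 7
      - 60 * x 2 * x 8 + 12 * x 3 * x 8 - 54 * x 5 * x 8 - 12 * x 7 * x 8
  | 19 =>
    -19 * x 1 ^ 2 + 41 * x 2 ^ 2 + 5 * x 3 ^ 2 - 7 * x 4 ^ 2 - 7 * x 5 ^ 2 + 5 * x 6 ^ 2
      + 5 * x 7 ^ 2 - 7 * x 8 ^ 2 - 7 * x 9 ^ 2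
      + 16 * x 2 * x 5 - 36 * x 3 * x 5 + 8 * x 4 * x 5 + 32 * x 5 * x 6 + 12 * x 4 * x 7
      - 16 * x 5 * x 7 + 28 * x 5 * x 8 - 12 * x 6 * x 8 - 4 * x 2 * x 9 + 68 * x 3 * x 9
      + 16 * x 5 * x 9 - 28 * x 8 * x 9
  | _ => 0

/-- `(12 / 𝓔_{a,p}) q d/dq 𝓔_{a,p} - p E₂(pτ)`. -/
def systemLHS (p : ℕ) [NeZero p] (a : ZMod p) (τ : ℍ) : ℂ :=
  12 / gen p a τ * qDiff (gen p a) τ - p * eisTwo (nome τ ^ p)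

/-- `𝓕_p(𝓔_{a a₁,p}, …, 𝓔_{a a_{(p-1)/2},p})`. -/
def systemRHS (p : ℕ) [NeZero p] (a : ZMod p) (τ : ℍ) : ℂ :=
  quadForm p fun k => gen p (a * (genIndex p k : ZMod p)) τ

/-- `q (q; q)_∞² / (q², q³; q⁵)_∞⁵`, the fifth power of the level five parameter `A`. -/
def prodA5 (τ : ℍ) : ℂ :=
  nome τ * qPoch (nome τ) (nome τ) ^ 2 /
    qPochList [nome τ ^ 2, nome τ ^ 3] (nome τ ^ 5) ^ 5

/-- `(q; q)_∞² / (q, q⁴; q⁵)_∞⁵`, the fifth power of the level five parameter `B`. -/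
def prodB5 (τ : ℍ) : ℂ :=
  qPoch (nome τ) (nome τ) ^ 2 / qPochList [nome τ, nome τ ^ 4] (nome τ ^ 5) ^ 5

/-- The level seven parameter `x`. -/
def sevenX (τ : ℍ) : ℂ :=
  nome τ * (qPochList [nome τ ^ 2, nome τ ^ 5, nome τ ^ 7, nome τ ^ 7] (nome τ ^ 7) /
    qPochList [nome τ ^ 3, nome τ ^ 4] (nome τ ^ 7) ^ 2)

/-- The level seven parameter `y`. -/
def sevenY (τ : ℍ) : ℂ :=
  -nome τ * (qPochList [nome τ, nome τ ^ 6, nome τ ^ 7, nome τ ^ 7] (nome τ ^ 7) /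
    qPochList [nome τ ^ 2, nome τ ^ 5] (nome τ ^ 7) ^ 2)

/-- The level seven parameter `z`. -/
def sevenZ (τ : ℍ) : ℂ :=
  qPochList [nome τ ^ 3, nome τ ^ 4, nome τ ^ 7, nome τ ^ 7] (nome τ ^ 7) /
    qPochList [nome τ, nome τ ^ 6] (nome τ ^ 7) ^ 2

end

/-! Everything is derived from one odd Jacobi theta function θ(z, σ), taken at σ = p τ. Let J be its
logarithmic derivative in z, and let P be minus the derivative of J, which is ℘ up to an additive
constant; derivatives are normalized by 1/(2πi). On the section z = (a/p) σ the value G_a = J + a/p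
depends only on a modulo p, is odd in a, and is a weight one Eisenstein series which Γ₀(p) permutes
(`levelJ_slash`). For 0 < a < p the constant term of -G_a at infinity is 1/2 - a/p.

The form 𝓔_p is a sum of only four of these. For each prime in the range there are four residues t_i
of sum zero such that the sum of 1/2 - {a t_i / p} over i is 1 for a = 1, -1 for a = -1, and 0 for
every other nonzero a. Since L(0, χ) is the sum of χ(a)(1/2 - a/p) (from the Hurwitz zeta value ζ(0,
x) = 1/2 - x), this gives L(0, χ) ∑ χ(t_i)⁻¹ = 2 for odd χ (`BalancedQuad.LFunction_mul_sum`). So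
1/L(0, χ) is half a four-term character sum, and orthogonality yields 𝓔_p = -∑ G_{t_i}
(`BalancedQuad.eisSum_eq`). Acting by Γ₀(p), 𝓔_{d,p} is the same sum over the residues t_i d⁻¹.

Because the t_i add up to zero, the four-term sum is a quotient of theta values: Weierstrass'
three-term relation, differentiated once, expresses J(x) + J(y) + J(z) - J(x+y+z) as such a quotient
(`thetaJ_add_add`). This gives the absence of zeros and the infinite products at levels 5 and 7. By
the heat equation, the logarithmic derivative in τ of the quotient is (p/2)(T + Q), where T =
θ'''(0)/θ'(0) = E₂(q^p)/4 and Q is a signed sum of values G² - P (`quadSum`).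

Two further derivatives of the same relation give (G_a + G_b - G_{a+b})² = P_a + P_b + P_{a+b} + T
(`thetaJ_add_sq`). For each p an explicit integral combination of these identities shows that 𝓕_p,
evaluated at the generators, equals 2p(T + 3Q). As 12 (p/2)(T + Q) - 4pT is the same expression, the
differential equation follows.

Equivariance under Γ₀(p) comes from its action on the generators and from the homogeneity of 𝓕_p.
Equations for different classes modulo ±1 are told apart at infinity: exactly one variable has a
nonzero constant term, equal to ±1, and among the diagonal coefficients of 𝓕_p the value -p occurs
only at x₁².

For the derivative of E₂(q^p), the addition formula expresses T through J and P along sections.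
Differentiating it gives a polynomial in the values of J, P and P' (`hasDerivAt_thetaT`), and at p =
5, 7 the addition relations rewrite this in the generators and T. Fifth roots exist because the
upper half plane is simply connected. -/

noncomputable section

open Complex Filter Topology

/-! ### The odd theta function: convergence, heat equation, parity -/

/-- The general term of the `j`-th derivative (for `(2πi)⁻¹ d/dz`) of the odd theta function. -/
def thetaTerm (j : ℕ) (z τ : ℂ) (n : ℤ) : ℂ :=
  (-1) ^ n * ((n : ℂ) + 1 / 2) ^ j *
    cexp (2 * Real.pi * I * (((n : ℂ) + 1 / 2) * z + ((n : ℂ) + 1 / 2) ^ 2 * τ / 2))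

/-- The `j`-th derivative, with respect to `(2πi)⁻¹ d/dz`, of the odd theta function
`∑ (-1)ⁿ exp (2πi (n + 1/2) z + πi (n + 1/2)² τ)`. -/
def theta (j : ℕ) (z τ : ℂ) : ℂ := ∑' n : ℤ, thetaTerm j z τ n

/-- Expanding (n + 1/2)² exhibits the two-variable Jacobi theta term at the shifted point `z + τ /
2`, so that the known bounds apply. The sign stays outside, since it has norm one. -/
theorem thetaTerm_eq (j : ℕ) (z τ : ℂ) (n : ℤ) :
    thetaTerm j z τ n = (-1) ^ n * ((n : ℂ) + 1 / 2) ^ j *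
      (cexp (Real.pi * I * (z + τ / 4)) * jacobiTheta₂_term n (z + τ / 2) τ) := by
  rw [thetaTerm, jacobiTheta₂_term, ← Complex.exp_add]
  congr 2
  ring

/-- A summable majorant of `thetaTerm`, uniform on strips. -/
def thetaBound (j : ℕ) (S T R : ℝ) (n : ℤ) : ℝ :=
  (|(n : ℝ)| + 1) ^ j * (Real.exp (Real.pi * (S + R)) *
    Real.exp (-Real.pi * (T * n ^ 2 - 2 * (S + R) * |(n : ℝ)|)))

theorem summable_thetaBound (j : ℕ) (S R : ℝ) {T : ℝ} (hT : 0 < T) :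
    Summable (thetaBound j S T R) := by
  have h : ∀ k : ℕ, Summable (fun n : ℤ ↦ (|(n : ℝ)| ^ k : ℝ) *
      Real.exp (-Real.pi * (T * n ^ 2 - 2 * (S + R) * |(n : ℝ)|))) := fun k => by
    simpa using summable_pow_mul_jacobiTheta₂_term_bound (S + R) hT k
  have h2 : Summable (fun n : ℤ ↦ ∑ k ∈ Finset.range (j + 1),
      ((j.choose k : ℝ) * Real.exp (Real.pi * (S + R))) * (|(n : ℝ)| ^ k *
        Real.exp (-Real.pi * (T * n ^ 2 - 2 * (S + R) * |(n : ℝ)|)))) :=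
    summable_sum fun k _ => (h k).mul_left _
  refine h2.congr fun n => ?_
  rw [thetaBound, add_pow, Finset.sum_mul]
  refine Finset.sum_congr rfl fun k _ => ?_
  rw [one_pow]
  ring

theorem norm_thetaTerm_le (j : ℕ) {S T R : ℝ} (hT : 0 < T) {z τ : ℂ} (hz : |z.im| ≤ S)
    (hτ : T ≤ τ.im) (hR : τ.im ≤ R) (n : ℤ) : ‖thetaTerm j z τ n‖ ≤ thetaBound j S T R n := by
  have hS : 0 ≤ S := (abs_nonneg _).trans hz
  have hz' := abs_le.mp hz
  rw [thetaTerm_eq, thetaBound, norm_mul, norm_mul, norm_mul, norm_pow, norm_zpow, norm_neg, norm_one,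
    one_zpow, one_mul]
  have h1 : ‖(n : ℂ) + 1 / 2‖ ≤ |(n : ℝ)| + 1 := by
    refine (norm_add_le _ _).trans ?_
    rw [Complex.norm_intCast]
    norm_num
  have h2 : ‖cexp (Real.pi * I * (z + τ / 4))‖ ≤ Real.exp (Real.pi * (S + R)) := by
    rw [Complex.norm_exp]
    apply Real.exp_le_exp.mpr
    have : (Real.pi * I * (z + τ / 4)).re = Real.pi * -(z.im + τ.im / 4) := by
      rw [mul_assoc, Complex.re_ofReal_mul, Complex.I_mul_re]
      simp
    rw [this]
    exact mul_le_mul_of_nonneg_left (by linarith) Real.pi_pos.le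
  have h3 : ‖jacobiTheta₂_term n (z + τ / 2) τ‖ ≤
      Real.exp (-Real.pi * (T * n ^ 2 - 2 * (S + R) * |(n : ℝ)|)) := by
    -- The strip is widened from `S` to `S + R` to absorb the shift of `z` by `τ / 2`.
    have := norm_jacobiTheta₂_term_le (S := S + R) hT (z := z + τ / 2) (τ := τ) ?_ hτ n
    · simpa using this
    · have : (z + τ / 2).im = z.im + τ.im / 2 := by simp
      rw [this, abs_le]
      constructor <;> linarith
  gcongr

theorem summable_norm_thetaTerm (j : ℕ) (z : ℂ) {τ : ℂ} (hτ : 0 < τ.im) :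
    Summable fun n => ‖thetaTerm j z τ n‖ :=
  Summable.of_nonneg_of_le (fun _ => norm_nonneg _)
    (norm_thetaTerm_le j hτ le_rfl le_rfl le_rfl) (summable_thetaBound j _ _ hτ)

theorem hasSum_theta (j : ℕ) (z : ℂ) {τ : ℂ} (hτ : 0 < τ.im) :
    HasSum (thetaTerm j z τ) (theta j z τ) :=
  (summable_norm_thetaTerm j z hτ).of_norm.hasSum

/-- Moving `z` brings down one factor n + 1/2 and moving `τ` brings down (n + 1/2)² / 2, so a
derivative in `τ` is half of a second derivative in `z`. This is the heat equation, term by term. -/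
theorem hasDerivAt_thetaTerm (j : ℕ) (z a τ b t : ℂ) (n : ℤ) :
    HasDerivAt (fun t => thetaTerm j (z + a * t) (τ + b * t) n)
      (2 * Real.pi * I * (a * thetaTerm (j + 1) (z + a * t) (τ + b * t) n +
        b / 2 * thetaTerm (j + 2) (z + a * t) (τ + b * t) n)) t := by
  have h1 : HasDerivAt (fun t : ℂ => 2 * Real.pi * I * (((n : ℂ) + 1 / 2) * (z + a * t) +
      ((n : ℂ) + 1 / 2) ^ 2 * (τ + b * t) / 2))
      (2 * Real.pi * I * (((n : ℂ) + 1 / 2) * a + ((n : ℂ) + 1 / 2) ^ 2 * b / 2)) t := by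
    have ha : HasDerivAt (fun t : ℂ => z + a * t) a t := by
      simpa using ((hasDerivAt_id t).const_mul a).const_add z
    have hb : HasDerivAt (fun t : ℂ => τ + b * t) b t := by
      simpa using ((hasDerivAt_id t).const_mul b).const_add τ
    exact ((ha.const_mul _).add ((hb.const_mul _).div_const 2)).const_mul _
  have h2 := (h1.cexp).const_mul ((-1) ^ n * ((n : ℂ) + 1 / 2) ^ j)
  refine h2.congr_deriv ?_
  simp only [thetaTerm]
  ring

/-- Differentiation of the theta series along complex lines; in particular the heat equation. -/
theorem hasDerivAt_theta_line (j : ℕ) (z a τ b t : ℂ) (ht : 0 < (τ + b * t).im) :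
    HasDerivAt (fun t => theta j (z + a * t) (τ + b * t))
      (2 * Real.pi * I * (a * theta (j + 1) (z + a * t) (τ + b * t) +
        b / 2 * theta (j + 2) (z + a * t) (τ + b * t))) t := by
  have hcz : Continuous fun w : ℂ => |(z + a * w).im| := by fun_prop
  have hcτ : Continuous fun w : ℂ => (τ + b * w).im := by fun_prop
  -- On the open set `U` below the imaginary parts stay in a fixed strip, with that of `τ + b * t`
  -- bounded away from zero, so a single majorant `thetaBound` permits termwise differentiation.
  set S := |(z + a * t).im| + 1
  set T := (τ + b * t).im / 2
  set R := (τ + b * t).im + 1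
  set U : Set ℂ := {w | |(z + a * w).im| < S} ∩ ({w | T < (τ + b * w).im} ∩
    {w | (τ + b * w).im < R})
  have hU : IsOpen U := (isOpen_lt hcz continuous_const).inter
    ((isOpen_lt continuous_const hcτ).inter (isOpen_lt hcτ continuous_const))
  have hT : 0 < T := half_pos ht
  have htU : t ∈ U := ⟨lt_add_one |(z + a * t).im|, half_lt_self ht, lt_add_one (τ + b * t).im⟩
  have hd : ∀ n : ℤ, DifferentiableOn ℂ (fun t => thetaTerm j (z + a * t) (τ + b * t) n) U :=
    fun n w _ => (hasDerivAt_thetaTerm j z a τ b w n).differentiableAt.differentiableWithinAt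
  have hb : ∀ (n : ℤ) (w : ℂ), w ∈ U →
      ‖thetaTerm j (z + a * w) (τ + b * w) n‖ ≤ thetaBound j S T R n :=
    fun n w hw => norm_thetaTerm_le j hT hw.1.le hw.2.1.le hw.2.2.le n
  have hs := summable_thetaBound j S R hT
  have h1 := hasSum_deriv_of_summable_norm hs hd hU hb htU
  have h2 := (differentiableOn_tsum_of_summable_norm hs hd hU hb).differentiableAt
    (hU.mem_nhds htU)
  have h3 : HasSum (fun n : ℤ => deriv (fun t => thetaTerm j (z + a * t) (τ + b * t) n) t)
      (2 * Real.pi * I * (a * theta (j + 1) (z + a * t) (τ + b * t) +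
        b / 2 * theta (j + 2) (z + a * t) (τ + b * t))) := by
    simp_rw [fun n => (hasDerivAt_thetaTerm j z a τ b t n).deriv]
    exact (((hasSum_theta _ _ ht).mul_left a).add ((hasSum_theta _ _ ht).mul_left (b / 2))).mul_left _
  have h4 := h2.hasDerivAt
  rw [h1.unique h3] at h4
  exact h4

theorem hasDerivAt_theta (j : ℕ) (z : ℂ) {τ : ℂ} (hτ : 0 < τ.im) :
    HasDerivAt (fun z => theta j z τ) (2 * Real.pi * I * theta (j + 1) z τ) z := by
  simpa using hasDerivAt_theta_line j 0 1 τ 0 z (by simpa using hτ)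

/-- The reflection n ↦ -n - 1 negates n + 1/2 and flips the sign (-1)ⁿ, which accounts for the
exponent `j + 1`. -/
theorem thetaTerm_neg (j : ℕ) (z τ : ℂ) (n : ℤ) :
    thetaTerm j (-z) τ n = (-1) ^ (j + 1) * thetaTerm j z τ (-n - 1) := by
  have h1 : ((-n - 1 : ℤ) : ℂ) + 1 / 2 = -((n : ℂ) + 1 / 2) := by push_cast; ring
  have h2 : (-1 : ℂ) ^ (-n - 1) = -(-1) ^ n := by
    rw [zpow_sub₀ (by norm_num), zpow_neg, ← inv_zpow]
    norm_num [div_neg]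
  rw [thetaTerm, thetaTerm, h1, h2, neg_pow ((n : ℂ) + 1 / 2) j, pow_succ (-1 : ℂ) j]
  have h3 : ((-1 : ℂ) ^ j) * (-1) ^ j = 1 := by rw [← mul_pow]; norm_num
  have h4 : ((n : ℂ) + 1 / 2) * -z + ((n : ℂ) + 1 / 2) ^ 2 * τ / 2 =
    -((n : ℂ) + 1 / 2) * z + (-((n : ℂ) + 1 / 2)) ^ 2 * τ / 2 := by ring
  rw [h4]
  linear_combination (-(-1) ^ n * ((n : ℂ) + 1 / 2) ^ j * cexp (2 * Real.pi * I * (-((n : ℂ) + 1 / 2)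
    * z + (-((n : ℂ) + 1 / 2)) ^ 2 * τ / 2))) * h3

theorem theta_neg (j : ℕ) (z τ : ℂ) : theta j (-z) τ = (-1) ^ (j + 1) * theta j z τ := by
  have e : ∑' n : ℤ, thetaTerm j z τ (-n - 1) = theta j z τ :=
    ((Equiv.neg ℤ).trans (Equiv.subRight 1)).tsum_eq (thetaTerm j z τ)
  rw [theta, tsum_congr (thetaTerm_neg j z τ), tsum_mul_left, e]

theorem theta_zero_of_even {j : ℕ} (hj : Even j) (τ : ℂ) : theta j 0 τ = 0 := by
  have h := theta_neg j 0 τ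
  rw [neg_zero, hj.add_one.neg_one_pow] at h
  linear_combination h / 2

theorem theta_add_one (j : ℕ) (z τ : ℂ) : theta j (z + 1) τ = -theta j z τ := by
  rw [theta, theta, ← tsum_neg]
  refine tsum_congr fun n => ?_
  have : 2 * Real.pi * I * (((n : ℂ) + 1 / 2) * (z + 1) + ((n : ℂ) + 1 / 2) ^ 2 * τ / 2) =
    2 * Real.pi * I * (((n : ℂ) + 1 / 2) * z + ((n : ℂ) + 1 / 2) ^ 2 * τ / 2) + Real.pi * I
      + n * (2 * Real.pi * I) := by ring
  rw [thetaTerm, thetaTerm, this, Complex.exp_add, Complex.exp_add, Complex.exp_pi_mul_I,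
    Complex.exp_int_mul_two_pi_mul_I]
  ring

/-- The shift by 1/2 encodes the sign (-1)ⁿ. In this form θ inherits quasi-periodicity and the
behaviour under τ ↦ -1/τ. -/
theorem theta_eq_jacobiTheta₂ (z τ : ℂ) :
    theta 0 z τ = cexp (Real.pi * I * (z + τ / 4)) * jacobiTheta₂ (z + τ / 2 + 1 / 2) τ := by
  rw [theta, jacobiTheta₂, ← tsum_mul_left]
  refine tsum_congr fun n => ?_
  have : 2 * Real.pi * I * n * (z + τ / 2 + 1 / 2) + Real.pi * I * n ^ 2 * τ =
    2 * Real.pi * I * n * (z + τ / 2) + Real.pi * I * n ^ 2 * τ + n * (Real.pi * I) := by ring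
  rw [thetaTerm_eq, jacobiTheta₂_term, jacobiTheta₂_term, this, Complex.exp_add _ (n * (Real.pi * I)),
    Complex.exp_int_mul, Complex.exp_pi_mul_I]
  ring

/-! ### The addition formula -/

/-- The even half of the product formula for theta functions. -/
def thetaEven (z τ : ℂ) : ℂ :=
  ∑' n : ℤ, cexp (2 * Real.pi * I * (2 * n * z + n ^ 2 * τ))

/-- The odd half of the product formula for theta functions. -/
def thetaOdd (z τ : ℂ) : ℂ :=
  ∑' n : ℤ, cexp (2 * Real.pi * I * ((2 * n + 1) * z + (n + 1 / 2) ^ 2 * τ))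

theorem summable_thetaEven (z : ℂ) {τ : ℂ} (hτ : 0 < τ.im) :
    Summable fun n : ℤ => ‖cexp (2 * Real.pi * I * (2 * n * z + n ^ 2 * τ))‖ := by
  have h := (summable_jacobiTheta₂_term_iff (2 * z) (2 * τ)).mpr (by simpa using hτ)
  refine h.norm.congr fun n => ?_
  rw [jacobiTheta₂_term]
  congr 2
  ring

theorem summable_thetaOdd (z : ℂ) {τ : ℂ} (hτ : 0 < τ.im) :
    Summable fun n : ℤ =>
      ‖cexp (2 * Real.pi * I * ((2 * n + 1) * z + (n + 1 / 2) ^ 2 * τ))‖ := by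
  have h := (summable_jacobiTheta₂_term_iff (2 * z + τ) (2 * τ)).mpr (by simpa using hτ)
  refine (h.norm.mul_left ‖cexp (2 * Real.pi * I * (z + τ / 4))‖).congr fun n => ?_
  rw [jacobiTheta₂_term, ← norm_mul, ← Complex.exp_add]
  congr 2
  ring

/-- Pairs of integers of equal (`inl`) or opposite (`inr`) parity. -/
def parityEquiv : (ℤ × ℤ) ⊕ (ℤ × ℤ) ≃ ℤ × ℤ where
  toFun := Sum.elim (fun u => (u.1 + u.2, u.1 - u.2)) (fun u => (u.1 + u.2, u.1 - u.2 - 1))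
  invFun v := if (v.1 - v.2) % 2 = 0 then .inl ((v.1 + v.2) / 2, (v.1 - v.2) / 2)
    else .inr ((v.1 + v.2 + 1) / 2, (v.1 - v.2 - 1) / 2)
  left_inv := by
    rintro (⟨r, s⟩ | ⟨r, s⟩)
    · have : (r + s - (r - s)) % 2 = 0 := by omega
      simp only [Sum.elim_inl, this, if_true]
      congr 2 <;> omega
    · have : ¬ (r + s - (r - s - 1)) % 2 = 0 := by omega
      simp only [Sum.elim_inr, this, if_false]
      congr 2 <;> omega
  right_inv := by
    rintro ⟨u, v⟩
    by_cases h : (u - v) % 2 = 0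
    · simp only [h, if_true, Sum.elim_inl]
      ext <;> dsimp only <;> omega
    · simp only [h, if_false, Sum.elim_inr]
      ext <;> dsimp only <;> omega

/-- In the double sum, with m = n + 1/2 for each factor, m₁ + m₂ multiplies x and m₁ - m₂ multiplies
y. These are integers of opposite parity, so the sum splits into two products of one-variable
series. The sign is constant on each part: +1 when the indices have equal parity, -1 otherwise. -/
theorem theta_mul_theta (x y : ℂ) {τ : ℂ} (hτ : 0 < τ.im) :
    theta 0 (x + y) τ * theta 0 (x - y) τ =
      thetaOdd x τ * thetaEven y τ - thetaEven x τ * thetaOdd y τ := by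
  have hA := summable_norm_thetaTerm 0 (x + y) hτ
  have hB := summable_norm_thetaTerm 0 (x - y) hτ
  rw [theta, theta, tsum_mul_tsum_of_summable_norm hA hB,
    ← parityEquiv.tsum_eq (fun c => thetaTerm 0 (x + y) τ c.1 * thetaTerm 0 (x - y) τ c.2)]
  have hs : Summable fun c => thetaTerm 0 (x + y) τ (parityEquiv c).1 *
      thetaTerm 0 (x - y) τ (parityEquiv c).2 :=
    parityEquiv.summable_iff.mpr (summable_mul_of_summable_norm hA hB)
  have hO := fun z => summable_thetaOdd z hτ
  have hE := fun z => summable_thetaEven z hτ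
  have hsplit := (hs.comp_injective Sum.inl_injective).tsum_sum (hs.comp_injective Sum.inr_injective)
  refine hsplit.trans ((congrArg₂ (· + ·) ?_ ?_).trans (sub_eq_add_neg _ _).symm)
  · rw [thetaOdd, thetaEven, tsum_mul_tsum_of_summable_norm (hO x) (hE y)]
    refine tsum_congr fun c => ?_
    simp only [parityEquiv, Equiv.coe_fn_mk, Sum.elim_inl, thetaTerm, pow_zero, mul_one]
    have h : (-1 : ℂ) ^ (c.1 + c.2) * (-1) ^ (c.1 - c.2) = 1 := by
      rw [← zpow_add₀ (by norm_num), show c.1 + c.2 + (c.1 - c.2) = 2 * c.1 by ring, zpow_mul]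
      norm_num
    rw [mul_mul_mul_comm, h, one_mul, ← Complex.exp_add, ← Complex.exp_add]
    congr 1
    push_cast
    ring
  · rw [thetaOdd, thetaEven, tsum_mul_tsum_of_summable_norm (hE x) (hO y), ← tsum_neg]
    refine tsum_congr fun c => ?_
    simp only [parityEquiv, Equiv.coe_fn_mk, Sum.elim_inr, thetaTerm, pow_zero, mul_one]
    have h : (-1 : ℂ) ^ (c.1 + c.2) * (-1) ^ (c.1 - c.2 - 1) = -1 := by
      rw [← zpow_add₀ (by norm_num), show c.1 + c.2 + (c.1 - c.2 - 1) = 2 * c.1 - 1 by ring,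
        zpow_sub₀ (by norm_num), zpow_mul]
      norm_num
    rw [mul_mul_mul_comm, h, neg_one_mul, ← Complex.exp_add, ← Complex.exp_add]
    congr 2
    push_cast
    ring

/-- Weierstrass' three-term relation. -/
theorem theta_three_term (a b c d : ℂ) {τ : ℂ} (hτ : 0 < τ.im) :
    theta 0 (a + b) τ * theta 0 (a - b) τ * (theta 0 (c + d) τ * theta 0 (c - d) τ) -
      theta 0 (a + c) τ * theta 0 (a - c) τ * (theta 0 (b + d) τ * theta 0 (b - d) τ) +
      theta 0 (a + d) τ * theta 0 (a - d) τ * (theta 0 (b + c) τ * theta 0 (b - c) τ) = 0 := by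
  -- Each product of two thetas is a 2 × 2 minor of the matrix with columns (`thetaOdd`,
  -- `thetaEven`) at the four points, so what remains is the Plücker relation.
  simp only [theta_mul_theta _ _ hτ]
  ring

/-- The derivative of the three-term relation at `d = c`. -/
theorem theta_three_term_deriv (x y z : ℂ) {τ : ℂ} (hτ : 0 < τ.im) :
    theta 1 0 τ * theta 0 (x + y) τ * theta 0 (y + z) τ * theta 0 (z + x) τ =
      theta 0 (x + y + z) τ * theta 0 z τ *
          (theta 1 x τ * theta 0 y τ + theta 0 x τ * theta 1 y τ) +
        theta 0 x τ * theta 0 y τ *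
          (theta 0 (x + y + z) τ * theta 1 z τ - theta 1 (x + y + z) τ * theta 0 z τ) := by
  -- Chosen so that a + c, a - c, b - c and b + c become x, -y, z and x + y + z.
  set a := (x - y) / 2 with ha
  set c := (x + y) / 2 with hc
  set b := z + (x + y) / 2 with hb
  have hp : ∀ e d : ℂ, HasDerivAt (fun d => theta 0 (e + d) τ)
      (2 * Real.pi * I * theta 1 (e + d) τ) d := fun e d =>
    (hasDerivAt_theta 0 (e + d) hτ).comp_const_add e d
  have hm : ∀ e d : ℂ, HasDerivAt (fun d => theta 0 (e - d) τ)
      (-(2 * Real.pi * I * theta 1 (e - d) τ)) d := fun e d =>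
    (hasDerivAt_theta 0 (e - d) hτ).comp_const_sub e d
  have h1 := ((((hp c c).mul (hm c c)).const_mul (theta 0 (a + b) τ * theta 0 (a - b) τ)).sub
    (((hp b c).mul (hm b c)).const_mul (theta 0 (a + c) τ * theta 0 (a - c) τ))).add
    (((hp a c).mul (hm a c)).mul_const (theta 0 (b + c) τ * theta 0 (b - c) τ))
  have h2 : HasDerivAt (fun _ : ℂ => (0 : ℂ)) 0 c := hasDerivAt_const _ _
  have h3 := h1.unique (h2.congr_of_eventuallyEq
    (Eventually.of_forall fun d => theta_three_term a b c d hτ))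
  have e1 : c + c = x + y := by rw [hc]; ring
  have e2 : a + b = z + x := by rw [ha, hb]; ring
  have e3 : a - b = -(y + z) := by rw [ha, hb]; ring
  have e4 : a + c = x := by rw [ha, hc]; ring
  have e5 : a - c = -y := by rw [ha, hc]; ring
  have e6 : b + c = x + y + z := by rw [hb, hc]; ring
  have e7 : b - c = z := by rw [hb, hc]; ring
  rw [sub_self, theta_zero_of_even Even.zero, e1, e2, e3, e4, e5, e6, e7, theta_neg, theta_neg,
    theta_neg] at h3
  have hpi : (2 * Real.pi * I : ℂ) ≠ 0 := Complex.two_pi_I_ne_zero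
  apply mul_left_cancel₀ hpi
  linear_combination h3

/-! ### Logarithmic derivatives of the theta function -/

/-- The logarithmic derivative of the odd theta function. -/
def thetaJ (z τ : ℂ) : ℂ := theta 1 z τ / theta 0 z τ

/-- Minus the derivative of `thetaJ`, a Weierstrass `℘`-function up to normalization. -/
def thetaP (z τ : ℂ) : ℂ := thetaJ z τ ^ 2 - theta 2 z τ / theta 0 z τ

/-- The first derivative of `thetaP`. -/
def thetaPDer (z τ : ℂ) : ℂ :=
  3 * thetaJ z τ * (theta 2 z τ / theta 0 z τ) - 2 * thetaJ z τ ^ 3 - theta 3 z τ / theta 0 z τ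

/-- The second derivative of `thetaP`. -/
def thetaPDer₂ (z τ : ℂ) : ℂ :=
  3 * (theta 2 z τ / theta 0 z τ) ^ 2 - 12 * thetaJ z τ ^ 2 * (theta 2 z τ / theta 0 z τ) +
    4 * thetaJ z τ * (theta 3 z τ / theta 0 z τ) + 6 * thetaJ z τ ^ 4 - theta 4 z τ / theta 0 z τ

/-- The quotient `θ'''(0) / θ'(0)`. -/
def thetaT (τ : ℂ) : ℂ := theta 3 0 τ / theta 1 0 τ

theorem hasDerivAt_unique_of_eventuallyEq {f g : ℂ → ℂ} {f' g' x : ℂ} (hf : HasDerivAt f f' x)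
    (hg : HasDerivAt g g' x) (h : f =ᶠ[𝓝 x] g) : f' = g' :=
  hf.unique (hg.congr_of_eventuallyEq h)

section FixedTau

variable {τ : ℂ}

theorem eventually_theta_ne_zero (hτ : 0 < τ.im) {z : ℂ} (hz : theta 0 z τ ≠ 0) :
    ∀ᶠ w in 𝓝 z, theta 0 w τ ≠ 0 :=
  (hasDerivAt_theta 0 z hτ).continuousAt.eventually_ne hz

theorem hasDerivAt_theta_div (j : ℕ) (hτ : 0 < τ.im) {z : ℂ} (hz : theta 0 z τ ≠ 0) :
    HasDerivAt (fun z => theta j z τ / theta 0 z τ)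
      (2 * Real.pi * I * (theta (j + 1) z τ / theta 0 z τ -
        theta j z τ / theta 0 z τ * thetaJ z τ)) z := by
  refine ((hasDerivAt_theta j z hτ).div (hasDerivAt_theta 0 z hτ) hz).congr_deriv ?_
  rw [thetaJ]
  field_simp

theorem hasDerivAt_thetaJ (hτ : 0 < τ.im) {z : ℂ} (hz : theta 0 z τ ≠ 0) :
    HasDerivAt (fun z => thetaJ z τ) (2 * Real.pi * I * -thetaP z τ) z := by
  refine (hasDerivAt_theta_div 1 hτ hz).congr_deriv ?_
  rw [thetaP, thetaJ]
  ring

theorem hasDerivAt_thetaP (hτ : 0 < τ.im) {z : ℂ} (hz : theta 0 z τ ≠ 0) :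
    HasDerivAt (fun z => thetaP z τ) (2 * Real.pi * I * thetaPDer z τ) z := by
  refine (((hasDerivAt_thetaJ hτ hz).pow 2).sub (hasDerivAt_theta_div 2 hτ hz)).congr_deriv ?_
  rw [thetaPDer, thetaP]
  push_cast
  ring

theorem hasDerivAt_thetaPDer (hτ : 0 < τ.im) {z : ℂ} (hz : theta 0 z τ ≠ 0) :
    HasDerivAt (fun z => thetaPDer z τ) (2 * Real.pi * I * thetaPDer₂ z τ) z := by
  have hJ := hasDerivAt_thetaJ hτ hz
  refine ((((hJ.const_mul 3).mul (hasDerivAt_theta_div 2 hτ hz)).sub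
    ((hJ.pow 3).const_mul 2)).sub (hasDerivAt_theta_div 3 hτ hz)).congr_deriv ?_
  rw [thetaPDer₂, thetaP]
  push_cast
  ring

theorem thetaJ_neg (z : ℂ) : thetaJ (-z) τ = -thetaJ z τ := by
  rw [thetaJ, thetaJ, theta_neg, theta_neg]
  ring

theorem thetaP_neg (z : ℂ) : thetaP (-z) τ = thetaP z τ := by
  rw [thetaP, thetaP, thetaJ_neg, theta_neg, theta_neg]
  ring

/-- The four-term product formula. -/
theorem thetaJ_add_add (hτ : 0 < τ.im) {x y z : ℂ} (hx : theta 0 x τ ≠ 0) (hy : theta 0 y τ ≠ 0)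
    (hz : theta 0 z τ ≠ 0) (hs : theta 0 (x + y + z) τ ≠ 0) :
    thetaJ x τ + thetaJ y τ + thetaJ z τ - thetaJ (x + y + z) τ =
      theta 1 0 τ * theta 0 (x + y) τ * theta 0 (y + z) τ * theta 0 (z + x) τ /
        (theta 0 x τ * theta 0 y τ * theta 0 z τ * theta 0 (x + y + z) τ) := by
  rw [theta_three_term_deriv x y z hτ]
  simp only [thetaJ]
  field_simp
  ring

/-- The second derivative at z = 0 of `theta_three_term_deriv`. The value and the first derivative
there are trivial identities, so this is the first order that carries information. -/
theorem theta_three_term_deriv_deriv (x y : ℂ) (hτ : 0 < τ.im) :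
    theta 1 0 τ * theta 0 (x + y) τ * (theta 2 y τ * theta 0 x τ +
        2 * theta 1 y τ * theta 1 x τ + theta 0 y τ * theta 2 x τ) =
      2 * theta 1 (x + y) τ * theta 1 0 τ *
          (theta 1 x τ * theta 0 y τ + theta 0 x τ * theta 1 y τ) +
        theta 0 x τ * theta 0 y τ *
          (theta 0 (x + y) τ * theta 3 0 τ - theta 2 (x + y) τ * theta 1 0 τ) := by
  have hpi : (2 * Real.pi * I : ℂ) ≠ 0 := Complex.two_pi_I_ne_zero
  have hp : ∀ (j : ℕ) (e d : ℂ), HasDerivAt (fun d => theta j (e + d) τ)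
      (2 * Real.pi * I * theta (j + 1) (e + d) τ) d := fun j e d =>
    (hasDerivAt_theta j (e + d) hτ).comp_const_add e d
  have h0 : ∀ (j : ℕ) (d : ℂ), HasDerivAt (fun d => theta j d τ)
      (2 * Real.pi * I * theta (j + 1) d τ) d := fun j d => hasDerivAt_theta j d hτ
  have first : ∀ z, theta 1 0 τ * theta 0 (x + y) τ *
      (theta 1 (y + z) τ * theta 0 (x + z) τ + theta 0 (y + z) τ * theta 1 (x + z) τ) =
      (theta 1 x τ * theta 0 y τ + theta 0 x τ * theta 1 y τ) *
        (theta 1 (x + y + z) τ * theta 0 z τ + theta 0 (x + y + z) τ * theta 1 z τ) +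
      theta 0 x τ * theta 0 y τ *
        (theta 0 (x + y + z) τ * theta 2 z τ - theta 2 (x + y + z) τ * theta 0 z τ) := by
    intro z
    have hl := ((hp 0 y z).mul (hp 0 x z)).const_mul (theta 1 0 τ * theta 0 (x + y) τ)
    have hr := (((hp 0 (x + y) z).mul (h0 0 z)).const_mul
      (theta 1 x τ * theta 0 y τ + theta 0 x τ * theta 1 y τ)).add
      ((((hp 0 (x + y) z).mul (h0 1 z)).sub ((hp 1 (x + y) z).mul (h0 0 z))).const_mul
        (theta 0 x τ * theta 0 y τ))
    have h := hasDerivAt_unique_of_eventuallyEq hl hr (Eventually.of_forall fun w => by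
      have := theta_three_term_deriv x y w hτ
      rw [add_comm w x] at this
      simp only [Pi.mul_apply, Pi.add_apply, Pi.sub_apply]
      linear_combination this)
    apply mul_left_cancel₀ hpi
    linear_combination h
  have hl := (((hp 1 y 0).mul (hp 0 x 0)).add ((hp 0 y 0).mul (hp 1 x 0))).const_mul
    (theta 1 0 τ * theta 0 (x + y) τ)
  have hr := ((((hp 1 (x + y) 0).mul (h0 0 0)).add ((hp 0 (x + y) 0).mul (h0 1 0))).const_mul
      (theta 1 x τ * theta 0 y τ + theta 0 x τ * theta 1 y τ)).add
      ((((hp 0 (x + y) 0).mul (h0 2 0)).sub ((hp 2 (x + y) 0).mul (h0 0 0))).const_mul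
        (theta 0 x τ * theta 0 y τ))
  have h := hasDerivAt_unique_of_eventuallyEq hl hr (Eventually.of_forall first)
  have e2 : theta (1 + 1) 0 τ = 0 := theta_zero_of_even (by decide) τ
  have e0 : theta 0 0 τ = 0 := theta_zero_of_even Even.zero τ
  simp only [add_zero, e2, e0] at h
  apply mul_left_cancel₀ hpi
  linear_combination h

/-- The relation `(ζ(x) + ζ(y) - ζ(x + y))² = ℘(x) + ℘(y) + ℘(x + y)`. -/
theorem thetaJ_add_sq (hτ : 0 < τ.im) (h1 : theta 1 0 τ ≠ 0) {x y : ℂ} (hx : theta 0 x τ ≠ 0)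
    (hy : theta 0 y τ ≠ 0) (hs : theta 0 (x + y) τ ≠ 0) :
    (thetaJ x τ + thetaJ y τ - thetaJ (x + y) τ) ^ 2 =
      thetaP x τ + thetaP y τ + thetaP (x + y) τ + thetaT τ := by
  have h := theta_three_term_deriv_deriv x y hτ
  have h' : theta 2 y τ / theta 0 y τ + 2 * thetaJ y τ * thetaJ x τ + theta 2 x τ / theta 0 x τ =
      2 * thetaJ (x + y) τ * (thetaJ x τ + thetaJ y τ) + thetaT τ -
        theta 2 (x + y) τ / theta 0 (x + y) τ := by
    simp only [thetaJ, thetaT]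
    field_simp
    linear_combination h
  simp only [thetaP]
  linear_combination h'

section Derivatives

variable (hτ : 0 < τ.im) (h1 : theta 1 0 τ ≠ 0) {x y : ℂ} (hx : theta 0 x τ ≠ 0)
  (hy : theta 0 y τ ≠ 0) (hs : theta 0 (x + y) τ ≠ 0)

include hτ h1 hx hy hs

/-- The derivative of `thetaJ_add_sq` in `x`, all normalized derivatives of J being -P. -/
theorem thetaPDer_left_add :
    thetaPDer x τ + thetaPDer (x + y) τ = 2 * (thetaJ x τ + thetaJ y τ - thetaJ (x + y) τ) *
      (thetaP (x + y) τ - thetaP x τ) := by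
  have hev : ∀ᶠ w in 𝓝 x, theta 0 w τ ≠ 0 ∧ theta 0 (w + y) τ ≠ 0 :=
    (eventually_theta_ne_zero hτ hx).and
      ((continuous_add_const y).continuousAt.eventually (eventually_theta_ne_zero hτ hs))
  have hl := (((hasDerivAt_thetaJ hτ hx).add_const (thetaJ y τ)).sub
    ((hasDerivAt_thetaJ hτ hs).comp_add_const x y)).pow 2
  have hr := (((hasDerivAt_thetaP hτ hx).add_const (thetaP y τ)).add
    ((hasDerivAt_thetaP hτ hs).comp_add_const x y)).add_const (thetaT τ)
  have h := hasDerivAt_unique_of_eventuallyEq hl hr (hev.mono fun w hw =>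
    thetaJ_add_sq hτ h1 hw.1 hy hw.2)
  apply mul_left_cancel₀ Complex.two_pi_I_ne_zero
  simp only [Pi.sub_apply] at h
  push_cast at h
  linear_combination -h

theorem thetaPDer_right_add :
    thetaPDer y τ + thetaPDer (x + y) τ = 2 * (thetaJ x τ + thetaJ y τ - thetaJ (x + y) τ) *
      (thetaP (x + y) τ - thetaP y τ) := by
  rw [add_comm x y] at hs ⊢
  linear_combination thetaPDer_left_add hτ h1 hy hx hs

theorem thetaPDer₂_left_add :
    thetaPDer₂ x τ + thetaPDer₂ (x + y) τ = 2 * (thetaP (x + y) τ - thetaP x τ) ^ 2 +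
      2 * (thetaJ x τ + thetaJ y τ - thetaJ (x + y) τ) *
        (thetaPDer (x + y) τ - thetaPDer x τ) := by
  have hev : ∀ᶠ w in 𝓝 x, theta 0 w τ ≠ 0 ∧ theta 0 (w + y) τ ≠ 0 :=
    (eventually_theta_ne_zero hτ hx).and
      ((continuous_add_const y).continuousAt.eventually (eventually_theta_ne_zero hτ hs))
  have hl := (hasDerivAt_thetaPDer hτ hx).add ((hasDerivAt_thetaPDer hτ hs).comp_add_const x y)
  have hr := ((((hasDerivAt_thetaJ hτ hx).add_const (thetaJ y τ)).sub
    ((hasDerivAt_thetaJ hτ hs).comp_add_const x y)).const_mul 2).mul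
    (((hasDerivAt_thetaP hτ hs).comp_add_const x y).sub (hasDerivAt_thetaP hτ hx))
  have h := hasDerivAt_unique_of_eventuallyEq hl hr (hev.mono fun w hw =>
    thetaPDer_left_add hτ h1 hw.1 hy hw.2)
  apply mul_left_cancel₀ Complex.two_pi_I_ne_zero
  simp only [Pi.sub_apply] at h
  linear_combination h

theorem thetaPDer₂_right_add :
    thetaPDer₂ y τ + thetaPDer₂ (x + y) τ = 2 * (thetaP (x + y) τ - thetaP y τ) ^ 2 +
      2 * (thetaJ x τ + thetaJ y τ - thetaJ (x + y) τ) *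
        (thetaPDer (x + y) τ - thetaPDer y τ) := by
  rw [add_comm x y] at hs ⊢
  linear_combination thetaPDer₂_left_add hτ h1 hy hx hs

/-- The mixed derivative: `thetaPDer_left_add` differentiated in `y`, so that the term at `x` alone
disappears. -/
theorem thetaPDer₂_add :
    thetaPDer₂ (x + y) τ = 2 * (thetaP (x + y) τ - thetaP x τ) *
        (thetaP (x + y) τ - thetaP y τ) +
      2 * (thetaJ x τ + thetaJ y τ - thetaJ (x + y) τ) * thetaPDer (x + y) τ := by
  have hev : ∀ᶠ w in 𝓝 y, theta 0 w τ ≠ 0 ∧ theta 0 (x + w) τ ≠ 0 :=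
    (eventually_theta_ne_zero hτ hy).and
      ((continuous_const_add x).continuousAt.eventually (eventually_theta_ne_zero hτ hs))
  have hl := ((hasDerivAt_thetaPDer hτ hs).comp_const_add x y).const_add (thetaPDer x τ)
  have hr := ((((hasDerivAt_thetaJ hτ hy).const_add (thetaJ x τ)).sub
    ((hasDerivAt_thetaJ hτ hs).comp_const_add x y)).const_mul 2).mul
    (((hasDerivAt_thetaP hτ hs).comp_const_add x y).sub_const (thetaP x τ))
  have h := hasDerivAt_unique_of_eventuallyEq hl hr (hev.mono fun w hw =>
    thetaPDer_left_add hτ h1 hx hw.1 hw.2)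
  apply mul_left_cancel₀ Complex.two_pi_I_ne_zero
  simp only [Pi.sub_apply] at h
  linear_combination h

end Derivatives

end FixedTau

/-! ### Derivatives along torsion sections `z = v τ` -/

section Section

variable {τ : ℂ} (v : ℂ)

theorem hasDerivAt_theta_section (j : ℕ) (hτ : 0 < τ.im) :
    HasDerivAt (fun τ => theta j (v * τ) τ)
      (2 * Real.pi * I * (v * theta (j + 1) (v * τ) τ + 1 / 2 * theta (j + 2) (v * τ) τ)) τ := by
  simpa using hasDerivAt_theta_line j 0 v 0 1 τ (by simpa using hτ)

theorem hasDerivAt_theta_zero (j : ℕ) (hτ : 0 < τ.im) :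
    HasDerivAt (fun τ => theta j 0 τ) (2 * Real.pi * I * (1 / 2 * theta (j + 2) 0 τ)) τ := by
  simpa using hasDerivAt_theta_section 0 j hτ

variable {v}

theorem hasDerivAt_theta_div_section (j : ℕ) (hτ : 0 < τ.im) (hz : theta 0 (v * τ) τ ≠ 0) :
    HasDerivAt (fun τ => theta j (v * τ) τ / theta 0 (v * τ) τ)
      (2 * Real.pi * I * (v * (theta (j + 1) (v * τ) τ / theta 0 (v * τ) τ) +
        1 / 2 * (theta (j + 2) (v * τ) τ / theta 0 (v * τ) τ) -
        theta j (v * τ) τ / theta 0 (v * τ) τ * (v * thetaJ (v * τ) τ +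
          1 / 2 * (theta 2 (v * τ) τ / theta 0 (v * τ) τ)))) τ := by
  refine ((hasDerivAt_theta_section v j hτ).div (hasDerivAt_theta_section v 0 hτ) hz).congr_deriv ?_
  rw [thetaJ]
  field_simp

/-- J enters through J + v, the combination that does not change under v ↦ v + 1, because J drops by
1 when its argument moves by τ. -/
theorem hasDerivAt_thetaJ_section (hτ : 0 < τ.im) (hz : theta 0 (v * τ) τ ≠ 0) :
    HasDerivAt (fun τ => thetaJ (v * τ) τ)
      (2 * Real.pi * I * (-(thetaJ (v * τ) τ + v) * thetaP (v * τ) τ -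
        1 / 2 * thetaPDer (v * τ) τ)) τ := by
  refine (hasDerivAt_theta_div_section 1 hτ hz).congr_deriv ?_
  rw [thetaP, thetaPDer, thetaJ]
  ring

theorem hasDerivAt_thetaP_section (hτ : 0 < τ.im) (hz : theta 0 (v * τ) τ ≠ 0) :
    HasDerivAt (fun τ => thetaP (v * τ) τ)
      (2 * Real.pi * I * (-thetaP (v * τ) τ ^ 2 + (thetaJ (v * τ) τ + v) * thetaPDer (v * τ) τ +
        1 / 2 * thetaPDer₂ (v * τ) τ)) τ := by
  refine (((hasDerivAt_thetaJ_section hτ hz).pow 2).sub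
    (hasDerivAt_theta_div_section 2 hτ hz)).congr_deriv ?_
  rw [thetaPDer₂, thetaPDer, thetaP]
  push_cast
  ring

theorem eventually_theta_section_ne_zero (hτ : 0 < τ.im) (hz : theta 0 (v * τ) τ ≠ 0) :
    ∀ᶠ w in 𝓝 τ, theta 0 (v * w) w ≠ 0 :=
  (hasDerivAt_theta_section v 0 hτ).continuousAt.eventually_ne hz

/-- The derivative of `θ'''(0) / θ'(0)` in terms of values of `℘` and its derivative. -/
theorem hasDerivAt_thetaT (hτ : 0 < τ.im) (h1 : theta 1 0 τ ≠ 0) {u : ℂ}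
    (hv : theta 0 (v * τ) τ ≠ 0) (hu : theta 0 (u * τ) τ ≠ 0)
    (hs : theta 0 ((v + u) * τ) τ ≠ 0) :
    HasDerivAt thetaT (2 * Real.pi * I *
      (thetaP (v * τ) τ * thetaP (u * τ) τ + thetaP (v * τ) τ * thetaP ((v + u) * τ) τ +
        thetaP (u * τ) τ * thetaP ((v + u) * τ) τ -
        (thetaPDer (v * τ) τ + 2 * (thetaJ (v * τ) τ + thetaJ (u * τ) τ -
          thetaJ ((v + u) * τ) τ) * thetaP (v * τ) τ) *
          (thetaJ (v * τ) τ + thetaJ (u * τ) τ - thetaJ ((v + u) * τ) τ))) τ := by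
  -- The heat equation applied directly to `thetaT` would produce fifth derivatives of θ at 0. The
  -- addition formula at the two sections expresses `thetaT` near `τ` through J and P, whose
  -- derivatives along sections are known.
  have hev : ∀ᶠ w : ℂ in 𝓝 τ, thetaT w = (thetaJ (v * w) w + thetaJ (u * w) w -
      thetaJ ((v + u) * w) w) ^ 2 - (thetaP (v * w) w + thetaP (u * w) w +
        thetaP ((v + u) * w) w) := by
    filter_upwards [eventually_theta_section_ne_zero hτ hv, eventually_theta_section_ne_zero hτ hu,
      eventually_theta_section_ne_zero hτ hs,
      (hasDerivAt_theta_zero 1 hτ).continuousAt.eventually_ne h1,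
      (isOpen_lt continuous_const Complex.continuous_im).mem_nhds hτ] with w hv hu hs h1 hw
    rw [add_mul] at hs ⊢
    rw [thetaJ_add_sq hw h1 hv hu hs]
    ring
  have h := (((((hasDerivAt_thetaJ_section hτ hv).add (hasDerivAt_thetaJ_section hτ hu)).sub
    (hasDerivAt_thetaJ_section hτ hs)).pow 2).sub (((hasDerivAt_thetaP_section hτ hv).add
      (hasDerivAt_thetaP_section hτ hu)).add (hasDerivAt_thetaP_section hτ hs)))
  refine (h.congr_of_eventuallyEq hev).congr_deriv ?_
  rw [add_mul] at hs
  have c1 := thetaPDer_left_add hτ h1 hv hu hs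
  have c2 := thetaPDer_right_add hτ h1 hv hu hs
  have c3 := thetaPDer₂_add hτ h1 hv hu hs
  have c4 := thetaPDer₂_left_add hτ h1 hv hu hs
  have c5 := thetaPDer₂_right_add hτ h1 hv hu hs
  simp only [Pi.add_apply, Pi.sub_apply, add_mul] at *
  push_cast
  generalize thetaJ (v * τ) τ = Jv at *
  generalize thetaJ (u * τ) τ = Ju at *
  generalize thetaJ (v * τ + u * τ) τ = Js at *
  generalize thetaP (v * τ) τ = Pv at *
  generalize thetaP (u * τ) τ = Pu at *
  generalize thetaP (v * τ + u * τ) τ = Ps at *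
  generalize thetaPDer (v * τ) τ = Dv at *
  generalize thetaPDer (u * τ) τ = Du at *
  generalize thetaPDer (v * τ + u * τ) τ = Ds at *
  -- First derivatives of P at `v` and `u` are eliminated in favour of the one at the sum. The three
  -- second derivatives occur only through their sum, which is `c4 + c5 - c3`.
  obtain rfl : Dv = 2 * (Jv + Ju - Js) * (Ps - Pv) - Ds := by linear_combination c1
  obtain rfl : Du = 2 * (Jv + Ju - Js) * (Ps - Pu) - Ds := by linear_combination c2
  linear_combination (-(2 * Real.pi * I) / 2) * c4 + (-(2 * Real.pi * I) / 2) * c5 +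
    (2 * Real.pi * I) / 2 * c3

end Section

/-! ### `q`-Pochhammer symbols -/

theorem summable_qPoch_term (a : ℂ) {q : ℂ} (hq : ‖q‖ < 1) :
    Summable fun k : ℕ => ‖-(a * q ^ k)‖ := by
  simp_rw [norm_neg, norm_mul, norm_pow]
  exact (summable_geometric_of_lt_one (norm_nonneg q) hq).mul_left _

theorem multipliable_qPoch (a : ℂ) {q : ℂ} (hq : ‖q‖ < 1) :
    Multipliable fun k : ℕ => 1 - a * q ^ k := by
  simpa [sub_eq_add_neg] using multipliable_one_add_of_summable (summable_qPoch_term a hq)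

theorem qPoch_ne_zero {a q : ℂ} (hq : ‖q‖ < 1) (h : ∀ k : ℕ, 1 - a * q ^ k ≠ 0) :
    qPoch a q ≠ 0 := by
  have := tprod_one_add_ne_zero_of_summable (f := fun k : ℕ => -(a * q ^ k))
    (by simpa [sub_eq_add_neg] using h) (summable_qPoch_term a hq)
  simpa [qPoch, sub_eq_add_neg] using this

theorem qPoch_eq_mul (a : ℂ) {q : ℂ} (hq : ‖q‖ < 1) :
    qPoch a q = (1 - a) * qPoch (a * q) q := by
  have h : (fun k : ℕ => 1 - a * q ^ (k + 1)) = fun k : ℕ => 1 - a * q * q ^ k := by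
    funext k
    ring
  rw [qPoch, tprod_eq_zero_mul' (by rw [h]; exact multipliable_qPoch (a * q) hq), pow_zero, mul_one,
    h, qPoch]

theorem tendsto_qPoch (a : ℂ) {q : ℂ} (hq : ‖q‖ < 1) :
    Tendsto (fun n => ∏ k ∈ Finset.range n, (1 - a * q ^ k)) atTop (𝓝 (qPoch a q)) :=
  (multipliable_qPoch a hq).tendsto_prod_tprod_nat

theorem one_sub_pow_ne_zero {q : ℂ} (hq : ‖q‖ < 1) {n : ℕ} (hn : n ≠ 0) : 1 - q ^ n ≠ 0 := by
  intro h
  have h1 : ‖q ^ n‖ < 1 := by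
    rw [norm_pow]
    exact pow_lt_one₀ (norm_nonneg q) hq hn
  rw [← sub_eq_zero.mp h, norm_one] at h1
  exact lt_irrefl _ h1

theorem qPoch_self_ne_zero {q : ℂ} (hq : ‖q‖ < 1) : qPoch q q ≠ 0 :=
  qPoch_ne_zero hq fun k => by
    rw [← pow_succ']
    exact one_sub_pow_ne_zero hq k.succ_ne_zero

theorem multipliableLocallyUniformlyOn_qPoch {q : ℂ} (hq : ‖q‖ < 1) (R : ℝ) :
    MultipliableLocallyUniformlyOn (fun (k : ℕ) (a : ℂ) => 1 - a * q ^ k) (Metric.ball 0 R) := by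
  have hu : Summable fun k : ℕ => R * ‖q‖ ^ k :=
    (summable_geometric_of_lt_one (norm_nonneg q) hq).mul_left _
  have := Summable.multipliableLocallyUniformlyOn_nat_one_add (f := fun (k : ℕ) (a : ℂ) => -(a * q ^ k))
    (K := Metric.ball 0 R) Metric.isOpen_ball hu (Eventually.of_forall fun k a ha => by
      rw [norm_neg, norm_mul, norm_pow]
      exact mul_le_mul_of_nonneg_right (by simpa using (Metric.mem_ball.mp ha).le) (by positivity))
    (fun k => by fun_prop)
  simpa [sub_eq_add_neg] using this

theorem differentiable_qPoch {q : ℂ} (hq : ‖q‖ < 1) : Differentiable ℂ fun a => qPoch a q := by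
  intro a
  have ha : a ∈ Metric.ball (0 : ℂ) (‖a‖ + 1) := by simp
  have := (multipliableLocallyUniformlyOn_qPoch hq
    (‖a‖ + 1)).hasProdLocallyUniformlyOn.differentiableOn (Eventually.of_forall fun s => by
      simpa [Finset.prod_fn] using DifferentiableOn.finsetProd (fun _ _ => by fun_prop))
    Metric.isOpen_ball
  exact this.differentiableAt (Metric.isOpen_ball.mem_nhds ha)

theorem summable_qPoch_logDeriv {a q : ℂ} (hq : ‖q‖ < 1) :
    Summable fun k : ℕ => a * q ^ k / (1 - a * q ^ k) := by
  have h0 : Tendsto (fun k : ℕ => a * q ^ k) atTop (𝓝 0) := by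
    simpa using (tendsto_pow_atTop_nhds_zero_of_norm_lt_one hq).const_mul a
  have h1 : ∀ᶠ k : ℕ in atTop, ‖a * q ^ k‖ < 1 / 2 := by
    have := h0.norm
    rw [norm_zero] at this
    exact this.eventually_lt_const (by norm_num)
  have hs : Summable fun k : ℕ => 2 * ‖-(a * q ^ k)‖ := (summable_qPoch_term a hq).mul_left 2
  refine Summable.of_norm_bounded_eventually_nat hs (h1.mono fun k hk => ?_)
  have h2 : 1 / 2 ≤ ‖1 - a * q ^ k‖ := by
    have := norm_sub_norm_le (1 : ℂ) (a * q ^ k)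
    rw [norm_one] at this
    linarith
  rw [norm_div, norm_neg, div_le_iff₀ (by linarith)]
  nlinarith [norm_nonneg (a * q ^ k)]

theorem hasDerivAt_qPoch {a q : ℂ} (hq : ‖q‖ < 1) (ha : a ≠ 0) (h : ∀ k : ℕ, 1 - a * q ^ k ≠ 0) :
    HasDerivAt (fun a => qPoch a q)
      (-a⁻¹ * (∑' k : ℕ, a * q ^ k / (1 - a * q ^ k)) * qPoch a q) a := by
  have hmem : a ∈ Metric.ball (0 : ℂ) (‖a‖ + 1) := by simp
  have hl : ∀ k : ℕ, logDeriv (fun a : ℂ => 1 - a * q ^ k) a =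
      -a⁻¹ * (a * q ^ k / (1 - a * q ^ k)) := by
    intro k
    rw [logDeriv_apply, show deriv (fun a : ℂ => 1 - a * q ^ k) a = -q ^ k by simp]
    field_simp
  have h1 := logDeriv_tprod_eq_tsum Metric.isOpen_ball hmem h
    (fun k => by fun_prop) (by
      simp_rw [hl]
      exact (summable_qPoch_logDeriv hq).mul_left _)
    (multipliableLocallyUniformlyOn_qPoch hq (‖a‖ + 1)) (qPoch_ne_zero hq h)
  simp_rw [hl] at h1
  rw [tsum_mul_left] at h1
  refine (differentiable_qPoch hq a).hasDerivAt.congr_deriv ?_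
  rw [← h1, logDeriv_apply]
  exact (div_mul_cancel₀ _ (qPoch_ne_zero hq h)).symm

/-! ### The Jacobi triple product -/

/-- `1 / (q; q)_n`, extended by zero to negative `n`. -/
def invPoch (q : ℂ) : ℤ → ℂ
  | (n : ℕ) => (∏ k ∈ Finset.range n, (1 - q * q ^ k))⁻¹
  | Int.negSucc _ => 0

theorem invPoch_of_neg (q : ℂ) {n : ℤ} (hn : n < 0) : invPoch q n = 0 := by
  obtain ⟨m, rfl⟩ := Int.eq_negSucc_of_lt_zero hn
  rfl

theorem invPoch_natCast (q : ℂ) (n : ℕ) :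
    invPoch q n = (∏ k ∈ Finset.range n, (1 - q * q ^ k))⁻¹ := rfl

theorem invPoch_sub_one {q : ℂ} (hq : ‖q‖ < 1) (n : ℤ) :
    invPoch q (n - 1) = (1 - q ^ n) * invPoch q n := by
  rcases lt_trichotomy n 0 with h | rfl | h
  · rw [invPoch_of_neg q h, invPoch_of_neg q (by omega), mul_zero]
  · rw [invPoch_of_neg q (by omega), zpow_zero, sub_self, zero_mul]
  · obtain ⟨m, rfl⟩ : ∃ m : ℕ, n = (m + 1 : ℕ) := ⟨(n - 1).toNat, by omega⟩
    rw [show (((m + 1 : ℕ) : ℤ) - 1) = (m : ℕ) by push_cast; ring, invPoch_natCast,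
      invPoch_natCast, Finset.prod_range_succ, zpow_natCast, ← pow_succ', mul_inv]
    have := one_sub_pow_ne_zero hq m.succ_ne_zero
    field_simp

theorem exists_norm_invPoch_le {q : ℂ} (hq : ‖q‖ < 1) : ∃ M : ℝ, ∀ n, ‖invPoch q n‖ ≤ M := by
  have h := ((tendsto_qPoch q hq).inv₀ (qPoch_self_ne_zero hq)).norm
  obtain ⟨M, hM⟩ := h.bddAbove_range
  refine ⟨max M 0, fun n => ?_⟩
  rcases lt_or_ge n 0 with hn | hn
  · rw [invPoch_of_neg q hn, norm_zero]
    exact le_max_right _ _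
  · lift n to ℕ using hn
    exact (hM ⟨n, rfl⟩).trans (le_max_left _ _)

theorem tendsto_invPoch {q : ℂ} (hq : ‖q‖ < 1) :
    Tendsto (invPoch q) atTop (𝓝 (qPoch q q)⁻¹) := by
  have h := (tendsto_qPoch q hq).inv₀ (qPoch_self_ne_zero hq)
  have h2 : Tendsto Int.toNat atTop atTop := by
    refine tendsto_atTop_atTop.mpr fun b => ⟨b, fun a ha => ?_⟩
    omega
  refine (h.comp h2).congr' ((eventually_ge_atTop 0).mono fun n hn => ?_)
  lift n to ℕ using hn
  rfl

theorem HasSum.congr_fun_value {ι : Type*} {f g : ι → ℂ} {a b : ℂ} (h : HasSum g b)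
    (hfg : ∀ n, f n = g n) (hab : a = b) : HasSum f a := by
  rw [hab, show f = g from funext hfg]
  exact h

/-- The coefficients (q;q)_{2N} / ((q;q)_{N+n} (q;q)_{N-n}) are Gaussian binomials, and the sum is
finite because `invPoch` vanishes at negative integers. Only the recursion of `t` is used, so the
theta terms can be inserted without normalizing them. -/
theorem finite_triple_product {q w : ℂ} (hq : ‖q‖ < 1) (hq0 : q ≠ 0) (hw : w ≠ 0) {t : ℤ → ℂ}
    (ht : ∀ n, t (n + 1) = -w * q ^ (n + 1) * t n) (N : ℕ) :
    HasSum (fun n : ℤ => (∏ k ∈ Finset.range (2 * N), (1 - q * q ^ k)) *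
        invPoch q (N + n) * invPoch q (N - n) * t n)
      (t 0 * (∏ k ∈ Finset.range N, (1 - w * q * q ^ k)) *
        ∏ k ∈ Finset.range N, (1 - w⁻¹ * q ^ k)) := by
  induction N with
  | zero =>
    have := hasSum_single (f := fun n : ℤ => (∏ k ∈ Finset.range (2 * 0), (1 - q * q ^ k)) *
        invPoch q ((0 : ℕ) + n) * invPoch q ((0 : ℕ) - n) * t n) 0 (fun n hn => by
      rcases lt_or_gt_of_ne hn with h | h
      · rw [invPoch_of_neg q (n := (0 : ℕ) + n) (by simpa using h)]
        ring
      · rw [invPoch_of_neg q (n := (0 : ℕ) - n) (by simpa using h)]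
        ring)
    simpa [show invPoch q 0 = 1 by simpa using invPoch_natCast q 0] using this
  | succ N ih =>
    have h1 := (Equiv.subRight (1 : ℤ)).hasSum_iff.mpr ih
    have h2 := (Equiv.addRight (1 : ℤ)).hasSum_iff.mpr ih
    -- The new factors multiply out as (1 - w q^(N+1)) (1 - w⁻¹ q^N) = 1 + q^(2N+1) - w q^(N+1) -
    -- w⁻¹ q^N. The powers of w are absorbed by shifting the summation index by one in either
    -- direction.
    have h := ((ih.mul_left (1 + q ^ (2 * N + 1))).sub (h1.mul_left (w * q ^ (N + 1)))).sub
      (h2.mul_left (w⁻¹ * q ^ N))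
    rw [Finset.prod_range_succ, Finset.prod_range_succ]
    refine HasSum.congr_fun_value h (fun n => ?_) ?_
    · simp only [Function.comp_apply, Equiv.subRight_apply, Equiv.coe_addRight]
      have ht1 : t n = -w * q ^ n * t (n - 1) := by
        have := ht (n - 1)
        rwa [sub_add_cancel] at this
      have hqn : ∀ m : ℤ, q ^ m ≠ 0 := fun m => zpow_ne_zero m hq0
      have ht2 : w * t (n - 1) = -(q ^ n)⁻¹ * t n := by
        rw [ht1]
        have := hqn n
        field_simp
      have ht3 : w⁻¹ * t (n + 1) = -(q ^ n * q) * t n := by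
        rw [ht n, zpow_add_one₀ hq0]
        field_simp
      set X := q ^ ((N : ℤ) + 1 + n) with hX
      set Y := q ^ ((N : ℤ) + 1 - n) with hY
      have eX : X = q ^ N * q * q ^ n := by
        rw [hX, zpow_add₀ hq0, zpow_add_one₀ hq0, zpow_natCast]
      have eY : Y = q ^ N * q * (q ^ n)⁻¹ := by
        rw [hY, zpow_sub₀ hq0, zpow_add_one₀ hq0, zpow_natCast, div_eq_mul_inv]
      have a1 : invPoch q (N + n) = (1 - X) * invPoch q (N + 1 + n) := by
        rw [← invPoch_sub_one hq]
        congr 1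
        ring
      have a2 : invPoch q (N + (n - 1)) = (1 - X * q⁻¹) * ((1 - X) * invPoch q (N + 1 + n)) := by
        rw [← a1, hX, ← zpow_sub_one₀ hq0, show (N : ℤ) + 1 + n - 1 = N + n by ring,
          ← invPoch_sub_one hq]
        congr 1
        ring
      have b1 : invPoch q (N - n) = (1 - Y) * invPoch q (N + 1 - n) := by
        rw [← invPoch_sub_one hq]
        congr 1
        ring
      have b2 : invPoch q (N - (n + 1)) = (1 - Y * q⁻¹) * ((1 - Y) * invPoch q (N + 1 - n)) := by
        rw [← b1, hY, ← zpow_sub_one₀ hq0, show (N : ℤ) + 1 - n - 1 = N - n by ring,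
          ← invPoch_sub_one hq]
        congr 1
        ring
      have a3 : (N : ℤ) + (n + 1) = N + 1 + n := by ring
      have b3 : (N : ℤ) - (n - 1) = N + 1 - n := by ring
      rw [show 2 * (N + 1) = 2 * N + 1 + 1 by ring, Finset.prod_range_succ, Finset.prod_range_succ,
        a1, a2, b1, b2, a3, b3]
      push_cast
      generalize invPoch q (N + 1 + n) = A
      generalize invPoch q (N + 1 - n) = B
      generalize ∏ k ∈ Finset.range (2 * N), (1 - q * q ^ k) = Q
      have hq2 : q ^ (2 * N) = q ^ N * q ^ N := by rw [two_mul, pow_add]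
      have hxy : X * Y = q ^ N * q ^ N * q * q := by
        rw [eX, eY]
        have := hqn n
        field_simp
      have hxyq : q ^ N * q ^ N * q = X * Y * q⁻¹ := by
        rw [hxy]
        field_simp
      have key : Q * (1 - q * q ^ (2 * N)) * (1 - q * q ^ (2 * N + 1)) * A * B * t n =
          (1 + q ^ (2 * N + 1)) * (Q * ((1 - X) * A) * ((1 - Y) * B) * t n) -
          q ^ (N + 1) * (Q * ((1 - X * q⁻¹) * ((1 - X) * A)) * B) * (-(q ^ n)⁻¹ * t n) -
          q ^ N * (Q * A * ((1 - Y * q⁻¹) * ((1 - Y) * B))) * (-(q ^ n * q) * t n) := by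
        have p1 : q * q ^ (2 * N) = X * Y * q⁻¹ := by rw [← hxyq, hq2]; ring
        have p2 : q * q ^ (2 * N + 1) = X * Y := by rw [hxy, pow_succ, hq2]; ring
        have p3 : q ^ (2 * N + 1) = X * Y * q⁻¹ := by rw [← hxyq, pow_succ, hq2]
        have p4 : q ^ (N + 1) * (q ^ n)⁻¹ = Y := by rw [eY, pow_succ]
        have p5 : q ^ N * (q ^ n * q) = X := by rw [eX]; ring
        rw [p1, p2, p3]
        linear_combination (-(Q * ((1 - X * q⁻¹) * ((1 - X) * A)) * B) * t n) * p4 -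
          (Q * A * ((1 - Y * q⁻¹) * ((1 - Y) * B))) * t n * p5
      rw [key]
      linear_combination (-q ^ (N + 1) * (Q * ((1 - X * q⁻¹) * ((1 - X) * A)) * B)) * (-ht2) +
        (q ^ N * (Q * A * ((1 - Y * q⁻¹) * ((1 - Y) * B)))) * ht3
    · rw [pow_succ q (2 * N), pow_succ q N, two_mul, pow_add]
      linear_combination (t 0 * (∏ k ∈ Finset.range N, (1 - w * q * q ^ k)) *
        (∏ k ∈ Finset.range N, (1 - w⁻¹ * q ^ k)) * q ^ N * q ^ N * q) * mul_inv_cancel₀ hw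

/-- Let N tend to infinity in the finite identity. Since `invPoch` is bounded, the terms are
dominated by a multiple of ‖t n‖. -/
theorem hasSum_triple_product {q w : ℂ} (hq : ‖q‖ < 1) (hq0 : q ≠ 0) (hw : w ≠ 0) {t : ℤ → ℂ}
    (ht : ∀ n, t (n + 1) = -w * q ^ (n + 1) * t n) (hs : Summable fun n => ‖t n‖) :
    ∑' n, t n = t 0 * qPoch q q * qPoch (w * q) q * qPoch w⁻¹ q := by
  obtain ⟨M, hM⟩ := exists_norm_invPoch_le hq
  have hM0 : 0 ≤ M := (norm_nonneg _).trans (hM 0)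
  have hne := qPoch_self_ne_zero hq
  have h1 : Tendsto (fun N : ℕ => ∑' n : ℤ, invPoch q (N + n) * invPoch q (N - n) * t n) atTop
      (𝓝 (∑' n : ℤ, (qPoch q q)⁻¹ * (qPoch q q)⁻¹ * t n)) := by
    refine tendsto_tsum_of_dominated_convergence (bound := fun n => M * M * ‖t n‖)
      (hs.mul_left _) (fun n => ?_) (Eventually.of_forall fun N n => ?_)
    · have e1 : Tendsto (fun N : ℕ => (N : ℤ) + n) atTop atTop :=
        tendsto_atTop_add_const_right _ n tendsto_natCast_atTop_atTop
      have e2 : Tendsto (fun N : ℕ => (N : ℤ) - n) atTop atTop :=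
        tendsto_atTop_add_const_right _ (-n) tendsto_natCast_atTop_atTop
      exact (((tendsto_invPoch hq).comp e1).mul ((tendsto_invPoch hq).comp e2)).mul_const _
    · rw [norm_mul, norm_mul]
      exact mul_le_mul_of_nonneg_right
        (mul_le_mul (hM _) (hM _) (norm_nonneg _) hM0) (norm_nonneg _)
  have h2 : Tendsto (fun N : ℕ => ∏ k ∈ Finset.range (2 * N), (1 - q * q ^ k)) atTop
      (𝓝 (qPoch q q)) :=
    (tendsto_qPoch q hq).comp (tendsto_atTop_mono (fun N => by dsimp only [id]; omega) tendsto_id)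
  have h3 := h2.mul h1
  have h4 := ((tendsto_qPoch (w * q) hq).const_mul (t 0)).mul (tendsto_qPoch w⁻¹ hq)
  have h5 := tendsto_nhds_unique (h3.congr fun N => by
    rw [← tsum_mul_left, ← (finite_triple_product hq hq0 hw ht N).tsum_eq]
    exact tsum_congr fun n => by ring) h4
  rw [tsum_mul_left] at h5
  have h6 := mul_inv_cancel₀ hne
  linear_combination qPoch q q * h5 -
    (qPoch q q * (qPoch q q)⁻¹ + 1) * (∑' n, t n) * h6

theorem norm_cexp_lt_one {τ : ℂ} (hτ : 0 < τ.im) : ‖cexp (2 * Real.pi * I * τ)‖ < 1 := by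
  rw [Complex.norm_exp, Real.exp_lt_one_iff]
  have : (2 * Real.pi * I * τ).re = -(2 * Real.pi * τ.im) := by simp
  rw [this, neg_lt_zero]
  positivity

/-- The product expansion of the odd theta function. -/
theorem theta_eq_prod (z : ℂ) {τ : ℂ} (hτ : 0 < τ.im) :
    theta 0 z τ = cexp (Real.pi * I * (z + τ / 4)) *
      qPoch (cexp (2 * Real.pi * I * τ)) (cexp (2 * Real.pi * I * τ)) *
      qPoch (cexp (2 * Real.pi * I * z) * cexp (2 * Real.pi * I * τ))
        (cexp (2 * Real.pi * I * τ)) *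
      qPoch (cexp (2 * Real.pi * I * z))⁻¹ (cexp (2 * Real.pi * I * τ)) := by
  have h := hasSum_triple_product (norm_cexp_lt_one hτ) (Complex.exp_ne_zero _)
    (Complex.exp_ne_zero (2 * Real.pi * I * z)) (t := thetaTerm 0 z τ) (fun n => by
      rw [thetaTerm, thetaTerm, zpow_add_one₀ (by norm_num), ← Complex.exp_int_mul]
      simp only [pow_zero, mul_one]
      rw [show ∀ A B C D : ℂ, -A * B * (C * D) = C * -1 * (A * B * D) by intros; ring,
        ← Complex.exp_add, ← Complex.exp_add]
      congr 2
      push_cast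
      ring) (summable_norm_thetaTerm 0 z hτ)
  rw [theta, h]
  congr 3
  simp only [thetaTerm]
  rw [zpow_zero, pow_zero, one_mul, one_mul]
  congr 1
  push_cast
  ring

theorem one_sub_exp_eq_zero_iff {z : ℂ} :
    1 - cexp (2 * Real.pi * I * z) = 0 ↔ ∃ n : ℤ, z = n := by
  rw [sub_eq_zero, eq_comm, Complex.exp_eq_one_iff]
  refine exists_congr fun n => ?_
  rw [mul_comm, mul_left_inj' Complex.two_pi_I_ne_zero]

/-- The odd theta function vanishes at lattice points only. -/
theorem exists_of_theta_eq_zero {z τ : ℂ} (hτ : 0 < τ.im) (h : theta 0 z τ = 0) :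
    ∃ m n : ℤ, z = m * τ + n := by
  by_contra! hc
  refine absurd h ?_
  rw [theta_eq_prod z hτ]
  have hq := norm_cexp_lt_one hτ
  refine mul_ne_zero (mul_ne_zero (mul_ne_zero (Complex.exp_ne_zero _) (qPoch_self_ne_zero hq))
    (qPoch_ne_zero hq fun k => ?_)) (qPoch_ne_zero hq fun k => ?_)
  · have e : cexp (2 * Real.pi * I * z) * cexp (2 * Real.pi * I * τ) *
        cexp (2 * Real.pi * I * τ) ^ k = cexp (2 * Real.pi * I * (z + (k + 1) * τ)) := by
      rw [← Complex.exp_nat_mul, ← Complex.exp_add, ← Complex.exp_add]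
      congr 1
      ring
    rw [e, Ne, one_sub_exp_eq_zero_iff]
    rintro ⟨n, hn⟩
    refine hc (-(k + 1)) n ?_
    push_cast
    linear_combination hn
  · have e : (cexp (2 * Real.pi * I * z))⁻¹ *
        cexp (2 * Real.pi * I * τ) ^ k = cexp (2 * Real.pi * I * (-z + k * τ)) := by
      rw [← Complex.exp_nat_mul, ← Complex.exp_neg, ← Complex.exp_add]
      congr 1
      ring
    rw [e, Ne, one_sub_exp_eq_zero_iff]
    rintro ⟨n, hn⟩
    refine hc k (-n) ?_
    push_cast
    linear_combination -hn

/-- The logarithmic derivative of the odd theta function as a Lambert series. -/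
theorem thetaJ_eq_tsum {z τ : ℂ} (hτ : 0 < τ.im)
    (hz : ∀ m n : ℤ, z ≠ m * τ + n) :
    thetaJ z τ = 1 / 2 -
      (∑' k : ℕ, cexp (2 * Real.pi * I * z) * cexp (2 * Real.pi * I * τ) *
        cexp (2 * Real.pi * I * τ) ^ k / (1 - cexp (2 * Real.pi * I * z) *
          cexp (2 * Real.pi * I * τ) * cexp (2 * Real.pi * I * τ) ^ k)) +
      ∑' k : ℕ, (cexp (2 * Real.pi * I * z))⁻¹ * cexp (2 * Real.pi * I * τ) ^ k /
        (1 - (cexp (2 * Real.pi * I * z))⁻¹ * cexp (2 * Real.pi * I * τ) ^ k) := by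
  have hq := norm_cexp_lt_one hτ
  have h0 : theta 0 z τ ≠ 0 := fun h => by
    obtain ⟨m, n, h⟩ := exists_of_theta_eq_zero hτ h
    exact hz m n h
  set q := cexp (2 * Real.pi * I * τ) with hqdef
  have hw0 : cexp (2 * Real.pi * I * z) ≠ 0 := Complex.exp_ne_zero _
  have ha : ∀ k : ℕ, 1 - cexp (2 * Real.pi * I * z) * q * q ^ k ≠ 0 := by
    intro k
    have e : cexp (2 * Real.pi * I * z) * q * q ^ k = cexp (2 * Real.pi * I * (z + (k + 1) * τ)) := by
      rw [hqdef, ← Complex.exp_nat_mul, ← Complex.exp_add, ← Complex.exp_add]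
      congr 1
      ring
    rw [e, Ne, one_sub_exp_eq_zero_iff]
    rintro ⟨n, hn⟩
    refine hz (-(k + 1)) n ?_
    push_cast
    linear_combination hn
  have hb : ∀ k : ℕ, 1 - (cexp (2 * Real.pi * I * z))⁻¹ * q ^ k ≠ 0 := by
    intro k
    have e : (cexp (2 * Real.pi * I * z))⁻¹ * q ^ k = cexp (2 * Real.pi * I * (-z + k * τ)) := by
      rw [hqdef, ← Complex.exp_nat_mul, ← Complex.exp_neg, ← Complex.exp_add]
      congr 1
      ring
    rw [e, Ne, one_sub_exp_eq_zero_iff]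
    rintro ⟨n, hn⟩
    refine hz k (-n) ?_
    push_cast
    linear_combination -hn
  have hw : HasDerivAt (fun z => cexp (2 * Real.pi * I * z))
      (2 * Real.pi * I * cexp (2 * Real.pi * I * z)) z := by
    have := ((hasDerivAt_id z).const_mul (2 * Real.pi * I : ℂ)).cexp
    simpa [mul_comm] using this
  have hp : HasDerivAt (fun z => cexp (Real.pi * I * (z + τ / 4)))
      (Real.pi * I * cexp (Real.pi * I * (z + τ / 4))) z := by
    have := (((hasDerivAt_id z).add_const (τ / 4)).const_mul (Real.pi * I : ℂ)).cexp
    simpa [mul_comm] using this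
  have h1 := (hasDerivAt_qPoch hq (mul_ne_zero hw0 (Complex.exp_ne_zero _)) ha).comp z
    (hw.mul_const q)
  have h2 := (hasDerivAt_qPoch hq (inv_ne_zero hw0) hb).comp z (hw.inv hw0)
  have h := hasDerivAt_unique_of_eventuallyEq (hasDerivAt_theta 0 z hτ)
    (((hp.mul_const (qPoch q q)).mul h1).mul h2)
    (Eventually.of_forall fun w => theta_eq_prod w hτ)
  have e := theta_eq_prod z hτ
  rw [← hqdef] at e
  rw [thetaJ, div_eq_iff h0]
  apply mul_left_cancel₀ Complex.two_pi_I_ne_zero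
  have hq0 : q ≠ 0 := Complex.exp_ne_zero _
  simp only [Function.comp_apply, Pi.mul_apply, Pi.inv_apply, ← hqdef, zero_add] at h
  rw [h, e]
  generalize (∑' k : ℕ, cexp (2 * Real.pi * I * z) * q * q ^ k /
    (1 - cexp (2 * Real.pi * I * z) * q * q ^ k)) = S₁
  generalize (∑' k : ℕ, (cexp (2 * Real.pi * I * z))⁻¹ * q ^ k /
    (1 - (cexp (2 * Real.pi * I * z))⁻¹ * q ^ k)) = S₂
  generalize qPoch (cexp (2 * Real.pi * I * z) * q) q = Q₁
  generalize qPoch (cexp (2 * Real.pi * I * z))⁻¹ q = Q₂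
  field_simp
  ring

/-! ### Transformation laws of the logarithmic derivative -/

theorem theta_add_tau (z : ℂ) (τ : ℂ) :
    theta 0 (z + τ) τ = -cexp (-(2 * Real.pi * I * z) - Real.pi * I * τ) * theta 0 z τ := by
  rw [theta_eq_jacobiTheta₂, theta_eq_jacobiTheta₂,
    show z + τ + τ / 2 + 1 / 2 = z + τ / 2 + 1 / 2 + τ by ring, jacobiTheta₂_add_left']
  rw [← mul_assoc, ← mul_assoc, ← Complex.exp_add, neg_mul (cexp _) (cexp _), ← Complex.exp_add]
  congr 1
  rw [show Real.pi * I * (z + τ + τ / 4) + -Real.pi * I * (τ + 2 * (z + τ / 2 + 1 / 2)) =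
    -(2 * Real.pi * I * z) - Real.pi * I * τ + Real.pi * I * (z + τ / 4) - Real.pi * I by ring,
    Complex.exp_sub, Complex.exp_pi_mul_I]
  ring

theorem thetaJ_add_tau {z τ : ℂ} (hτ : 0 < τ.im) (hz : theta 0 z τ ≠ 0) :
    thetaJ (z + τ) τ = thetaJ z τ - 1 := by
  have he : HasDerivAt (fun z => -cexp (-(2 * Real.pi * I * z) - Real.pi * I * τ))
      (2 * Real.pi * I * cexp (-(2 * Real.pi * I * z) - Real.pi * I * τ)) z := by
    have := ((((hasDerivAt_id z).const_mul (2 * Real.pi * I : ℂ)).neg).sub_const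
      (Real.pi * I * τ)).cexp.neg
    refine this.congr_deriv ?_
    simp only [id, mul_one, Pi.neg_apply]
    ring
  have h := hasDerivAt_unique_of_eventuallyEq ((hasDerivAt_theta 0 (z + τ) hτ).comp_add_const z τ)
    (he.mul (hasDerivAt_theta 0 z hτ)) (Eventually.of_forall fun w => theta_add_tau w τ)
  have hz' : theta 0 (z + τ) τ ≠ 0 := by
    rw [theta_add_tau]
    exact mul_ne_zero (neg_ne_zero.mpr (Complex.exp_ne_zero _)) hz
  rw [thetaJ, thetaJ, div_eq_iff hz']
  apply mul_left_cancel₀ Complex.two_pi_I_ne_zero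
  rw [zero_add] at h
  rw [h, theta_add_tau]
  field_simp
  ring

theorem thetaJ_add_one (z τ : ℂ) : thetaJ (z + 1) τ = thetaJ z τ := by
  rw [thetaJ, thetaJ, theta_add_one, theta_add_one, neg_div_neg_eq]

theorem theta_add_one_right (j : ℕ) (z τ : ℂ) :
    theta j z (τ + 1) = cexp (Real.pi * I / 4) * theta j z τ := by
  rw [theta, theta, ← tsum_mul_left]
  refine tsum_congr fun n => ?_
  obtain ⟨m, hm⟩ := Int.even_mul_succ_self n
  have hm' : (n : ℂ) * (n + 1) = m + m := by exact_mod_cast hm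
  have : 2 * Real.pi * I * (((n : ℂ) + 1 / 2) * z + ((n : ℂ) + 1 / 2) ^ 2 * (τ + 1) / 2) =
      Real.pi * I / 4 + 2 * Real.pi * I * (((n : ℂ) + 1 / 2) * z + ((n : ℂ) + 1 / 2) ^ 2 * τ / 2) +
        m * (2 * Real.pi * I) := by
    linear_combination (Real.pi * I) * hm'
  rw [thetaTerm, thetaTerm, this, Complex.exp_add, Complex.exp_add,
    Complex.exp_int_mul_two_pi_mul_I]
  ring

theorem thetaJ_add_one_right (z τ : ℂ) : thetaJ z (τ + 1) = thetaJ z τ := by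
  rw [thetaJ, thetaJ, theta_add_one_right, theta_add_one_right,
    mul_div_mul_left _ _ (Complex.exp_ne_zero _)]

/-- The constant is left unspecified: it does not depend on `z`, so it cancels in the logarithmic
derivative. The Gaussian factor is what matters, since it produces the additive `z` in `thetaJ_inv`.
-/
theorem exists_theta_inv {τ : ℂ} (hτ : 0 < τ.im) :
    ∃ c : ℂ, ∀ z, theta 0 (z / τ) (-1 / τ) =
      c * cexp (Real.pi * I * z ^ 2 / τ) * theta 0 z τ := by
  have h0 : τ ≠ 0 := fun h => by simp [h] at hτ
  have hc : (-I * τ) ^ (1 / 2 : ℂ) ≠ 0 := by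
    rw [Complex.cpow_def_of_ne_zero (mul_ne_zero (neg_ne_zero.mpr I_ne_zero) h0)]
    exact Complex.exp_ne_zero _
  refine ⟨(-I * τ) ^ (1 / 2 : ℂ) * cexp (-(Real.pi * I / 2)), fun z => ?_⟩
  have h1 := jacobiTheta₂_functional_equation (z + τ / 2 + 1 / 2) τ
  have h2 := jacobiTheta₂_add_left' ((z + τ / 2 + 1 / 2) / τ) (-1 / τ)
  -- Inversion exchanges the half periods 1/2 and τ/2, up to one full period -1/τ.
  have e : (z + τ / 2 + 1 / 2) / τ + -1 / τ = z / τ + -1 / τ / 2 + 1 / 2 := by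
    field_simp
    ring
  rw [theta_eq_jacobiTheta₂, theta_eq_jacobiTheta₂, ← e, h2, h1]
  rw [show ∀ a b c d e f : ℂ, a * b * c * (d * (1 / a * e * f)) =
    a * (1 / a) * (b * c * d * e) * f by intros; ring, mul_one_div_cancel hc, one_mul, ← mul_assoc,
    ← Complex.exp_add, ← Complex.exp_add, ← Complex.exp_add, ← Complex.exp_add]
  congr 2
  field_simp
  ring

theorem thetaJ_inv {z τ : ℂ} (hτ : 0 < τ.im) (hz : theta 0 (z / τ) (-1 / τ) ≠ 0) :
    thetaJ (z / τ) (-1 / τ) = τ * thetaJ z τ + z := by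
  have h0 : τ ≠ 0 := fun h => by simp [h] at hτ
  have hτ' : 0 < (-1 / τ).im := by
    have := UpperHalfPlane.im_inv_neg_coe_pos ⟨τ, hτ⟩
    simpa [neg_div, inv_neg] using this
  obtain ⟨c, hc⟩ := exists_theta_inv hτ
  have he : HasDerivAt (fun z => c * cexp (Real.pi * I * z ^ 2 / τ))
      (2 * Real.pi * I * (c * (z / τ) * cexp (Real.pi * I * z ^ 2 / τ))) z := by
    have := ((((hasDerivAt_id z).pow 2).const_mul (Real.pi * I : ℂ)).div_const τ).cexp.const_mul c
    refine this.congr_deriv ?_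
    simp only [id, mul_one, Pi.pow_apply]
    push_cast
    ring
  have h := hasDerivAt_unique_of_eventuallyEq
    (HasDerivAt.comp (h₂ := fun z => theta 0 z (-1 / τ)) z (hasDerivAt_theta 0 (z / τ) hτ')
      ((hasDerivAt_id z).div_const τ))
    (he.mul (hasDerivAt_theta 0 z hτ)) (Eventually.of_forall fun w => hc w)
  rw [hc] at hz
  have hz0 : theta 0 z τ ≠ 0 := right_ne_zero_of_mul hz
  rw [thetaJ, hc, thetaJ, div_eq_iff hz]
  apply mul_left_cancel₀ Complex.two_pi_I_ne_zero
  rw [zero_add] at h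
  have h' : 2 * Real.pi * I * theta 1 (z / τ) (-1 / τ) = τ *
      (2 * Real.pi * I * (c * (z / τ) * cexp (Real.pi * I * z ^ 2 / τ)) * theta 0 z τ +
      c * cexp (Real.pi * I * z ^ 2 / τ) * (2 * Real.pi * I * theta 1 z τ)) := by
    rw [← h]
    field_simp
  rw [h']
  field_simp
  ring

/-- Hecke's Eisenstein series of weight one attached to the torsion section `v τ + w`. -/
def heckeG (v w : ℝ) (τ : ℍ) : ℂ := thetaJ (v * τ + w) τ + v

/-- The torsion section `v τ + w` is not a lattice point. -/
def NonIntegral (v w : ℝ) : Prop := ¬ ∃ m n : ℤ, v = m ∧ w = n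

theorem eq_of_mul_add_eq {τ : ℂ} (hτ : 0 < τ.im) {a b c d : ℝ}
    (h : (a : ℂ) * τ + b = c * τ + d) : a = c ∧ b = d := by
  have him : a * τ.im = c * τ.im := by simpa using congrArg Complex.im h
  obtain rfl := mul_right_cancel₀ hτ.ne' him
  exact ⟨rfl, by exact_mod_cast add_left_cancel h⟩

theorem theta_ne_zero_of_nonIntegral {v w : ℝ} (h : NonIntegral v w) {τ : ℂ} (hτ : 0 < τ.im) :
    theta 0 (v * τ + w) τ ≠ 0 := by
  intro h0
  obtain ⟨m, n, hmn⟩ := exists_of_theta_eq_zero hτ h0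
  have := eq_of_mul_add_eq (c := m) (d := n) hτ (by push_cast; exact hmn)
  exact h ⟨m, n, this⟩

theorem heckeG_add_one_right (v w : ℝ) (τ : ℍ) : heckeG v (w + 1) τ = heckeG v w τ := by
  rw [heckeG, heckeG]
  push_cast
  rw [← add_assoc, thetaJ_add_one]

theorem heckeG_add_int_right (v w : ℝ) (n : ℤ) (τ : ℍ) : heckeG v (w + n) τ = heckeG v w τ := by
  have hp : Function.Periodic (fun w => heckeG v w τ) 1 := fun w => heckeG_add_one_right v w τ
  simpa using hp.int_mul n w

open UpperHalfPlane in
theorem nonIntegral_mul {v w : ℝ} (h : NonIntegral v w) (γ : SL(2, ℤ)) :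
    NonIntegral (v * γ 0 0 + w * γ 1 0) (v * γ 0 1 + w * γ 1 1) := by
  rintro ⟨m, n, hm, hn⟩
  have hdet : ((γ 0 0 : ℤ) : ℝ) * γ 1 1 - γ 0 1 * γ 1 0 = 1 := by
    have := γ.det_coe
    rw [Matrix.det_fin_two] at this
    exact_mod_cast this
  refine h ⟨m * γ 1 1 - n * γ 1 0, n * γ 0 0 - m * γ 0 1, ?_, ?_⟩
  · push_cast
    rw [← hm, ← hn]
    linear_combination (-v) * hdet
  · push_cast
    rw [← hm, ← hn]
    linear_combination (-w) * hdet

theorem heckeG_slash_S {v w : ℝ} (h : NonIntegral v w) :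
    heckeG v w ∣[(1 : ℤ)] ModularGroup.S = heckeG w (-v) := by
  ext τ
  have h0 : (τ : ℂ) ≠ 0 := UpperHalfPlane.ne_zero τ
  have e : ((v : ℂ) * (-1 / τ) + w) = (w * τ + (-v : ℝ)) / τ := by
    push_cast
    field_simp
    ring
  have hS : ((ModularGroup.S • τ : ℍ) : ℂ) = -1 / τ := by
    rw [UpperHalfPlane.modular_S_smul]
    simp [neg_div, inv_neg]
  have him : 0 < (-1 / (τ : ℂ)).im := hS ▸ (ModularGroup.S • τ).im_pos
  have hz := theta_ne_zero_of_nonIntegral h him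
  rw [ModularForm.SL_slash_apply, heckeG, heckeG, hS]
  rw [e] at hz ⊢
  rw [thetaJ_inv τ.im_pos hz, ModularGroup.denom_apply]
  simp [ModularGroup.S]
  field_simp
  ring

theorem heckeG_slash_T (v w : ℝ) :
    heckeG v w ∣[(1 : ℤ)] ModularGroup.T = heckeG v (v + w) := by
  ext τ
  have hT : ((ModularGroup.T • τ : ℍ) : ℂ) = τ + 1 := by
    rw [UpperHalfPlane.modular_T_smul]
    simp [add_comm]
  rw [ModularForm.SL_slash_apply, heckeG, heckeG, hT, thetaJ_add_one_right,
    ModularGroup.denom_apply]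
  simp [ModularGroup.T]
  ring_nf

/-- The characteristic (v, w) transforms as a row vector under right multiplication, an action
compatible with products and inverses, so the two generators S and T suffice. Nonintegrality keeps θ
away from its zeros. -/
theorem heckeG_slash (γ : SL(2, ℤ)) : ∀ {v w : ℝ}, NonIntegral v w →
    heckeG v w ∣[(1 : ℤ)] γ = heckeG (v * γ 0 0 + w * γ 1 0) (v * γ 0 1 + w * γ 1 1) := by
  have : γ ∈ Subgroup.closure {ModularGroup.S, ModularGroup.T} := by
    simp [SpecialLinearGroup.SL2Z_generators]
  induction this using Subgroup.closure_induction with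
  | one => intro v w _; simp [SlashAction.slash_one]
  | mem g hg =>
    intro v w h
    rcases hg with rfl | rfl
    · rw [heckeG_slash_S h]
      simp [ModularGroup.S]
    · rw [heckeG_slash_T]
      simp [ModularGroup.T]
  | mul g h _ _ ig ih =>
    intro v w hvw
    rw [SlashAction.slash_mul, ig hvw, ih (nonIntegral_mul hvw g)]
    simp only [Matrix.SpecialLinearGroup.coe_mul, Matrix.mul_apply, Fin.sum_univ_two]
    push_cast
    congr 1 <;> ring
  | inv g _ ig =>
    intro v w hvw
    have h := ig (nonIntegral_mul hvw g⁻¹)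
    have hdet : ((g 0 0 : ℤ) : ℝ) * g 1 1 - g 0 1 * g 1 0 = 1 := by
      have := g.det_coe
      rw [Matrix.det_fin_two] at this
      exact_mod_cast this
    have e : heckeG v w = heckeG (v * g⁻¹ 0 0 + w * g⁻¹ 1 0) (v * g⁻¹ 0 1 + w * g⁻¹ 1 1)
        ∣[(1 : ℤ)] g := by
      rw [h]
      simp only [Matrix.SpecialLinearGroup.SL2_inv_expl, Matrix.cons_val', Matrix.cons_val_zero,
        Matrix.cons_val_one]
      simp
      congr 1
      · linear_combination (-v) * hdet
      · linear_combination (-w) * hdet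
    conv_lhs => rw [e]
    rw [← SlashAction.slash_mul, mul_inv_cancel, SlashAction.slash_one]

/-! ### The value of the Hurwitz zeta function at zero -/

/-- A second-order Taylor estimate in x. The exponent -3/2 is summable and the bound is uniform for
Re s ≥ -1/2, ‖s‖ ≤ 3, a region reaching from absolute convergence to s = 0. The constant is 12 = 3 ·
4, from ‖s‖ ≤ 3 and ‖s + 1‖ ≤ 4. -/
theorem norm_cpow_expansion_le {s : ℂ} (hs : -(1 / 2) ≤ s.re) (hs3 : ‖s‖ ≤ 3) {x : ℝ} (hx : 0 ≤ x)
    (hx1 : x ≤ 1) (n : ℕ) :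
    ‖((n + 1 + x : ℝ) : ℂ) ^ (-s) - ((n + 1 : ℝ) : ℂ) ^ (-s) +
      s * x * ((n + 1 : ℝ) : ℂ) ^ (-s - 1)‖ ≤ 12 * ((n : ℝ) + 1) ^ (-(3 / 2) : ℝ) := by
  have hpos : ∀ t : ℝ, 0 ≤ t → 0 < (n : ℝ) + 1 + t := fun t ht => by positivity
  have hd : ∀ (r : ℂ) (t : ℝ), 0 ≤ t → HasDerivAt (fun t : ℝ => ((n + 1 + t : ℝ) : ℂ) ^ r)
      (r * ((n + 1 + t : ℝ) : ℂ) ^ (r - 1)) t := by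
    intro r t ht
    have h1 : HasDerivAt (fun t : ℝ => ((n + 1 + t : ℝ) : ℂ)) 1 t := by
      have := ((hasDerivAt_id t).const_add ((n : ℝ) + 1)).ofReal_comp
      simpa using this
    have h2 : HasDerivAt (fun z : ℂ => z ^ r) (r * ((n + 1 + t : ℝ) : ℂ) ^ (r - 1))
        ((n + 1 + t : ℝ) : ℂ) := by
      have := (hasDerivAt_id ((n + 1 + t : ℝ) : ℂ)).cpow_const (c := r)
        (Or.inl (by simpa using hpos t ht))
      simpa using this
    have h3 := h2.scomp t h1
    rw [one_smul] at h3
    exact h3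
  have hs1 : ‖s + 1‖ ≤ 4 := (norm_add_le _ _).trans (by rw [norm_one]; linarith)
  have hb : ∀ t : ℝ, 0 ≤ t → ‖(-s - 1) * ((n + 1 + t : ℝ) : ℂ) ^ (-s - 1 - 1)‖ ≤
      4 * ((n : ℝ) + 1) ^ (-(3 / 2) : ℝ) := by
    intro t ht
    rw [norm_mul, Complex.norm_cpow_eq_rpow_re_of_pos (hpos t ht),
      show -s - 1 = -(s + 1) by ring, norm_neg]
    have e : (-(s + 1) - 1).re = -s.re - 2 := by simp; ring
    rw [e]
    have h1 : ((n : ℝ) + 1 + t) ^ (-s.re - 2) ≤ ((n : ℝ) + 1) ^ (-s.re - 2) :=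
      Real.rpow_le_rpow_of_nonpos (by positivity) (by linarith) (by linarith)
    have h2 : ((n : ℝ) + 1) ^ (-s.re - 2) ≤ ((n : ℝ) + 1) ^ (-(3 / 2) : ℝ) :=
      Real.rpow_le_rpow_of_exponent_le (by have : (0:ℝ) ≤ n := n.cast_nonneg; linarith)
        (by linarith)
    exact mul_le_mul hs1 (h1.trans h2) (by positivity) (by norm_num)
  have hc : ∀ t ∈ Set.Icc (0 : ℝ) x, ‖((n + 1 + t : ℝ) : ℂ) ^ (-s - 1) -
      ((n + 1 + 0 : ℝ) : ℂ) ^ (-s - 1)‖ ≤ 4 * ((n : ℝ) + 1) ^ (-(3 / 2) : ℝ) * (t - 0) :=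
    norm_image_sub_le_of_norm_deriv_le_segment'
      (fun t ht => (hd (-s - 1) t ht.1).hasDerivWithinAt) (fun t ht => hb t ht.1)
  have hA : 0 ≤ ((n : ℝ) + 1) ^ (-(3 / 2) : ℝ) := by positivity
  have h := norm_image_sub_le_of_norm_deriv_le_segment' (a := 0) (b := x)
    (f := fun t : ℝ => ((n + 1 + t : ℝ) : ℂ) ^ (-s) + s * t * ((n + 1 : ℝ) : ℂ) ^ (-s - 1))
    (f' := fun t : ℝ => -s * (((n + 1 + t : ℝ) : ℂ) ^ (-s - 1) -
      ((n + 1 + 0 : ℝ) : ℂ) ^ (-s - 1))) (C := 12 * ((n : ℝ) + 1) ^ (-(3 / 2) : ℝ)) ?_ ?_ x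
    ⟨hx, le_rfl⟩
  · refine le_trans (le_of_eq ?_) (h.trans ?_)
    · congr 1
      simp
      ring
    · rw [sub_zero]
      exact mul_le_of_le_one_right (by positivity) hx1
  · intro t ht
    have h1 : HasDerivAt (fun t : ℝ => s * (t : ℂ) * ((n + 1 : ℝ) : ℂ) ^ (-s - 1))
        (s * ((n + 1 : ℝ) : ℂ) ^ (-s - 1)) t := by
      have := ((hasDerivAt_id t).ofReal_comp.const_mul s).mul_const (((n + 1 : ℝ) : ℂ) ^ (-s - 1))
      simpa using this
    refine (((hd (-s) t ht.1).add h1).congr_deriv ?_).hasDerivWithinAt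
    rw [add_zero]
    ring
  · intro t ht
    rw [norm_mul, norm_neg]
    have h1 := hc t ⟨ht.1, ht.2.le⟩
    have h2 : 4 * ((n : ℝ) + 1) ^ (-(3 / 2) : ℝ) * (t - 0) ≤ 4 * ((n : ℝ) + 1) ^ (-(3 / 2) : ℝ) := by
      rw [sub_zero]
      exact mul_le_of_le_one_right (by positivity) (ht.2.le.trans hx1)
    calc ‖s‖ * _ ≤ 3 * (4 * ((n : ℝ) + 1) ^ (-(3 / 2) : ℝ)) :=
          mul_le_mul hs3 (h1.trans h2) (norm_nonneg _) (by norm_num)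
      _ = _ := by ring

/-- The entire function `s ζ(s + 1)`. -/
def mulZeta : ℂ → ℂ := Function.update (fun s => s * riemannZeta (s + 1)) 0 1

theorem differentiable_mulZeta : Differentiable ℂ mulZeta := by
  have h1 : ∀ s : ℂ, s ≠ 0 → DifferentiableAt ℂ mulZeta s := by
    intro s hs
    have h : DifferentiableAt ℂ (fun s => s * riemannZeta (s + 1)) s :=
      differentiableAt_id.mul (DifferentiableAt.comp s
        (differentiableAt_riemannZeta (by simpa using hs)) (differentiableAt_id.add_const 1))
    refine h.congr_of_eventuallyEq ?_
    filter_upwards [isOpen_ne.mem_nhds hs] with w hw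
    exact Function.update_of_ne hw _ _
  intro s
  by_cases hs : s = 0
  · subst hs
    refine (Complex.analyticAt_of_differentiable_on_punctured_nhds_of_continuousAt
      (eventually_mem_nhdsWithin.mono fun s hs => h1 s hs) ?_).differentiableAt
    rw [mulZeta, continuousAt_update_same]
    have h2 : Tendsto (fun s : ℂ => s + 1) (𝓝[≠] 0) (𝓝[≠] 1) := by
      refine tendsto_nhdsWithin_iff.mpr ⟨?_, eventually_mem_nhdsWithin.mono fun s hs => ?_⟩
      · have : Tendsto (fun s : ℂ => s + 1) (𝓝 0) (𝓝 (0 + 1)) :=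
          (continuous_add_const 1).tendsto 0
        rw [zero_add] at this
        exact this.mono_left nhdsWithin_le_nhds
      · simpa using hs
    refine (riemannZeta_residue_one.comp h2).congr fun s => ?_
    simp
  · exact h1 s hs

/-- From ζ(s, x) - ζ(s) remove the leading term x^(-s) and the linear correction -x s ζ(s + 1). What
is left is a series that still converges near s = 0, and each of its terms vanishes there.
Evaluating at 0, where s ζ(s + 1) takes the value 1 and ζ(0) = -1/2, gives the result. -/
theorem hurwitzZeta_apply_zero {x : ℝ} (hx : 0 < x) (hx1 : x ≤ 1) :
    HurwitzZeta.hurwitzZeta (x : UnitAddCircle) 0 = 1 / 2 - x := by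
  set r : ℕ → ℂ → ℂ := fun n s => ((n + 1 + x : ℝ) : ℂ) ^ (-s) - ((n + 1 : ℝ) : ℂ) ^ (-s) +
      s * x * ((n + 1 : ℝ) : ℂ) ^ (-s - 1) with hr
  -- A convex region containing both 2, near which the identity is checked by absolutely convergent
  -- series, and the target point 0.
  set U : Set ℂ := {s | -(1 / 2) < s.re} ∩ Metric.ball 0 3 with hU
  have hUo : IsOpen U := (isOpen_lt continuous_const Complex.continuous_re).inter Metric.isOpen_ball
  have hUc : Convex ℝ U := (convex_halfSpace_re_gt _).inter (convex_ball _ _)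
  have hsum : Summable fun n : ℕ => 12 * ((n : ℝ) + 1) ^ (-(3 / 2) : ℝ) := by
    have := (summable_nat_add_iff 1).mpr (Real.summable_nat_rpow.mpr
      (show (-(3 / 2) : ℝ) < -1 by norm_num))
    simpa using this.mul_left 12
  have hpos : ∀ n : ℕ, ∀ t : ℝ, 0 ≤ t → ((n + 1 + t : ℝ) : ℂ) ≠ 0 := fun n t ht => by
    exact_mod_cast (by positivity : (0 : ℝ) < n + 1 + t).ne'
  have hpos' : ∀ n : ℕ, ((n + 1 : ℝ) : ℂ) ≠ 0 := fun n => by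
    exact_mod_cast (by positivity : (0 : ℝ) < n + 1).ne'
  have hrd : ∀ n, Differentiable ℂ (r n) := by
    intro n s
    have d : ∀ (c : ℂ) (hc : c ≠ 0) (f : ℂ → ℂ), DifferentiableAt ℂ f s →
        DifferentiableAt ℂ (fun s => c ^ f s) s := fun c hc f hf => hf.const_cpow (Or.inl hc)
    exact ((d _ (hpos n x hx.le) _ (by fun_prop)).sub (d _ (hpos' n) _ (by fun_prop))).add
      ((by fun_prop : DifferentiableAt ℂ (fun s : ℂ => s * x) s).mul
        (d _ (hpos' n) _ (by fun_prop)))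
  have hRd : DifferentiableOn ℂ (fun s => ∑' n, r n s) U :=
    differentiableOn_tsum_of_summable_norm hsum (fun n => (hrd n).differentiableOn) hUo
      fun n s hs => norm_cpow_expansion_le hs.1.le (mem_ball_zero_iff.mp hs.2).le hx.le hx1 n
  set F : ℂ → ℂ := fun s => (HurwitzZeta.hurwitzZeta (x : UnitAddCircle) s -
    HurwitzZeta.hurwitzZeta (0 : UnitAddCircle) s) - (x : ℂ) ^ (-s) + x * mulZeta s with hF
  have hx0 : (x : ℂ) ≠ 0 := by exact_mod_cast hx.ne'
  have hFd : Differentiable ℂ F := by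
    have d1 := HurwitzZeta.differentiable_hurwitzZeta_sub_hurwitzZeta (x : UnitAddCircle) 0
    have d2 : Differentiable ℂ fun s : ℂ => (x : ℂ) ^ (-s) := fun s =>
      differentiableAt_id.neg.const_cpow (Or.inl hx0)
    exact (d1.sub d2).add (differentiable_mulZeta.const_mul _)
  have hev : ∀ s : ℂ, 1 < s.re → F s = ∑' n, r n s := by
    intro s hs
    have hs0 : s ≠ 0 := fun h => by simp [h] at hs; linarith
    have s1 := HurwitzZeta.hasSum_hurwitzZeta_of_one_lt_re (a := x) ⟨hx.le, hx1⟩ hs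
    have s2 := HurwitzZeta.hasSum_hurwitzZeta_of_one_lt_re (a := 0) ⟨le_rfl, zero_le_one⟩ hs
    have s3 := HurwitzZeta.hasSum_hurwitzZeta_of_one_lt_re (a := 0) ⟨le_rfl, zero_le_one⟩
      (s := s + 1) (by simp; linarith)
    -- Splitting off n = 0 gives x^(-s) in the first series. In the other two that term is the
    -- inverse of a power of zero, hence 0.
    rw [← hasSum_nat_add_iff' 1] at s1 s2 s3
    have h := (s1.sub s2).add (s3.mul_left (s * x))
    have hz : (0 : ℂ) ^ s = 0 := Complex.zero_cpow hs0
    have hz1 : (0 : ℂ) ^ (s + 1) = 0 := Complex.zero_cpow (fun h => by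
      have := congrArg Complex.re h
      simp at this
      linarith)
    have e := (HasSum.congr_fun_value h (f := fun n => r n s) (a := F s) (fun n => ?_) ?_).tsum_eq
    · exact e.symm
    · simp only [hr]
      push_cast
      rw [Complex.cpow_neg, Complex.cpow_neg, show -s - 1 = -(s + 1) by ring, Complex.cpow_neg]
      simp only [one_div, add_zero]
    · simp only [hF, mulZeta, Function.update_of_ne hs0]
      simp [hz, hz1, HurwitzZeta.hurwitzZeta_zero, Complex.cpow_neg]
      ring
  have h2 : (2 : ℂ) ∈ U := by
    constructor
    · simp; norm_num
    · simp; norm_num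
  have h0 : (0 : ℂ) ∈ U := by
    constructor
    · simp
    · simp
  have key := (hFd.differentiableOn.analyticOnNhd hUo).eqOn_of_preconnected_of_eventuallyEq
    (hRd.analyticOnNhd hUo) hUc.isPreconnected h2 (by
      filter_upwards [(isOpen_lt continuous_const Complex.continuous_re).mem_nhds
        (show (1 : ℝ) < (2 : ℂ).re by simp)] with s hs using hev s hs) h0
  have hR0 : ∑' n, r n 0 = 0 := by
    simp [hr]
  simp only [hR0] at key
  simp only [hF, mulZeta, Function.update_self, neg_zero, Complex.cpow_zero, mul_one,
    HurwitzZeta.hurwitzZeta_zero, riemannZeta_zero] at key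
  linear_combination key

/-! ### Torsion sections of level `p` -/

theorem theta_add_tau_ne_zero {z τ : ℂ} : theta 0 (z + τ) τ ≠ 0 ↔ theta 0 z τ ≠ 0 := by
  rw [theta_add_tau, Ne, mul_eq_zero, not_or]
  exact and_iff_right (neg_ne_zero.mpr (Complex.exp_ne_zero _))

theorem thetaP_add_tau {z τ : ℂ} (hτ : 0 < τ.im) (hz : theta 0 z τ ≠ 0) :
    thetaP (z + τ) τ = thetaP z τ := by
  have h := hasDerivAt_unique_of_eventuallyEq
    ((hasDerivAt_thetaJ hτ (theta_add_tau_ne_zero.mpr hz)).comp_add_const z τ)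
    ((hasDerivAt_thetaJ hτ hz).sub_const 1)
    ((eventually_theta_ne_zero hτ hz).mono fun w hw => thetaJ_add_tau hτ hw)
  have := mul_left_cancel₀ Complex.two_pi_I_ne_zero h
  linear_combination -this

theorem thetaPDer_add_tau {z τ : ℂ} (hτ : 0 < τ.im) (hz : theta 0 z τ ≠ 0) :
    thetaPDer (z + τ) τ = thetaPDer z τ := by
  have h := hasDerivAt_unique_of_eventuallyEq
    ((hasDerivAt_thetaP hτ (theta_add_tau_ne_zero.mpr hz)).comp_add_const z τ)
    (hasDerivAt_thetaP hτ hz)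
    ((eventually_theta_ne_zero hτ hz).mono fun w hw => thetaP_add_tau hτ hw)
  exact mul_left_cancel₀ Complex.two_pi_I_ne_zero h

theorem thetaPDer_neg (z τ : ℂ) : thetaPDer (-z) τ = -thetaPDer z τ := by
  simp only [thetaPDer, thetaJ_neg, theta_neg]
  ring

/-- Periodicity is assumed only off the zeros of θ, so nonvanishing has to be propagated along the
translates, in both directions. -/
theorem int_periodic_of_theta_ne_zero {F : ℂ → ℂ} {τ : ℂ}
    (hF : ∀ z, theta 0 z τ ≠ 0 → F (z + τ) = F z) {z : ℂ} (hz : theta 0 z τ ≠ 0) (m : ℤ) :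
    F (z + m * τ) = F z := by
  have h : ∀ n : ℕ, ∀ z, theta 0 z τ ≠ 0 →
      F (z + n * τ) = F z ∧ theta 0 (z + n * τ) τ ≠ 0 := by
    intro n
    induction n with
    | zero => intro z hz; simpa using hz
    | succ n ih =>
      intro z hz
      obtain ⟨h1, h2⟩ := ih z hz
      have e : z + ((n + 1 : ℕ) : ℂ) * τ = z + n * τ + τ := by push_cast; ring
      rw [e]
      exact ⟨(hF _ h2).trans h1, theta_add_tau_ne_zero.mpr h2⟩
  have hneg : ∀ n : ℕ, ∀ z, theta 0 z τ ≠ 0 → theta 0 (z - n * τ) τ ≠ 0 := by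
    intro n
    induction n with
    | zero => intro z hz; simpa using hz
    | succ n ih =>
      intro z hz
      rw [← theta_add_tau_ne_zero]
      convert ih z hz using 2
      push_cast
      ring
  obtain ⟨n, rfl | rfl⟩ := m.eq_nat_or_neg
  · simpa using (h n z hz).1
  · have := (h n _ (hneg n z hz)).1
    push_cast
    rw [sub_add_cancel] at this
    rw [this]
    congr 1
    ring

section Level

variable {p : ℕ}

/-- The weight one Eisenstein series attached to the section `(a / p) σ`. -/
def secJ (p : ℕ) (a : ZMod p) (σ : ℂ) : ℂ := thetaJ ((a.val / p : ℂ) * σ) σ + a.val / p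

/-- The value of `℘` at the section `(a / p) σ`. -/
def secP (p : ℕ) (a : ZMod p) (σ : ℂ) : ℂ := thetaP ((a.val / p : ℂ) * σ) σ

/-- The value of the derivative of `℘` at the section `(a / p) σ`. -/
def secD (p : ℕ) (a : ZMod p) (σ : ℂ) : ℂ := thetaPDer ((a.val / p : ℂ) * σ) σ

variable [hp : NeZero p] {σ : ℂ} (hσ : 0 < σ.im)

include hσ

theorem theta_sec_ne_zero {k : ℤ} (hk : (k : ZMod p) ≠ 0) :
    theta 0 ((k / p : ℂ) * σ) σ ≠ 0 := by
  intro h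
  obtain ⟨m, n, hmn⟩ := exists_of_theta_eq_zero hσ h
  have hp0 : (p : ℝ) ≠ 0 := by exact_mod_cast hp.out
  have := (eq_of_mul_add_eq (a := k / p) (b := 0) (c := m) (d := n) hσ
    (by push_cast; rw [add_zero]; exact hmn)).1
  rw [div_eq_iff hp0] at this
  have h2 : k = m * p := by exact_mod_cast this
  exact hk ((ZMod.intCast_zmod_eq_zero_iff_dvd k p).mpr ⟨m, by rw [h2, mul_comm]⟩)

omit hσ in
theorem exists_int_eq_val_add {a : ZMod p} {k : ℤ} (hk : (k : ZMod p) = a) :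
    ∃ m : ℤ, (k / p : ℂ) = a.val / p + m := by
  have h : ((k - a.val : ℤ) : ZMod p) = 0 := by
    push_cast
    rw [hk, ZMod.natCast_val, ZMod.cast_id, sub_self]
  obtain ⟨m, hm⟩ := (ZMod.intCast_zmod_eq_zero_iff_dvd _ p).mp h
  refine ⟨m, ?_⟩
  have hp0 : (p : ℂ) ≠ 0 := by exact_mod_cast hp.out
  have : (k : ℂ) - a.val = p * m := by exact_mod_cast hm
  field_simp
  linear_combination this

theorem theta_val_ne_zero {a : ZMod p} (ha : a ≠ 0) :
    theta 0 ((a.val / p : ℂ) * σ) σ ≠ 0 := by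
  have := theta_sec_ne_zero hσ (k := (a.val : ℤ)) (p := p) (by
    rwa [Int.cast_natCast, ZMod.natCast_val, ZMod.cast_id])
  simpa using this

/-- J(z) + z/σ is periodic under z ↦ z + σ, so any integer representative of the residue gives the
same value. This lets arithmetic in `ZMod p` replace that of `ZMod.val`. -/
theorem secJ_intCast {a : ZMod p} (ha : a ≠ 0) {k : ℤ} (hk : (k : ZMod p) = a) :
    thetaJ ((k / p : ℂ) * σ) σ + k / p = secJ p a σ := by
  obtain ⟨m, hm⟩ := exists_int_eq_val_add hk
  have hσ0 : σ ≠ 0 := fun h => by simp [h] at hσ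
  have := int_periodic_of_theta_ne_zero (F := fun z => thetaJ z σ + z / σ) (fun z hz => by
    rw [thetaJ_add_tau hσ hz]
    field_simp
    ring) (theta_val_ne_zero hσ ha) m
  simp only [← add_mul, mul_div_cancel_right₀ _ hσ0] at this
  rw [hm, this, secJ]

theorem secP_intCast {a : ZMod p} (ha : a ≠ 0) {k : ℤ} (hk : (k : ZMod p) = a) :
    thetaP ((k / p : ℂ) * σ) σ = secP p a σ := by
  obtain ⟨m, hm⟩ := exists_int_eq_val_add hk
  have := int_periodic_of_theta_ne_zero (F := fun z => thetaP z σ)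
    (fun z hz => thetaP_add_tau hσ hz) (theta_val_ne_zero hσ ha) m
  simp only [← add_mul] at this
  rw [hm, this, secP]

theorem secD_intCast {a : ZMod p} (ha : a ≠ 0) {k : ℤ} (hk : (k : ZMod p) = a) :
    thetaPDer ((k / p : ℂ) * σ) σ = secD p a σ := by
  obtain ⟨m, hm⟩ := exists_int_eq_val_add hk
  have := int_periodic_of_theta_ne_zero (F := fun z => thetaPDer z σ)
    (fun z hz => thetaPDer_add_tau hσ hz) (theta_val_ne_zero hσ ha) m
  simp only [← add_mul] at this
  rw [hm, this, secD]

omit hσ in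
theorem intCast_neg_val (a : ZMod p) : ((-(a.val : ℤ) : ℤ) : ZMod p) = -a := by
  push_cast
  rw [ZMod.natCast_val, ZMod.cast_id]

omit hσ in
theorem intCast_val_add (a b : ZMod p) : (((a.val : ℤ) + b.val : ℤ) : ZMod p) = a + b := by
  push_cast
  rw [ZMod.natCast_val, ZMod.natCast_val, ZMod.cast_id, ZMod.cast_id]

theorem secJ_neg {a : ZMod p} (ha : a ≠ 0) : secJ p (-a) σ = -secJ p a σ := by
  rw [← secJ_intCast hσ (neg_ne_zero.mpr ha) (intCast_neg_val a), secJ]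
  push_cast
  rw [neg_div, neg_mul, thetaJ_neg]
  ring

theorem secP_neg {a : ZMod p} (ha : a ≠ 0) : secP p (-a) σ = secP p a σ := by
  rw [← secP_intCast hσ (neg_ne_zero.mpr ha) (intCast_neg_val a), secP]
  push_cast
  rw [neg_div, neg_mul, thetaP_neg]

theorem secD_neg {a : ZMod p} (ha : a ≠ 0) : secD p (-a) σ = -secD p a σ := by
  rw [← secD_intCast hσ (neg_ne_zero.mpr ha) (intCast_neg_val a), secD]
  push_cast
  rw [neg_div, neg_mul, thetaPDer_neg]

theorem theta_val_add_ne_zero {a b : ZMod p} (hab : a + b ≠ 0) :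
    theta 0 ((a.val / p : ℂ) * σ + (b.val / p : ℂ) * σ) σ ≠ 0 := by
  have := theta_sec_ne_zero hσ (k := (a.val : ℤ) + b.val) (p := p) (by rwa [intCast_val_add])
  push_cast at this
  rwa [add_div, add_mul] at this

theorem secJ_add {a b : ZMod p} (hab : a + b ≠ 0) :
    thetaJ ((a.val / p : ℂ) * σ + (b.val / p : ℂ) * σ) σ + (a.val / p + b.val / p) =
      secJ p (a + b) σ := by
  rw [← secJ_intCast hσ hab (intCast_val_add a b)]
  push_cast
  rw [add_div, add_mul]

theorem secP_add {a b : ZMod p} (hab : a + b ≠ 0) :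
    thetaP ((a.val / p : ℂ) * σ + (b.val / p : ℂ) * σ) σ = secP p (a + b) σ := by
  rw [← secP_intCast hσ hab (intCast_val_add a b)]
  push_cast
  rw [add_div, add_mul]

theorem secD_add {a b : ZMod p} (hab : a + b ≠ 0) :
    thetaPDer ((a.val / p : ℂ) * σ + (b.val / p : ℂ) * σ) σ = secD p (a + b) σ := by
  rw [← secD_intCast hσ hab (intCast_val_add a b)]
  push_cast
  rw [add_div, add_mul]

variable (h1 : theta 1 0 σ ≠ 0)

include h1

theorem secJ_add_sq {a b : ZMod p} (ha : a ≠ 0) (hb : b ≠ 0) (hab : a + b ≠ 0) :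
    (secJ p a σ + secJ p b σ - secJ p (a + b) σ) ^ 2 =
      secP p a σ + secP p b σ + secP p (a + b) σ + thetaT σ := by
  have h := thetaJ_add_sq hσ h1 (theta_val_ne_zero hσ ha) (theta_val_ne_zero hσ hb)
    (theta_val_add_ne_zero hσ hab)
  rw [secP_add hσ hab] at h
  rw [← secJ_add hσ hab, secJ, secJ, secP, secP, ← h]
  ring

theorem secD_left_add {a b : ZMod p} (ha : a ≠ 0) (hb : b ≠ 0) (hab : a + b ≠ 0) :
    secD p a σ + secD p (a + b) σ = 2 * (secJ p a σ + secJ p b σ - secJ p (a + b) σ) *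
      (secP p (a + b) σ - secP p a σ) := by
  have h := thetaPDer_left_add hσ h1 (theta_val_ne_zero hσ ha) (theta_val_ne_zero hσ hb)
    (theta_val_add_ne_zero hσ hab)
  rw [secP_add hσ hab, secD_add hσ hab] at h
  rw [← secJ_add hσ hab, secJ, secJ, secD, secP, h]
  simp only [secP]
  ring

theorem hasDerivAt_thetaT_sec {a b : ZMod p} (ha : a ≠ 0) (hb : b ≠ 0) (hab : a + b ≠ 0) :
    HasDerivAt thetaT (2 * Real.pi * I *
      (secP p a σ * secP p b σ + secP p a σ * secP p (a + b) σ + secP p b σ * secP p (a + b) σ -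
        (secD p a σ + 2 * (secJ p a σ + secJ p b σ - secJ p (a + b) σ) * secP p a σ) *
          (secJ p a σ + secJ p b σ - secJ p (a + b) σ))) σ := by
  have h := hasDerivAt_thetaT hσ h1 (theta_val_ne_zero hσ ha) (theta_val_ne_zero hσ hb)
    (by rw [add_mul]; exact theta_val_add_ne_zero hσ hab)
  simp only [add_mul (a.val / p : ℂ), secP_add hσ hab] at h
  refine h.congr_deriv ?_
  rw [← secJ_add hσ hab, secJ, secJ, secD]
  simp only [secP]
  ring

end Level

/-! ### Action of `Γ₀(p)` -/

theorem nonIntegral_sec {p : ℕ} [hp : NeZero p] {k : ℤ} (hk : (k : ZMod p) ≠ 0) :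
    NonIntegral (k / p : ℝ) 0 := by
  rintro ⟨m, n, hm, -⟩
  have hp0 : (p : ℝ) ≠ 0 := by exact_mod_cast hp.out
  rw [div_eq_iff hp0] at hm
  have h2 : k = m * p := by exact_mod_cast hm
  exact hk ((ZMod.intCast_zmod_eq_zero_iff_dvd k p).mpr ⟨m, by rw [h2, mul_comm]⟩)

theorem natCast_mul_im_pos (p : ℕ) [hp : NeZero p] (τ : ℍ) : 0 < ((p : ℂ) * τ).im := by
  simpa using mul_pos (Nat.cast_pos.mpr hp.pos) τ.im_pos

/-- The function `τ ↦ 𝔾_a(p τ)` on the upper half plane. -/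
def levelJ (p : ℕ) (a : ZMod p) (τ : ℍ) : ℂ := secJ p a (p * τ)

/-- Conjugating γ by diag(p, 1) gives an integral matrix δ acting on σ = p τ, because p divides the
lower left entry. It sends the characteristic (a/p, 0) to (a γ₁₁/p, a γ₁₂), whose second coordinate
is an integer and may be dropped. -/
theorem levelJ_slash {p : ℕ} [hp : NeZero p] {γ : SL(2, ℤ)}
    (hγ : γ ∈ CongruenceSubgroup.Gamma0 p) {a : ZMod p} (ha : a * ((γ 0 0 : ℤ) : ZMod p) ≠ 0) :
    levelJ p a ∣[(1 : ℤ)] γ = levelJ p (a * ((γ 0 0 : ℤ) : ZMod p)) := by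
  ext τ
  have hp0 : (p : ℂ) ≠ 0 := by exact_mod_cast hp.out
  have hp0' : (p : ℝ) ≠ 0 := by exact_mod_cast hp.out
  obtain ⟨c, hc⟩ := (ZMod.intCast_zmod_eq_zero_iff_dvd _ p).mp (CongruenceSubgroup.Gamma0_mem.mp hγ)
  have hdet := γ.det_coe
  rw [Matrix.det_fin_two] at hdet
  set δ : SL(2, ℤ) := ⟨!![γ 0 0, p * γ 0 1; c, γ 1 1], by
    rw [Matrix.det_fin_two_of]
    rw [hc] at hdet
    linarith⟩ with hδ
  set σ : ℍ := ⟨p * τ, natCast_mul_im_pos p τ⟩ with hσ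
  have hσc : (σ : ℂ) = p * τ := rfl
  have e00 : δ 0 0 = γ 0 0 := rfl
  have e01 : δ 0 1 = p * γ 0 1 := rfl
  have e10 : δ 1 0 = c := rfl
  have e11 : δ 1 1 = γ 1 1 := rfl
  have hcC : ((γ 1 0 : ℤ) : ℂ) = p * c := by rw [hc]; push_cast; ring
  have hmoeb : ((δ • σ : ℍ) : ℂ) = p * ((γ • τ : ℍ) : ℂ) := by
    rw [UpperHalfPlane.coe_specialLinearGroup_apply, UpperHalfPlane.coe_specialLinearGroup_apply,
      e00, e01, e10, e11, hσc]
    simp only [algebraMap_int_eq, eq_intCast]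
    push_cast
    rw [hcC, ← mul_div_assoc]
    congr 1 <;> ring
  have hden : UpperHalfPlane.denom (δ : GL (Fin 2) ℝ) σ = UpperHalfPlane.denom (γ : GL (Fin 2) ℝ) τ := by
    rw [ModularGroup.denom_apply, ModularGroup.denom_apply, e10, e11, hσc, hcC]
    ring
  have hval : ((a.val : ℤ) : ZMod p) = a := by
    rw [Int.cast_natCast, ZMod.natCast_val, ZMod.cast_id]
  have ha0 : a ≠ 0 := left_ne_zero_of_mul ha
  have hni : NonIntegral (a.val / p : ℝ) 0 := by
    have := nonIntegral_sec (p := p) (k := (a.val : ℤ)) (by rwa [hval])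
    simpa using this
  have h := congrFun (heckeG_slash δ hni) σ
  rw [ModularForm.SL_slash_apply, hden, zero_mul, zero_mul, add_zero, add_zero, e00, e01] at h
  have e1 : ((a.val : ℝ) / p * ((p * γ 0 1 : ℤ) : ℝ)) = 0 + ((a.val * γ 0 1 : ℤ) : ℝ) := by
    push_cast
    field_simp
    ring
  rw [e1, heckeG_add_int_right, heckeG, heckeG, hmoeb] at h
  rw [ModularForm.SL_slash_apply, levelJ, levelJ, secJ]
  have h2 := secJ_intCast (natCast_mul_im_pos p τ) ha (k := a.val * γ 0 0) (by
    push_cast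
    rw [ZMod.natCast_val, ZMod.cast_id])
  rw [← h2]
  push_cast at h ⊢
  simp only [add_zero] at h
  rw [h, hσc, div_mul_eq_mul_div]

/-! ### The theta constant and the Eisenstein series of weight two -/

/-- In the product expansion only the factor 1 - exp(-2πi z) vanishes at z = 0, and it does so
simply. The derivative is therefore the value at 0 of the remaining product. -/
theorem theta_one_zero {τ : ℂ} (hτ : 0 < τ.im) :
    theta 1 0 τ = cexp (Real.pi * I * (τ / 4)) *
      qPoch (cexp (2 * Real.pi * I * τ)) (cexp (2 * Real.pi * I * τ)) ^ 3 := by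
  have hq := norm_cexp_lt_one hτ
  set q := cexp (2 * Real.pi * I * τ) with hqdef
  have hw : HasDerivAt (fun z : ℂ => 1 - cexp (-(2 * Real.pi * I * z))) (2 * Real.pi * I) 0 := by
    have := ((((hasDerivAt_id (0 : ℂ)).const_mul (2 * Real.pi * I : ℂ)).neg).cexp).const_sub 1
    simpa using this
  set h : ℂ → ℂ := fun z => cexp (Real.pi * I * (z + τ / 4)) * qPoch q q *
    qPoch (cexp (2 * Real.pi * I * z) * q) q *
    qPoch (cexp (-(2 * Real.pi * I * z)) * q) q with hh
  have hd : DifferentiableAt ℂ h 0 := by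
    have h1 : Differentiable ℂ fun z : ℂ => qPoch (cexp (2 * Real.pi * I * z) * q) q :=
      (differentiable_qPoch hq).comp (by fun_prop)
    have h2 : Differentiable ℂ fun z : ℂ => qPoch (cexp (-(2 * Real.pi * I * z)) * q) q :=
      (differentiable_qPoch hq).comp (by fun_prop)
    rw [hh]
    exact (((by fun_prop : DifferentiableAt ℂ (fun z : ℂ =>
      cexp (Real.pi * I * (z + τ / 4)) * qPoch q q) 0)).mul (h1 0)).mul (h2 0)
  have := hasDerivAt_unique_of_eventuallyEq (hasDerivAt_theta 0 0 hτ) (hw.mul hd.hasDerivAt)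
    (Eventually.of_forall fun z => by
      simp only [Pi.mul_apply]
      rw [theta_eq_prod z hτ, ← hqdef, ← Complex.exp_neg, qPoch_eq_mul (cexp (-_)) hq, hh]
      ring)
  simp only [mul_zero, neg_zero, Complex.exp_zero, sub_self, zero_mul, add_zero] at this
  have := mul_left_cancel₀ Complex.two_pi_I_ne_zero this
  rw [this, hh]
  simp only [mul_zero, neg_zero, Complex.exp_zero, one_mul, zero_add]
  ring

theorem theta_one_zero_ne_zero {τ : ℂ} (hτ : 0 < τ.im) : theta 1 0 τ ≠ 0 := by
  rw [theta_one_zero hτ]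
  exact mul_ne_zero (Complex.exp_ne_zero _)
    (pow_ne_zero _ (qPoch_self_ne_zero (norm_cexp_lt_one hτ)))

theorem theta_one_zero_eq_eta {τ : ℂ} (hτ : 0 < τ.im) : theta 1 0 τ = ModularForm.eta τ ^ 3 := by
  rw [theta_one_zero hτ, ModularForm.eta, mul_pow]
  congr 1
  · rw [Function.Periodic.qParam, ← Complex.exp_nat_mul]
    congr 1
    push_cast
    ring
  · congr 1
    rw [qPoch]
    refine tprod_congr fun k => ?_
    rw [ModularForm.eta_q_eq_pow, pow_succ']

theorem eisTwo_eq_E2 (τ : ℍ) : eisTwo (cexp (2 * Real.pi * I * τ)) = EisensteinSeries.E2 τ := by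
  rw [EisensteinSeries.E2_eq_tsum_cexp, eisTwo,
    ← tsum_pow_div_one_sub_eq_tsum_sigma (UpperHalfPlane.norm_exp_two_pi_I_lt_one τ)]
  simp

/-- By the heat equation T/2 is the logarithmic derivative of θ'(0) = η³ in τ, while η contributes
E₂/24. Hence T/2 = 3 E₂/24. -/
theorem thetaT_eq_eisTwo {τ : ℂ} (hτ : 0 < τ.im) :
    thetaT τ = eisTwo (cexp (2 * Real.pi * I * τ)) / 4 := by
  have h1 := theta_one_zero_ne_zero hτ
  have hη := ModularForm.eta_ne_zero (z := τ) hτ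
  have hd := (ModularForm.differentiableAt_eta_of_mem_upperHalfPlaneSet (z := τ) hτ).hasDerivAt
  have h := hasDerivAt_unique_of_eventuallyEq (hasDerivAt_theta_zero 1 hτ) (hd.pow 3)
    (eventually_of_mem (UpperHalfPlane.isOpen_upperHalfPlaneSet.mem_nhds hτ) fun w hw =>
      theta_one_zero_eq_eta hw)
  have hl := ModularForm.logDeriv_eta_eq_E2 ⟨τ, hτ⟩
  rw [← eisTwo_eq_E2, logDeriv_apply, div_eq_iff hη] at hl
  change deriv ModularForm.eta τ = (Real.pi * I / 12) * eisTwo (cexp (2 * Real.pi * I * τ)) *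
    ModularForm.eta τ at hl
  rw [hl] at h
  rw [thetaT, div_eq_iff h1]
  apply mul_left_cancel₀ Complex.two_pi_I_ne_zero
  rw [theta_one_zero_eq_eta hτ]
  push_cast at h
  linear_combination 2 * h

/-! ### Expansions at infinity -/

/-- The summand of a Lambert series. -/
def lambertTerm (q : ℂ) (n : ℕ) : ℂ := q ^ n / (1 - q ^ n)

theorem summable_lambertTerm {q : ℂ} (hq : ‖q‖ < 1) : Summable (lambertTerm q) := by
  simpa [lambertTerm] using! summable_norm_pow_mul_geometric_div_one_sub 0 hq

/-- The part of the Lambert series over one residue class. -/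
def lambertClass (p : ℕ) (a : ZMod p) (q : ℂ) : ℂ := ∑' k : ℕ, lambertTerm q (a.val + p * k)

theorem summable_lambertClass {p : ℕ} [hp : NeZero p] {q : ℂ} (hq : ‖q‖ < 1) (m : ℕ) :
    Summable fun k : ℕ => lambertTerm q (m + p * k) :=
  (summable_lambertTerm hq).comp_injective fun a b h => by
    simpa [hp.out] using h

theorem norm_nome_lt_one (τ : ℍ) : ‖nome τ‖ < 1 := norm_cexp_lt_one τ.im_pos

theorem nome_ne_zero (τ : ℍ) : nome τ ≠ 0 := Complex.exp_ne_zero _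

theorem levelJ_eq_lambert {p : ℕ} [hp : NeZero p] {a : ZMod p} (ha : a ≠ 0) (τ : ℍ) :
    -levelJ p a τ = 1 / 2 - a.val / p + lambertClass p a (nome τ) -
      lambertClass p (-a) (nome τ) := by
  have hσ := natCast_mul_im_pos p τ
  have hp0 : (p : ℂ) ≠ 0 := by exact_mod_cast hp.out
  have hq := norm_nome_lt_one τ
  have hz : ∀ m n : ℤ, (a.val / p : ℂ) * (p * τ) ≠ m * (p * τ) + n := by
    intro m n h
    have hp0' : (p : ℝ) ≠ 0 := by exact_mod_cast hp.out
    have := (eq_of_mul_add_eq (a := a.val / p) (b := 0) (c := m) (d := n) hσ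
      (by push_cast; rw [add_zero]; exact h)).1
    rw [div_eq_iff hp0'] at this
    have h2 : (a.val : ℤ) = m * p := by exact_mod_cast this
    apply ha
    have h3 := (ZMod.intCast_zmod_eq_zero_iff_dvd (a.val : ℤ) p).mpr ⟨m, by rw [h2, mul_comm]⟩
    rwa [Int.cast_natCast, ZMod.natCast_val, ZMod.cast_id] at h3
  have hva : a.val ≠ 0 := (ZMod.val_ne_zero a).mpr ha
  have hneg : (-a).val = p - a.val := by
    have : NeZero a := ⟨ha⟩
    exact ZMod.val_neg_of_ne_zero a
  have hle : a.val < p := ZMod.val_lt a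
  have ew : cexp (2 * Real.pi * I * ((a.val / p : ℂ) * (p * τ))) = nome τ ^ a.val := by
    rw [nome, ← Complex.exp_nat_mul]
    congr 1
    field_simp
  have eq' : cexp (2 * Real.pi * I * (p * τ)) = nome τ ^ p := by
    rw [nome, ← Complex.exp_nat_mul]
    congr 1
    ring
  rw [levelJ, secJ, thetaJ_eq_tsum hσ hz, ew, eq']
  set q := nome τ
  have hq0 : q ≠ 0 := nome_ne_zero τ
  have e1 : ∀ k : ℕ, q ^ a.val * q ^ p * (q ^ p) ^ k / (1 - q ^ a.val * q ^ p * (q ^ p) ^ k) =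
      lambertTerm q (a.val + p * (k + 1)) := by
    intro k
    rw [lambertTerm, ← pow_mul, ← pow_add, ← pow_add, add_assoc, mul_add_one, add_comm p]
  have e2 : ∀ k : ℕ, (q ^ a.val)⁻¹ * (q ^ p) ^ (k + 1) / (1 - (q ^ a.val)⁻¹ * (q ^ p) ^ (k + 1)) =
      lambertTerm q ((-a).val + p * k) := by
    intro k
    have : (q ^ a.val)⁻¹ * (q ^ p) ^ (k + 1) = q ^ ((-a).val + p * k) := by
      rw [inv_mul_eq_iff_eq_mul₀ (pow_ne_zero _ hq0), ← pow_mul, ← pow_add, hneg]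
      congr 1
      rw [mul_add_one]
      omega
    rw [this, lambertTerm]
  have s2 : Summable fun k : ℕ => (q ^ a.val)⁻¹ * (q ^ p) ^ k / (1 - (q ^ a.val)⁻¹ * (q ^ p) ^ k) := by
    rw [← summable_nat_add_iff 1]
    simp only [e2]
    exact summable_lambertClass hq _
  rw [s2.tsum_eq_zero_add, tsum_congr e1, tsum_congr e2, lambertClass, lambertClass,
    (summable_lambertClass hq a.val).tsum_eq_zero_add, mul_zero, add_zero, pow_zero, mul_one]
  have h1 : 1 - q ^ a.val ≠ 0 := one_sub_pow_ne_zero hq hva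
  -- The k = 0 term of the second series has a negative exponent. Rewriting it supplies the missing
  -- first term of the class of `a` and changes the constant 1/2 into -1/2.
  have e3 : (q ^ a.val)⁻¹ / (1 - (q ^ a.val)⁻¹) = -1 - lambertTerm q a.val := by
    have h2 : q ^ a.val - 1 ≠ 0 := by
      rw [← neg_sub]; exact neg_ne_zero.mpr h1
    have h3 := pow_ne_zero a.val hq0
    rw [lambertTerm]
    field_simp
    ring
  rw [e3]
  ring

theorem tendsto_nome : Tendsto nome UpperHalfPlane.atImInfty (𝓝 0) := by
  refine (UpperHalfPlane.qParam_tendsto_atImInfty one_pos).congr fun τ => ?_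
  simp [Function.Periodic.qParam, nome]

theorem tendsto_lambertClass {p : ℕ} [hp : NeZero p] {a : ZMod p} (ha : a ≠ 0) :
    Tendsto (fun τ : ℍ => lambertClass p a (nome τ)) UpperHalfPlane.atImInfty (𝓝 0) := by
  have hva : a.val ≠ 0 := (ZMod.val_ne_zero a).mpr ha
  have hs : Summable fun k : ℕ => 2 * (1 / 2 : ℝ) ^ (a.val + p * k) :=
    (((summable_geometric_of_lt_one (by norm_num) (by norm_num) :
      Summable fun n : ℕ => (1 / 2 : ℝ) ^ n)).comp_injective (i := fun k : ℕ => a.val + p * k)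
        fun x y h => by simpa [hp.out] using h).mul_left 2
  have := tendsto_tsum_of_dominated_convergence (𝓕 := UpperHalfPlane.atImInfty)
    (f := fun (τ : ℍ) (k : ℕ) => lambertTerm (nome τ) (a.val + p * k)) (g := fun _ => 0) hs
    (fun k => by
      have h0 : a.val + p * k ≠ 0 := by omega
      have h := (tendsto_nome.pow (a.val + p * k))
      rw [zero_pow h0] at h
      have h' := h.div (h.const_sub 1) (by norm_num)
      simpa [lambertTerm] using! h')
    (by
      have hev : ∀ᶠ τ : ℍ in UpperHalfPlane.atImInfty, ‖nome τ‖ < 1 / 2 := by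
        have := tendsto_nome.norm
        rw [norm_zero] at this
        exact this.eventually_lt_const (by norm_num)
      filter_upwards [hev] with τ hτ k
      have h0 : a.val + p * k ≠ 0 := by omega
      have hb : ‖nome τ ^ (a.val + p * k)‖ ≤ (1 / 2) ^ (a.val + p * k) := by
        rw [norm_pow]
        exact pow_le_pow_left₀ (norm_nonneg _) hτ.le _
      have hb2 : ‖nome τ ^ (a.val + p * k)‖ ≤ 1 / 2 :=
        hb.trans (pow_le_of_le_one (by norm_num) (by norm_num) h0)
      have hd : 1 / 2 ≤ ‖1 - nome τ ^ (a.val + p * k)‖ := by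
        have := norm_sub_norm_le (1 : ℂ) (nome τ ^ (a.val + p * k))
        rw [norm_one] at this
        linarith
      rw [lambertTerm, norm_div, div_le_iff₀ (by linarith)]
      have h3 : (0 : ℝ) ≤ (1 / 2) ^ (a.val + p * k) := by positivity
      nlinarith)
  simpa [lambertClass] using this

theorem tendsto_levelJ {p : ℕ} [hp : NeZero p] {a : ZMod p} (ha : a ≠ 0) :
    Tendsto (fun τ : ℍ => -levelJ p a τ) UpperHalfPlane.atImInfty
      (𝓝 (1 / 2 - a.val / p)) := by
  simp only [levelJ_eq_lambert ha]
  simpa using (((tendsto_const_nhds (x := (1 / 2 - a.val / p : ℂ))).add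
    (tendsto_lambertClass ha)).sub (tendsto_lambertClass (neg_ne_zero.mpr ha)))

/-! ### Odd Dirichlet characters -/

section Characters

variable {p : ℕ} [hp : Fact p.Prime]

/-- The conductor is 1 or p, and the trivial character is even. -/
theorem isPrimitive_of_odd {χ : DirichletCharacter ℂ p} (hχ : χ.Odd) : χ.IsPrimitive := by
  rcases (Nat.dvd_prime hp.out).mp χ.conductor_dvd_level with h | h
  · rw [← DirichletCharacter.eq_one_iff_conductor_eq_one] at h
    rw [h, DirichletCharacter.Odd, MulChar.one_apply isUnit_one.neg] at hχ
    norm_num at hχ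
  · exact h

theorem LFunction_zero (χ : DirichletCharacter ℂ p) :
    DirichletCharacter.LFunction χ 0 = ∑ a : ZMod p, χ a * (1 / 2 - a.val / p) := by
  rw [DirichletCharacter.LFunction, ZMod.LFunction, neg_zero, Complex.cpow_zero, one_mul]
  refine Finset.sum_congr rfl fun a _ => ?_
  have : Fact (1 < p) := ⟨hp.out.one_lt⟩
  by_cases ha : a = 0
  · rw [ha, MulChar.map_zero, zero_mul, zero_mul]
  · have hp0 : (0 : ℝ) < p := by exact_mod_cast hp.out.pos
    rw [ZMod.toAddCircle_apply, hurwitzZeta_apply_zero]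
    · push_cast
      rfl
    · have := Nat.pos_of_ne_zero ((ZMod.val_ne_zero a).mpr ha)
      positivity
    · rw [div_le_one hp0]
      exact_mod_cast (ZMod.val_lt a).le

/-- Sorting the Lambert series by residue classes matches `levelJ_eq_lambert`. The classes a and -a
contribute equally because χ is odd, which produces the factor 2 of the Eisenstein series; the
constant terms add up to L(0, χ). -/
theorem LFunction_mul_heckeEis {χ : DirichletCharacter ℂ p} (hχ : χ.Odd)
    (hL : DirichletCharacter.LFunction χ 0 ≠ 0) (τ : ℍ) :
    DirichletCharacter.LFunction χ 0 * heckeEis 1 χ τ = ∑ a : ZMod p, χ a * -levelJ p a τ := by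
  have hq := norm_nome_lt_one τ
  have hsum : Summable fun n : ℕ => χ (n : ZMod p) * lambertTerm (nome τ) n := by
    refine Summable.of_norm_bounded (summable_lambertTerm hq).norm fun n => ?_
    rw [norm_mul]
    exact mul_le_of_le_one_left (norm_nonneg _) (DirichletCharacter.norm_le_one χ _)
  have e1 : ∑' n : ℕ+, χ ((n : ℕ) : ZMod p) * ((n : ℂ) ^ (1 - 1) * nome τ ^ (n : ℕ)) /
      (1 - nome τ ^ (n : ℕ)) = ∑ a : ZMod p, χ a * lambertClass p a (nome τ) := by
    have : ∑' n : ℕ, χ (n : ZMod p) * lambertTerm (nome τ) n =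
        ∑ a : ZMod p, χ a * lambertClass p a (nome τ) := by
      rw [Nat.sumByResidueClasses hsum p]
      refine Finset.sum_congr rfl fun a _ => ?_
      rw [lambertClass, ← tsum_mul_left]
      refine tsum_congr fun k => ?_
      congr 2
      push_cast
      rw [ZMod.natCast_val, ZMod.cast_id, CharP.cast_eq_zero, zero_mul, add_zero]
    rw [← this, ← tsum_zero_pnat_eq_tsum_nat hsum]
    simp [lambertTerm, mul_div_assoc]
  have e2 : ∑ a : ZMod p, χ a * lambertClass p (-a) (nome τ) =
      -∑ a : ZMod p, χ a * lambertClass p a (nome τ) := by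
    rw [← Equiv.sum_comp (Equiv.neg (ZMod p)), ← Finset.sum_neg_distrib]
    refine Finset.sum_congr rfl fun a _ => ?_
    rw [Equiv.neg_apply, neg_neg, hχ.eval_neg, neg_mul]
  have e3 : ∑ a : ZMod p, χ a * -levelJ p a τ = ∑ a : ZMod p, (χ a * (1 / 2 - a.val / p) +
      χ a * lambertClass p a (nome τ) - χ a * lambertClass p (-a) (nome τ)) := by
    refine Finset.sum_congr rfl fun a _ => ?_
    by_cases ha : a = 0
    · have : Fact (1 < p) := ⟨hp.out.one_lt⟩
      rw [ha, MulChar.map_zero]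
      ring
    · rw [levelJ_eq_lambert ha]
      ring
  rw [e3, Finset.sum_sub_distrib, Finset.sum_add_distrib, e2, ← LFunction_zero χ, heckeEis, e1,
    Nat.cast_one, sub_self]
  field_simp
  ring

/-! ### Balanced quadruples and the reduction of 𝓔_p to four terms -/

/-- Four residues of sum zero for which the first Bernoulli function is balanced. -/
structure BalancedQuad (p : ℕ) (t : Fin 4 → ZMod p) : Prop where
  ne_zero : ∀ i, t i ≠ 0
  sum_eq : t 0 + t 1 + t 2 + t 3 = 0
  add₀₁ : t 0 + t 1 ≠ 0
  add₁₂ : t 1 + t 2 ≠ 0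
  add₂₀ : t 2 + t 0 ≠ 0
  sum_val : ∀ a, a ≠ 0 → ∑ i, (a * t i).val = if a = 1 then p else if a = -1 then 3 * p else 2 * p

variable {t : Fin 4 → ZMod p} (ht : BalancedQuad p t)

include ht

theorem BalancedQuad.sum_bernoulli {a : ZMod p} (ha : a ≠ 0) (hp2 : p ≠ 2) :
    ∑ i, (1 / 2 - (a * t i).val / p : ℂ) =
      (if a = 1 then 1 else 0) - (if a = -1 then 1 else 0) := by
  have hp0 : (p : ℂ) ≠ 0 := by exact_mod_cast hp.out.ne_zero
  have h := congrArg (Nat.cast (R := ℂ)) (ht.sum_val a ha)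
  rw [Nat.cast_sum] at h
  rw [Finset.sum_sub_distrib, ← Finset.sum_div _ fun i => ((a * t i).val : ℂ), h]
  have h1 : (1 : ZMod p) ≠ -1 := by
    have : Fact (2 < p) := ⟨lt_of_le_of_ne hp.out.two_le (Ne.symm hp2)⟩
    exact (ZMod.neg_one_ne_one).symm
  by_cases h2 : a = 1
  · simp [h2, h1]
    field_simp
    norm_num
  · by_cases h3 : a = -1
    · simp [h3, h1.symm]
      field_simp
      norm_num
    · simp [h2, h3]
      field_simp
      norm_num

/-- The substitution a ↦ a t_i moves χ(t_i)⁻¹ inside the sum for L(0, χ). Summing over i leaves only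
a = ±1, hence χ(1) - χ(-1) = 2. -/
theorem BalancedQuad.LFunction_mul_sum (hp2 : p ≠ 2) {χ : DirichletCharacter ℂ p} (hχ : χ.Odd) :
    DirichletCharacter.LFunction χ 0 * ∑ i, χ (t i)⁻¹ = 2 := by
  have : Fact (1 < p) := ⟨hp.out.one_lt⟩
  rw [LFunction_zero χ, Finset.mul_sum]
  have h : ∀ i, (∑ a : ZMod p, χ a * (1 / 2 - a.val / p : ℂ)) * χ (t i)⁻¹ =
      ∑ a : ZMod p, χ a * (1 / 2 - (a * t i).val / p : ℂ) := by
    intro i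
    rw [← Equiv.sum_comp (Equiv.mulRight₀ (t i) (ht.ne_zero i)), Finset.sum_mul]
    refine Finset.sum_congr rfl fun a _ => ?_
    rw [Equiv.mulRight₀_apply, mul_right_comm, ← map_mul, mul_assoc,
      mul_inv_cancel₀ (ht.ne_zero i), mul_one]
  simp only [h]
  rw [Finset.sum_comm]
  have h2 : ∀ a : ZMod p, ∑ i, χ a * (1 / 2 - (a * t i).val / p : ℂ) =
      (if a = 1 then χ 1 else 0) - (if a = -1 then χ (-1) else 0) := by
    intro a
    by_cases ha : a = 0
    · subst ha
      simp [MulChar.map_zero]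
    · rw [← Finset.mul_sum, ht.sum_bernoulli ha hp2]
      split_ifs <;> simp_all
  simp only [h2]
  rw [Finset.sum_sub_distrib, Finset.sum_ite_eq', Finset.sum_ite_eq']
  simp only [Finset.mem_univ, if_true, map_one]
  rw [hχ]
  norm_num

/-- Replacing 1/L(0, χ) by half of the four-term character sum makes the summand bilinear in
characters. The sum over odd χ becomes a sum over all χ once χ(a) is replaced by (χ(a) - χ(-a))/2,
which kills the even ones. Orthogonality then selects a = ±t_i, and oddness of G combines the two.
The denominator 4 collects the two halves. -/
theorem BalancedQuad.eisSum_eq (hp2 : p ≠ 2) (τ : ℍ) : eisSum p τ = ∑ i, -levelJ p (t i) τ := by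
  classical
  have hp1 : (p : ℂ) - 1 ≠ 0 := by
    rw [sub_ne_zero]
    exact_mod_cast hp.out.one_lt.ne'
  have e0 : ∀ χ : DirichletCharacter ℂ p, χ.Odd ∧ χ.IsPrimitive ↔ χ.Odd := fun χ =>
    ⟨fun h => h.1, fun h => ⟨h, isPrimitive_of_odd h⟩⟩
  have e1 : ∀ χ : DirichletCharacter ℂ p, (∑ᶠ (_ : χ.Odd ∧ χ.IsPrimitive), heckeEis 1 χ τ) =
      ∑ i, ∑ a : ZMod p, (χ (t i)⁻¹ * χ a - χ (t i)⁻¹ * χ (-a)) * (-levelJ p a τ / 4) := by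
    intro χ
    simp only [finsum_eq_if, e0]
    split_ifs with h
    · have hL := ht.LFunction_mul_sum hp2 h
      have hL0 : DirichletCharacter.LFunction χ 0 ≠ 0 := by
        intro h0
        rw [h0, zero_mul] at hL
        norm_num at hL
      have hE := LFunction_mul_heckeEis h hL0 τ
      apply mul_left_cancel₀ hL0
      rw [hE]
      calc ∑ a : ZMod p, χ a * -levelJ p a τ = DirichletCharacter.LFunction χ 0 *
            (∑ i, χ (t i)⁻¹) * (∑ a : ZMod p, χ a * -levelJ p a τ) / 2 := by rw [hL]; ring
        _ = _ := by
          rw [mul_assoc, Finset.sum_mul, mul_div_assoc, Finset.sum_div]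
          congr 1
          refine Finset.sum_congr rfl fun i _ => ?_
          rw [Finset.mul_sum, Finset.sum_div]
          refine Finset.sum_congr rfl fun a _ => ?_
          rw [h.eval_neg]
          ring
    · have h' := (DirichletCharacter.even_or_odd χ).resolve_right h
      symm
      refine Finset.sum_eq_zero fun i _ => Finset.sum_eq_zero fun a _ => ?_
      rw [h'.eval_neg, sub_self, zero_mul]
  rw [eisSum, finsum_eq_sum_of_fintype]
  simp only [e1]
  rw [Finset.sum_comm, Finset.mul_sum]
  refine Finset.sum_congr rfl fun i _ => ?_
  rw [Finset.sum_comm]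
  have hu : IsUnit (t i) := (ht.ne_zero i).isUnit
  have e2 : ∀ a : ZMod p, ∑ χ : DirichletCharacter ℂ p,
      (χ (t i)⁻¹ * χ a - χ (t i)⁻¹ * χ (-a)) * (-levelJ p a τ / 4) =
      (if t i = a then ((p : ℂ) - 1) * (-levelJ p a τ / 4) else 0) -
      (if -t i = a then ((p : ℂ) - 1) * (-levelJ p a τ / 4) else 0) := by
    intro a
    rw [← Finset.sum_mul, Finset.sum_sub_distrib, DirichletCharacter.sum_char_inv_mul_char_eq ℂ hu,
      DirichletCharacter.sum_char_inv_mul_char_eq ℂ hu, Nat.totient_prime hp.out,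
      Nat.cast_sub hp.out.one_lt.le, Nat.cast_one, sub_mul]
    simp only [ite_mul, zero_mul, eq_neg_iff_add_eq_zero, neg_eq_iff_add_eq_zero]
  simp only [e2]
  rw [Finset.sum_sub_distrib, Finset.sum_ite_eq, Finset.sum_ite_eq]
  simp only [Finset.mem_univ, if_true]
  have e3 : levelJ p (-t i) τ = -levelJ p (t i) τ :=
    secJ_neg (natCast_mul_im_pos p τ) (ht.ne_zero i)
  rw [e3]
  field_simp
  ring

end Characters

/-! ### The quadratic relations and the quadratic forms -/

/-- An odd function and an even function on `ℤ / p` subject to the addition formula of `ζ`. -/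
structure ZetaData (p : ℕ) (G P : ZMod p → ℂ) (T : ℂ) : Prop where
  odd : ∀ a, a ≠ 0 → G (-a) = -G a
  even : ∀ a, a ≠ 0 → P (-a) = P a
  rel : ∀ a b, a ≠ 0 → b ≠ 0 → a + b ≠ 0 →
    (G a + G b - G (a + b)) ^ 2 = P a + P b + P (a + b) + T

namespace ZetaData

variable {p : ℕ} {G P : ZMod p → ℂ} {T : ℂ} (h : ZetaData p G P T)

include h

theorem flip (a b : ZMod p) (hab : a ≠ 0 ∧ b = -a) : G b = -G a := hab.2 ▸ h.odd a hab.1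

theorem rel_add (a b c : ZMod p) (hab : a ≠ 0 ∧ b ≠ 0 ∧ c ≠ 0 ∧ a + b = c) :
    (G a + G b - G c) ^ 2 = P a + P b + P c + T := by
  obtain ⟨ha, hb, hc, rfl⟩ := hab
  exact h.rel a b ha hb hc

theorem rel_zero (a b c : ZMod p) (hab : a ≠ 0 ∧ b ≠ 0 ∧ c ≠ 0 ∧ a + b = -c) :
    (G a + G b + G c) ^ 2 = P a + P b + P c + T := by
  obtain ⟨ha, hb, hc, he⟩ := hab
  have := h.rel a b ha hb (he ▸ neg_ne_zero.mpr hc)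
  rwa [he, h.odd c hc, h.even c hc, sub_neg_eq_add] at this

theorem sq_sub (a b : ZMod p) (hab : b ≠ 0 ∧ (a = b ∨ a = -b)) :
    G a ^ 2 - P a = G b ^ 2 - P b := by
  obtain ⟨hb, rfl | rfl⟩ := hab
  · rfl
  · rw [h.odd b hb, h.even b hb, neg_sq]

end ZetaData

/-- The combination of `G ^ 2 - P` in the logarithmic derivative of a product of theta functions. -/
def quadSum {p : ℕ} (G P : ZMod p → ℂ) (t : Fin 4 → ZMod p) : ℂ :=
  (G (t 0 + t 1) ^ 2 - P (t 0 + t 1)) + (G (t 1 + t 2) ^ 2 - P (t 1 + t 2)) +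
    (G (t 2 + t 0) ^ 2 - P (t 2 + t 0)) - ((G (t 0) ^ 2 - P (t 0)) + (G (t 1) ^ 2 - P (t 1)) +
    (G (t 2) ^ 2 - P (t 2)) + (G (t 3) ^ 2 - P (t 3)))

theorem balancedQuad_five : BalancedQuad 5 ![1, 1, 1, 2] := by
  constructor <;> decide

/-- For this and the larger primes, both sides become polynomials in G, P and T at the residues 1,
…, (p-1)/2, and their difference is an integral combination of the addition relations. The
coefficients solve the linear system obtained by comparing monomials; in particular they add up to
2p, the coefficient of T. The hypothesis `hx` is phrased with the residues t_i a_k⁻¹ as separate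
variables so that each instance is settled by `decide`. -/
theorem quadForm_five {G P : ZMod 5 → ℂ} {T : ℂ} (h : ZetaData 5 G P T) {x : ℕ → ℂ}
    (hx : ∀ k, ∀ v r₀ r₁ r₂ r₃ : ZMod 5, ((genIndex 5 k : ZMod 5) * v = 1 ∧ 1 * v = r₀ ∧
      1 * v = r₁ ∧ 1 * v = r₂ ∧ 2 * v = r₃) → x k = -(G r₀ + G r₁ + G r₂ + G r₃)) :
    quadForm 5 x = 2 * 5 * (T + 3 * quadSum G P ![1, 1, 1, 2]) := by
  have f3 := h.flip 2 3 (by decide)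
  have h1 := hx 1 1 1 1 1 2 (by decide)
  have h2 := hx 2 3 3 3 3 1 (by decide)
  have ea := h.sq_sub (1 + 1) 2 (by decide)
  simp only [quadSum, Matrix.cons_val, quadForm]
  rw [ea, h1, h2]
  simp only [f3]
  linear_combination (80) * (h.rel_add 1 1 2 (by decide)) +
    (-70) * (h.rel_zero 2 2 1 (by decide))

theorem balancedQuad_seven : BalancedQuad 7 ![1, 1, 2, 3] := by
  constructor <;> decide

theorem quadForm_seven {G P : ZMod 7 → ℂ} {T : ℂ} (h : ZetaData 7 G P T) {x : ℕ → ℂ}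
    (hx : ∀ k, ∀ v r₀ r₁ r₂ r₃ : ZMod 7, ((genIndex 7 k : ZMod 7) * v = 1 ∧ 1 * v = r₀ ∧
      1 * v = r₁ ∧ 2 * v = r₂ ∧ 3 * v = r₃) → x k = -(G r₀ + G r₁ + G r₂ + G r₃)) :
    quadForm 7 x = 2 * 7 * (T + 3 * quadSum G P ![1, 1, 2, 3]) := by
  have f4 := h.flip 3 4 (by decide)
  have f5 := h.flip 2 5 (by decide)
  have h1 := hx 1 1 1 1 2 3 (by decide)
  have h2 := hx 2 4 4 4 1 5 (by decide)
  have h3 := hx 3 5 5 5 3 1 (by decide)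
  have ea := h.sq_sub (1 + 1) 2 (by decide)
  have eb := h.sq_sub (1 + 2) 3 (by decide)
  have ec := h.sq_sub (2 + 1) 3 (by decide)
  simp only [quadSum, Matrix.cons_val, quadForm]
  rw [ea, eb, ec, h1, h2, h3]
  simp only [f4, f5]
  linear_combination (33) * (h.rel_add 1 1 2 (by decide)) +
    (41) * (h.rel_add 1 2 3 (by decide)) +
    (-37) * (h.rel_zero 2 2 3 (by decide)) +
    (-23) * (h.rel_zero 3 3 1 (by decide))

theorem balancedQuad_eleven : BalancedQuad 11 ![1, 2, 3, 5] := by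
  constructor <;> decide

theorem quadForm_eleven {G P : ZMod 11 → ℂ} {T : ℂ} (h : ZetaData 11 G P T) {x : ℕ → ℂ}
    (hx : ∀ k, ∀ v r₀ r₁ r₂ r₃ : ZMod 11, ((genIndex 11 k : ZMod 11) * v = 1 ∧ 1 * v = r₀ ∧
      2 * v = r₁ ∧ 3 * v = r₂ ∧ 5 * v = r₃) → x k = -(G r₀ + G r₁ + G r₂ + G r₃)) :
    quadForm 11 x = 2 * 11 * (T + 3 * quadSum G P ![1, 2, 3, 5]) := by
  have f6 := h.flip 5 6 (by decide)
  have f7 := h.flip 4 7 (by decide)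
  have f8 := h.flip 3 8 (by decide)
  have f9 := h.flip 2 9 (by decide)
  have h1 := hx 1 1 1 2 3 5 (by decide)
  have h2 := hx 2 6 6 1 7 8 (by decide)
  have h3 := hx 3 4 4 8 1 9 (by decide)
  have h4 := hx 4 9 9 7 5 1 (by decide)
  have h5 := hx 5 8 8 5 2 7 (by decide)
  have ea := h.sq_sub (1 + 2) 3 (by decide)
  have eb := h.sq_sub (2 + 3) 5 (by decide)
  have ec := h.sq_sub (3 + 1) 4 (by decide)
  simp only [quadSum, Matrix.cons_val, quadForm]
  rw [ea, eb, ec, h1, h2, h3, h4, h5]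
  simp only [f6, f7, f8, f9]
  linear_combination (40) * (h.rel_add 1 1 2 (by decide)) +
    (28) * (h.rel_add 1 2 3 (by decide)) +
    (-12) * (h.rel_add 1 3 4 (by decide)) +
    (-20) * (h.rel_add 1 4 5 (by decide)) +
    (-29) * (h.rel_add 2 2 4 (by decide)) +
    (31) * (h.rel_add 2 3 5 (by decide)) +
    (25) * (h.rel_zero 2 4 5 (by decide)) +
    (-16) * (h.rel_zero 3 3 5 (by decide)) +
    (-15) * (h.rel_zero 4 4 3 (by decide)) +
    (-10) * (h.rel_zero 5 5 1 (by decide))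

theorem balancedQuad_thirteen : BalancedQuad 13 ![1, 3, 4, 5] := by
  constructor <;> decide

theorem quadForm_thirteen {G P : ZMod 13 → ℂ} {T : ℂ} (h : ZetaData 13 G P T) {x : ℕ → ℂ}
    (hx : ∀ k, ∀ v r₀ r₁ r₂ r₃ : ZMod 13, ((genIndex 13 k : ZMod 13) * v = 1 ∧ 1 * v = r₀ ∧
      3 * v = r₁ ∧ 4 * v = r₂ ∧ 5 * v = r₃) → x k = -(G r₀ + G r₁ + G r₂ + G r₃)) :
    quadForm 13 x = 2 * 13 * (T + 3 * quadSum G P ![1, 3, 4, 5]) := by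
  have f7 := h.flip 6 7 (by decide)
  have f8 := h.flip 5 8 (by decide)
  have f9 := h.flip 4 9 (by decide)
  have f10 := h.flip 3 10 (by decide)
  have f11 := h.flip 2 11 (by decide)
  have h1 := hx 1 1 1 3 4 5 (by decide)
  have h2 := hx 2 7 7 8 2 9 (by decide)
  have h3 := hx 3 9 9 1 10 6 (by decide)
  have h4 := hx 4 10 10 4 1 11 (by decide)
  have h5 := hx 5 8 8 11 6 1 (by decide)
  have h6 := hx 6 2 2 6 8 10 (by decide)
  have ea := h.sq_sub (1 + 3) 4 (by decide)
  have eb := h.sq_sub (3 + 4) 6 (by decide)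
  have ec := h.sq_sub (4 + 1) 5 (by decide)
  simp only [quadSum, Matrix.cons_val, quadForm]
  rw [ea, eb, ec, h1, h2, h3, h4, h5, h6]
  simp only [f7, f8, f9, f10, f11]
  linear_combination (11) * (h.rel_add 1 1 2 (by decide)) +
    (31) * (h.rel_add 1 2 3 (by decide)) +
    (32) * (h.rel_add 1 3 4 (by decide)) +
    (19) * (h.rel_add 1 4 5 (by decide)) +
    (-19) * (h.rel_add 1 5 6 (by decide)) +
    (-11) * (h.rel_add 2 2 4 (by decide)) +
    (21) * (h.rel_add 2 3 5 (by decide)) +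
    (-33) * (h.rel_add 2 4 6 (by decide)) +
    (-8) * (h.rel_zero 2 5 6 (by decide)) +
    (5) * (h.rel_add 3 3 6 (by decide)) +
    (-9) * (h.rel_zero 3 4 6 (by decide)) +
    (1) * (h.rel_zero 4 4 5 (by decide)) +
    (-7) * (h.rel_zero 5 5 3 (by decide)) +
    (-7) * (h.rel_zero 6 6 1 (by decide))

theorem balancedQuad_seventeen : BalancedQuad 17 ![2, 3, 5, 7] := by
  constructor <;> decide

theorem quadForm_seventeen {G P : ZMod 17 → ℂ} {T : ℂ} (h : ZetaData 17 G P T) {x : ℕ → ℂ}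
    (hx : ∀ k, ∀ v r₀ r₁ r₂ r₃ : ZMod 17, ((genIndex 17 k : ZMod 17) * v = 1 ∧ 2 * v = r₀ ∧
      3 * v = r₁ ∧ 5 * v = r₂ ∧ 7 * v = r₃) → x k = -(G r₀ + G r₁ + G r₂ + G r₃)) :
    quadForm 17 x = 2 * 17 * (T + 3 * quadSum G P ![2, 3, 5, 7]) := by
  have f10 := h.flip 7 10 (by decide)
  have f11 := h.flip 6 11 (by decide)
  have f12 := h.flip 5 12 (by decide)
  have f13 := h.flip 4 13 (by decide)
  have f14 := h.flip 3 14 (by decide)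
  have f15 := h.flip 2 15 (by decide)
  have h1 := hx 1 1 2 3 5 7 (by decide)
  have h2 := hx 2 9 1 10 11 12 (by decide)
  have h3 := hx 3 6 12 1 13 8 (by decide)
  have h4 := hx 4 7 14 4 1 15 (by decide)
  have h5 := hx 5 5 10 15 8 1 (by decide)
  have h6 := hx 6 15 13 11 7 3 (by decide)
  have h7 := hx 7 14 11 8 2 13 (by decide)
  have h8 := hx 8 4 8 12 3 11 (by decide)
  have ea := h.sq_sub (2 + 3) 5 (by decide)
  have eb := h.sq_sub (3 + 5) 8 (by decide)
  have ec := h.sq_sub (5 + 2) 7 (by decide)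
  simp only [quadSum, Matrix.cons_val, quadForm]
  rw [ea, eb, ec, h1, h2, h3, h4, h5, h6, h7, h8]
  simp only [f10, f11, f12, f13, f14, f15]
  linear_combination (29) * (h.rel_add 1 1 2 (by decide)) +
    (35) * (h.rel_add 1 2 3 (by decide)) +
    (-5) * (h.rel_add 1 3 4 (by decide)) +
    (-11) * (h.rel_add 1 4 5 (by decide)) +
    (-1) * (h.rel_add 1 5 6 (by decide)) +
    (10) * (h.rel_add 1 6 7 (by decide)) +
    (-46) * (h.rel_add 1 7 8 (by decide)) +
    (5) * (h.rel_add 2 2 4 (by decide)) +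
    (28) * (h.rel_add 2 3 5 (by decide)) +
    (5) * (h.rel_add 2 4 6 (by decide)) +
    (2) * (h.rel_add 2 5 7 (by decide)) +
    (-14) * (h.rel_add 2 6 8 (by decide)) +
    (7) * (h.rel_zero 2 7 8 (by decide)) +
    (-4) * (h.rel_add 3 3 6 (by decide)) +
    (5) * (h.rel_add 3 4 7 (by decide)) +
    (16) * (h.rel_add 3 5 8 (by decide)) +
    (14) * (h.rel_zero 3 6 8 (by decide)) +
    (-4) * (h.rel_add 4 4 8 (by decide)) +
    (5) * (h.rel_zero 4 5 8 (by decide)) +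
    (4) * (h.rel_zero 4 6 7 (by decide)) +
    (-16) * (h.rel_zero 5 5 7 (by decide)) +
    (-7) * (h.rel_zero 6 6 5 (by decide)) +
    (17) * (h.rel_zero 7 7 3 (by decide)) +
    (-40) * (h.rel_zero 8 8 1 (by decide))

theorem balancedQuad_nineteen : BalancedQuad 19 ![3, 4, 5, 7] := by
  constructor <;> decide

theorem quadForm_nineteen {G P : ZMod 19 → ℂ} {T : ℂ} (h : ZetaData 19 G P T) {x : ℕ → ℂ}
    (hx : ∀ k, ∀ v r₀ r₁ r₂ r₃ : ZMod 19, ((genIndex 19 k : ZMod 19) * v = 1 ∧ 3 * v = r₀ ∧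
      4 * v = r₁ ∧ 5 * v = r₂ ∧ 7 * v = r₃) → x k = -(G r₀ + G r₁ + G r₂ + G r₃)) :
    quadForm 19 x = 2 * 19 * (T + 3 * quadSum G P ![3, 4, 5, 7]) := by
  have f11 := h.flip 8 11 (by decide)
  have f12 := h.flip 7 12 (by decide)
  have f13 := h.flip 6 13 (by decide)
  have f14 := h.flip 5 14 (by decide)
  have f15 := h.flip 4 15 (by decide)
  have f16 := h.flip 3 16 (by decide)
  have f17 := h.flip 2 17 (by decide)
  have h1 := hx 1 1 3 4 5 7 (by decide)
  have h2 := hx 2 10 11 2 12 13 (by decide)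
  have h3 := hx 3 13 1 14 8 15 (by decide)
  have h4 := hx 4 5 15 1 6 16 (by decide)
  have h5 := hx 5 4 12 16 1 9 (by decide)
  have h6 := hx 6 11 14 6 17 1 (by decide)
  have h7 := hx 7 17 13 11 9 5 (by decide)
  have h8 := hx 8 7 2 9 16 11 (by decide)
  have h9 := hx 9 3 9 12 15 2 (by decide)
  have ea := h.sq_sub (3 + 4) 7 (by decide)
  have eb := h.sq_sub (4 + 5) 9 (by decide)
  have ec := h.sq_sub (5 + 3) 8 (by decide)
  simp only [quadSum, Matrix.cons_val, quadForm]
  rw [ea, eb, ec, h1, h2, h3, h4, h5, h6, h7, h8, h9]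
  simp only [f11, f12, f13, f14, f15, f16, f17]
  linear_combination (37) * (h.rel_add 1 2 3 (by decide)) +
    (37) * (h.rel_add 1 3 4 (by decide)) +
    (11) * (h.rel_add 1 4 5 (by decide)) +
    (1) * (h.rel_add 1 5 6 (by decide)) +
    (13) * (h.rel_add 1 6 7 (by decide)) +
    (-32) * (h.rel_add 1 7 8 (by decide)) +
    (-59) * (h.rel_add 1 8 9 (by decide)) +
    (6) * (h.rel_add 2 2 4 (by decide)) +
    (38) * (h.rel_add 2 3 5 (by decide)) +
    (1) * (h.rel_add 2 4 6 (by decide)) +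
    (15) * (h.rel_add 2 5 7 (by decide)) +
    (-49) * (h.rel_add 2 6 8 (by decide)) +
    (-15) * (h.rel_add 2 7 9 (by decide)) +
    (-39) * (h.rel_zero 2 8 9 (by decide)) +
    (-2) * (h.rel_add 3 3 6 (by decide)) +
    (-9) * (h.rel_add 3 4 7 (by decide)) +
    (13) * (h.rel_add 3 5 8 (by decide)) +
    (-5) * (h.rel_add 3 6 9 (by decide)) +
    (-15) * (h.rel_zero 3 7 9 (by decide)) +
    (20) * (h.rel_add 4 4 8 (by decide)) +
    (25) * (h.rel_add 4 5 9 (by decide)) +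
    (12) * (h.rel_zero 4 6 9 (by decide)) +
    (-9) * (h.rel_zero 4 7 8 (by decide)) +
    (-2) * (h.rel_zero 5 5 9 (by decide)) +
    (-3) * (h.rel_zero 5 6 8 (by decide)) +
    (16) * (h.rel_zero 6 6 7 (by decide)) +
    (18) * (h.rel_zero 7 7 5 (by decide)) +
    (22) * (h.rel_zero 8 8 3 (by decide)) +
    (-8) * (h.rel_zero 9 9 1 (by decide))

/-- Packages the six cases so that the later argument is uniform in p: all it needs are a balanced
quadruple and the evaluation of 𝓕_p. -/
theorem exists_balancedQuad (p : ℕ) [hp : Fact p.Prime] (h5 : 5 ≤ p) (h19 : p ≤ 19) :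
    ∃ t, BalancedQuad p t ∧ ∀ {G P : ZMod p → ℂ} {T : ℂ}, ZetaData p G P T → ∀ {x : ℕ → ℂ},
      (∀ k, ∀ v : ZMod p, (genIndex p k : ZMod p) * v = 1 → x k = -∑ i, G (t i * v)) →
      quadForm p x = 2 * p * (T + 3 * quadSum G P t) := by
  have hpr := hp.out
  have key : ∀ {t : Fin 4 → ZMod p} {G : ZMod p → ℂ} {x : ℕ → ℂ},
      (∀ k, ∀ v : ZMod p, (genIndex p k : ZMod p) * v = 1 → x k = -∑ i, G (t i * v)) →
      ∀ k, ∀ v r₀ r₁ r₂ r₃ : ZMod p, ((genIndex p k : ZMod p) * v = 1 ∧ t 0 * v = r₀ ∧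
        t 1 * v = r₁ ∧ t 2 * v = r₂ ∧ t 3 * v = r₃) → x k = -(G r₀ + G r₁ + G r₂ + G r₃) := by
    rintro t G x hx k v r₀ r₁ r₂ r₃ ⟨h, rfl, rfl, rfl, rfl⟩
    rw [hx k v h, Fin.sum_univ_four]
  interval_cases p <;> first
    | exact ⟨_, balancedQuad_five, fun h _ hx => quadForm_five h (key hx)⟩
    | exact ⟨_, balancedQuad_seven, fun h _ hx => quadForm_seven h (key hx)⟩
    | exact ⟨_, balancedQuad_eleven, fun h _ hx => quadForm_eleven h (key hx)⟩
    | exact ⟨_, balancedQuad_thirteen, fun h _ hx => quadForm_thirteen h (key hx)⟩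
    | exact ⟨_, balancedQuad_seventeen, fun h _ hx => quadForm_seventeen h (key hx)⟩
    | exact ⟨_, balancedQuad_nineteen, fun h _ hx => quadForm_nineteen h (key hx)⟩
    | exact absurd hpr (by norm_num)

/-! ### Derivatives on the upper half plane -/

theorem eventually_comp_ofComplex {f : ℍ → ℂ} {F : ℂ → ℂ} (h : ∀ τ : ℍ, f τ = F τ) (τ : ℍ) :
    f ∘ UpperHalfPlane.ofComplex =ᶠ[𝓝 (τ : ℂ)] F := by
  filter_upwards [UpperHalfPlane.isOpen_upperHalfPlaneSet.mem_nhds τ.im_pos] with z hz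
  rw [Function.comp_apply, UpperHalfPlane.ofComplex_apply_of_im_pos hz, h]

theorem qDiff_eq {f : ℍ → ℂ} {F : ℂ → ℂ} {c : ℂ} (h : ∀ τ : ℍ, f τ = F τ) {τ : ℍ}
    (hF : HasDerivAt F (2 * Real.pi * I * c) τ) : qDiff f τ = c := by
  rw [qDiff, Derivative.normalizedDerivOfComplex, (eventually_comp_ofComplex h τ).deriv_eq, hF.deriv,
    inv_mul_cancel_left₀ Complex.two_pi_I_ne_zero]

theorem holo_of_differentiableAt {f : ℍ → ℂ} {F : ℂ → ℂ} (h : ∀ τ : ℍ, f τ = F τ)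
    (hF : ∀ τ : ℍ, DifferentiableAt ℂ F τ) : Holo f := fun τ =>
  UpperHalfPlane.mdifferentiableAt_iff.mpr
    ((hF τ).congr_of_eventuallyEq (eventually_comp_ofComplex h τ))

theorem HasDerivAt.comp_natCast_mul {F : ℂ → ℂ} {c : ℂ} (p : ℕ) {τ : ℂ}
    (h : HasDerivAt F (2 * Real.pi * I * c) (p * τ)) :
    HasDerivAt (fun τ => F (p * τ)) (2 * Real.pi * I * (p * c)) τ := by
  have h1 : HasDerivAt (fun τ : ℂ => (p : ℂ) * τ) p τ := by
    simpa using (hasDerivAt_id τ).const_mul (p : ℂ)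
  refine (h.comp τ h1).congr_deriv ?_
  ring

/-- Derivatives are carried in the form c · f · l, so that for products and quotients only the
logarithmic derivatives l need to be added or subtracted. -/
theorem HasDerivAt.mul_log {f g : ℂ → ℂ} {c l m x : ℂ} (hf : HasDerivAt f (c * (f x * l)) x)
    (hg : HasDerivAt g (c * (g x * m)) x) :
    HasDerivAt (fun y => f y * g y) (c * (f x * g x * (l + m))) x :=
  (hf.mul hg).congr_deriv (by ring)

theorem HasDerivAt.div_log {f g : ℂ → ℂ} {c l m x : ℂ} (hf : HasDerivAt f (c * (f x * l)) x)
    (hg : HasDerivAt g (c * (g x * m)) x) (h0 : g x ≠ 0) :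
    HasDerivAt (fun y => f y / g y) (c * (f x / g x * (l - m))) x :=
  (hf.div hg h0).congr_deriv (by field_simp)

/-- Completing the square makes J + v appear. The leftover v² cancels in the theta quotient, because
(a+b)² + (b+c)² + (c+a)² = a² + b² + c² + (a+b+c)². -/
theorem hasDerivAt_theta_section_log {v σ : ℂ} (hσ : 0 < σ.im) (h : theta 0 (v * σ) σ ≠ 0) :
    HasDerivAt (fun σ => theta 0 (v * σ) σ) (2 * Real.pi * I * (theta 0 (v * σ) σ *
      (1 / 2 * ((thetaJ (v * σ) σ + v) ^ 2 - v ^ 2 - thetaP (v * σ) σ)))) σ := by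
  refine (hasDerivAt_theta_section v 0 hσ).congr_deriv ?_
  rw [thetaP, thetaJ]
  field_simp
  ring

theorem hasDerivAt_theta_one_zero_log {σ : ℂ} (hσ : 0 < σ.im) :
    HasDerivAt (fun σ => theta 1 0 σ) (2 * Real.pi * I * (theta 1 0 σ * (1 / 2 * thetaT σ))) σ := by
  have := theta_one_zero_ne_zero hσ
  refine (hasDerivAt_theta_zero 1 hσ).congr_deriv ?_
  rw [thetaT]
  field_simp

/-! ### Products of theta functions -/

section Sum

variable {p : ℕ} [hp : NeZero p] {a b c : ZMod p}

/-- The four term combination of weight one Eisenstein series. -/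
def secSum (p : ℕ) (a b c : ZMod p) (σ : ℂ) : ℂ :=
  secJ p a σ + secJ p b σ + secJ p c σ - secJ p (a + b + c) σ

theorem val_add_three (a b c : ZMod p) :
    (((a.val : ℤ) + b.val + c.val : ℤ) : ZMod p) = a + b + c := by
  push_cast
  simp only [ZMod.natCast_val, ZMod.cast_id]

theorem theta_val_add_three_ne_zero (hs : a + b + c ≠ 0) {σ : ℂ} (hσ : 0 < σ.im) :
    theta 0 ((a.val / p : ℂ) * σ + (b.val / p : ℂ) * σ + (c.val / p : ℂ) * σ) σ ≠ 0 := by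
  have := theta_sec_ne_zero hσ (k := (a.val : ℤ) + b.val + c.val) (p := p)
    (by rwa [val_add_three])
  push_cast at this
  rwa [add_div, add_div, add_mul, add_mul] at this

/-- The shifts a/p cancel because the fourth theta value is taken at the sum of the chosen
representatives; `secJ_intCast` then identifies it with the residue class. -/
theorem secSum_eq_prod (ha : a ≠ 0) (hb : b ≠ 0) (hc : c ≠ 0) (hs : a + b + c ≠ 0) {σ : ℂ}
    (hσ : 0 < σ.im) :
    secSum p a b c σ = theta 1 0 σ * theta 0 ((a.val / p + b.val / p : ℂ) * σ) σ *
      theta 0 ((b.val / p + c.val / p : ℂ) * σ) σ * theta 0 ((c.val / p + a.val / p : ℂ) * σ) σ /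
      (theta 0 ((a.val / p : ℂ) * σ) σ * theta 0 ((b.val / p : ℂ) * σ) σ *
        theta 0 ((c.val / p : ℂ) * σ) σ *
        theta 0 ((a.val / p + b.val / p + c.val / p : ℂ) * σ) σ) := by
  have h := thetaJ_add_add hσ (theta_val_ne_zero hσ ha) (theta_val_ne_zero hσ hb)
    (theta_val_ne_zero hσ hc) (theta_val_add_three_ne_zero hs hσ)
  have h3 := secJ_intCast hσ hs (val_add_three a b c)
  push_cast at h3
  rw [add_div, add_div, add_mul, add_mul] at h3
  rw [secSum, ← h3, secJ, secJ, secJ]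
  simp only [add_mul]
  rw [← h]
  ring

theorem secSum_ne_zero (ha : a ≠ 0) (hb : b ≠ 0) (hc : c ≠ 0) (hs : a + b + c ≠ 0)
    (hab : a + b ≠ 0) (hbc : b + c ≠ 0) (hca : c + a ≠ 0) {σ : ℂ} (hσ : 0 < σ.im) :
    secSum p a b c σ ≠ 0 := by
  rw [secSum_eq_prod ha hb hc hs hσ]
  simp only [add_mul]
  exact div_ne_zero (mul_ne_zero (mul_ne_zero (mul_ne_zero (theta_one_zero_ne_zero hσ)
    (theta_val_add_ne_zero hσ hab)) (theta_val_add_ne_zero hσ hbc)) (theta_val_add_ne_zero hσ hca))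
    (mul_ne_zero (mul_ne_zero (mul_ne_zero (theta_val_ne_zero hσ ha) (theta_val_ne_zero hσ hb))
    (theta_val_ne_zero hσ hc)) (theta_val_add_three_ne_zero hs hσ))

/-- Logarithmic differentiation of the theta quotient: θ'(0) gives T/2, the three numerator sections
and the four denominator sections give the signed terms of `quadSum`. -/
theorem hasDerivAt_secSum (ha : a ≠ 0) (hb : b ≠ 0) (hc : c ≠ 0) (hs : a + b + c ≠ 0)
    (hab : a + b ≠ 0) (hbc : b + c ≠ 0) (hca : c + a ≠ 0) {σ : ℂ} (hσ : 0 < σ.im) :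
    HasDerivAt (secSum p a b c) (2 * Real.pi * I * (secSum p a b c σ * (1 / 2 * (thetaT σ +
      quadSum (fun k => secJ p k σ) (fun k => secP p k σ) ![a, b, c, a + b + c])))) σ := by
  have na := theta_val_ne_zero hσ ha
  have nb := theta_val_ne_zero hσ hb
  have nc := theta_val_ne_zero hσ hc
  have ns := theta_val_add_three_ne_zero hs hσ
  have nab := theta_val_add_ne_zero hσ hab
  have nbc := theta_val_add_ne_zero hσ hbc
  have nca := theta_val_add_ne_zero hσ hca
  have ea := secJ_add hσ hab
  have eb := secJ_add hσ hbc
  have ec := secJ_add hσ hca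
  have es := secJ_intCast hσ hs (val_add_three a b c)
  have fa := secP_add hσ hab
  have fb := secP_add hσ hbc
  have fc := secP_add hσ hca
  have fs := secP_intCast hσ hs (val_add_three a b c)
  push_cast at es fs
  rw [add_div, add_div] at es fs
  simp only [← add_mul] at ns nab nbc nca ea eb ec es fa fb fc fs
  have hnum := (((hasDerivAt_theta_one_zero_log hσ).mul_log
    (hasDerivAt_theta_section_log hσ nab)).mul_log
    (hasDerivAt_theta_section_log hσ nbc)).mul_log (hasDerivAt_theta_section_log hσ nca)
  have hden := (((hasDerivAt_theta_section_log hσ na).mul_log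
    (hasDerivAt_theta_section_log hσ nb)).mul_log
    (hasDerivAt_theta_section_log hσ nc)).mul_log (hasDerivAt_theta_section_log hσ ns)
  have h := (hnum.div_log hden (mul_ne_zero (mul_ne_zero (mul_ne_zero na nb) nc) ns)).congr_of_eventuallyEq
    (f₁ := secSum p a b c)
    (eventually_of_mem (UpperHalfPlane.isOpen_upperHalfPlaneSet.mem_nhds hσ) fun w hw =>
      secSum_eq_prod ha hb hc hs hw)
  refine h.congr_deriv ?_
  rw [← secSum_eq_prod ha hb hc hs hσ, ea, eb, ec, es, fa, fb, fc, fs]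
  simp only [quadSum, Matrix.cons_val]
  simp only [secJ, secP]
  ring

end Sum

/-! ### The generators -/

section Generators

variable {p : ℕ} [hp : Fact p.Prime]

theorem gamma0_diag_mul {γ : SL(2, ℤ)} (hγ : γ ∈ CongruenceSubgroup.Gamma0 p) :
    ((γ 0 0 : ℤ) : ZMod p) * ((γ 1 1 : ℤ) : ZMod p) = 1 := by
  have h := congrArg (Int.cast (R := ZMod p)) γ.det_coe
  rw [Matrix.det_fin_two] at h
  push_cast at h
  rw [CongruenceSubgroup.Gamma0_mem.mp hγ, mul_zero, sub_zero] at h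
  exact h

theorem gamma0_upper_left {γ : SL(2, ℤ)} (hγ : γ ∈ CongruenceSubgroup.Gamma0 p) :
    ((γ 0 0 : ℤ) : ZMod p) = ((γ 1 1 : ℤ) : ZMod p)⁻¹ :=
  eq_inv_of_mul_eq_one_left (gamma0_diag_mul hγ)

theorem gamma0_lower_right_ne_zero {γ : SL(2, ℤ)} (hγ : γ ∈ CongruenceSubgroup.Gamma0 p) :
    ((γ 1 1 : ℤ) : ZMod p) ≠ 0 := right_ne_zero_of_mul_eq_one (gamma0_diag_mul hγ)

variable {t : Fin 4 → ZMod p} (ht : BalancedQuad p t)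

include ht

/-- On Γ₀(p) the diagonal entries are inverse to each other modulo p, so the action by γ₁₁ on the
sections is division by γ₂₂. -/
theorem BalancedQuad.sum_slash {γ : SL(2, ℤ)} (hγ : γ ∈ CongruenceSubgroup.Gamma0 p) {u : ZMod p}
    (hu : u ≠ 0) : (fun τ => ∑ i, -levelJ p (t i * u) τ) ∣[(1 : ℤ)] γ =
      fun τ => ∑ i, -levelJ p (t i * (u * ((γ 1 1 : ℤ) : ZMod p)⁻¹)) τ := by
  have hd := gamma0_lower_right_ne_zero hγ
  have e : ∀ u, (fun τ => ∑ i, -levelJ p (t i * u) τ) = ∑ i, -levelJ p (t i * u) := by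
    intro u
    ext τ
    simp
  rw [e, e, SlashAction.sum_slash]
  refine Finset.sum_congr rfl fun i _ => ?_
  rw [SlashAction.neg_slash, levelJ_slash hγ, gamma0_upper_left hγ, mul_assoc]
  rw [gamma0_upper_left hγ]
  exact mul_ne_zero (mul_ne_zero (ht.ne_zero i) hu) (inv_ne_zero hd)

theorem BalancedQuad.eisSum_eq' (hp2 : p ≠ 2) :
    eisSum p = fun τ => ∑ i, -levelJ p (t i * 1) τ := by
  ext τ
  simp only [mul_one]
  exact ht.eisSum_eq hp2 τ

theorem BalancedQuad.gen_eq (hp2 : p ≠ 2) {d : ZMod p} (hd : d ≠ 0) :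
    gen p d = fun τ => ∑ i, -levelJ p (t i * d⁻¹) τ := by
  obtain ⟨h1, h2⟩ := diamondRep_spec p (Units.mk0 d hd)
  rw [Units.val_mk0] at h1 h2
  rw [gen, ht.eisSum_eq' hp2, ht.sum_slash h1 one_ne_zero, h2, one_mul]

theorem BalancedQuad.gen_apply (hp2 : p ≠ 2) {d : ZMod p} (hd : d ≠ 0) (τ : ℍ) :
    gen p d τ = ∑ i, -levelJ p (t i * d⁻¹) τ := by
  rw [ht.gen_eq hp2 hd]

theorem BalancedQuad.eisSum_slash (hp2 : p ≠ 2) {γ : SL(2, ℤ)}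
    (hγ : γ ∈ CongruenceSubgroup.Gamma0 p) :
    eisSum p ∣[(1 : ℤ)] γ = gen p ((γ 1 1 : ℤ) : ZMod p) := by
  rw [ht.gen_eq hp2 (gamma0_lower_right_ne_zero hγ), ht.eisSum_eq' hp2,
    ht.sum_slash hγ one_ne_zero, one_mul]

theorem BalancedQuad.gen_slash (hp2 : p ≠ 2) {γ : SL(2, ℤ)}
    (hγ : γ ∈ CongruenceSubgroup.Gamma0 p) {a : ZMod p} (ha : a ≠ 0) :
    gen p a ∣[(1 : ℤ)] γ = gen p (a * ((γ 1 1 : ℤ) : ZMod p)) := by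
  rw [ht.gen_eq hp2 (mul_ne_zero ha (gamma0_lower_right_ne_zero hγ)), ht.gen_eq hp2 ha,
    ht.sum_slash hγ (inv_ne_zero ha), mul_inv]

theorem BalancedQuad.gen_neg (hp2 : p ≠ 2) {a : ZMod p} (ha : a ≠ 0) :
    gen p (-a) = -gen p a := by
  rw [ht.gen_eq hp2 (neg_ne_zero.mpr ha), ht.gen_eq hp2 ha]
  ext τ
  rw [Pi.neg_apply, ← Finset.sum_neg_distrib]
  refine Finset.sum_congr rfl fun i _ => ?_
  rw [inv_neg, mul_neg, levelJ,
    secJ_neg (natCast_mul_im_pos p τ) (mul_ne_zero (ht.ne_zero i) (inv_ne_zero ha)), levelJ]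

/-- The constant term is the sum of 1/2 - {t_i a⁻¹ / p}, which the balancing condition evaluates. It
is what distinguishes the equations of different classes. -/
theorem BalancedQuad.tendsto_gen (hp2 : p ≠ 2) {a : ZMod p} (ha : a ≠ 0) :
    Tendsto (gen p a) UpperHalfPlane.atImInfty
      (𝓝 ((if a = 1 then 1 else 0) - (if a = -1 then 1 else 0))) := by
  have h := ht.sum_bernoulli (inv_ne_zero ha) hp2
  simp only [inv_eq_iff_eq_inv, inv_neg, inv_one] at h
  rw [ht.gen_eq hp2 ha, ← h]
  refine tendsto_finsetSum _ fun i _ => ?_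
  rw [mul_comm a⁻¹]
  exact tendsto_levelJ (mul_ne_zero (ht.ne_zero i) (inv_ne_zero ha))

omit ht in
/-- The sections at `p τ`, twisted by a unit, satisfy the addition formula. -/
theorem zetaData_level (τ : ℍ) {u : ZMod p} (hu : u ≠ 0) :
    ZetaData p (fun k => levelJ p (k * u) τ) (fun k => secP p (k * u) (p * τ))
      (thetaT (p * τ)) := by
  have hσ := natCast_mul_im_pos p τ
  refine ⟨fun a ha => ?_, fun a ha => ?_, fun a b ha hb hab => ?_⟩
  · rw [neg_mul]
    exact secJ_neg hσ (mul_ne_zero ha hu)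
  · rw [neg_mul]
    exact secP_neg hσ (mul_ne_zero ha hu)
  · have h := secJ_add_sq hσ (theta_one_zero_ne_zero hσ) (mul_ne_zero ha hu) (mul_ne_zero hb hu)
      (by rw [← add_mul]; exact mul_ne_zero hab hu)
    rw [← add_mul] at h
    exact h

/-- Since t₃ = -(t₀ + t₁ + t₂) and G is odd, the fourth summand enters with a minus sign, as the
product formula requires. -/
theorem BalancedQuad.gen_eq_secSum (hp2 : p ≠ 2) {a : ZMod p} (ha : a ≠ 0) (τ : ℍ) :
    gen p a τ = -secSum p (t 0 * a⁻¹) (t 1 * a⁻¹) (t 2 * a⁻¹) (p * τ) := by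
  rw [ht.gen_apply hp2 ha, Fin.sum_univ_four, secSum]
  have h3 : t 3 = -(t 0 + t 1 + t 2) := by linear_combination ht.sum_eq
  have h := secJ_neg (natCast_mul_im_pos p τ) (mul_ne_zero (ht.ne_zero 3) (inv_ne_zero ha))
  rw [← neg_mul, h3, neg_neg] at h
  simp only [levelJ]
  rw [← add_mul, ← add_mul, h, h3]
  ring

theorem BalancedQuad.secSum_conditions {u : ZMod p} (hu : u ≠ 0) :
    (t 0 * u ≠ 0 ∧ t 1 * u ≠ 0 ∧ t 2 * u ≠ 0 ∧ t 0 * u + t 1 * u + t 2 * u ≠ 0) ∧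
      t 0 * u + t 1 * u ≠ 0 ∧ t 1 * u + t 2 * u ≠ 0 ∧ t 2 * u + t 0 * u ≠ 0 := by
  simp only [← add_mul]
  have h3 : t 0 + t 1 + t 2 = -t 3 := by linear_combination ht.sum_eq
  refine ⟨⟨mul_ne_zero (ht.ne_zero _) hu, mul_ne_zero (ht.ne_zero _) hu,
    mul_ne_zero (ht.ne_zero _) hu, mul_ne_zero ?_ hu⟩, mul_ne_zero ht.add₀₁ hu,
    mul_ne_zero ht.add₁₂ hu, mul_ne_zero ht.add₂₀ hu⟩
  rw [h3]
  exact neg_ne_zero.mpr (ht.ne_zero 3)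

theorem BalancedQuad.gen_ne_zero (hp2 : p ≠ 2) {a : ZMod p} (ha : a ≠ 0) (τ : ℍ) :
    gen p a τ ≠ 0 := by
  obtain ⟨⟨h1, h2, h3, h4⟩, h5, h6, h7⟩ := ht.secSum_conditions (inv_ne_zero ha)
  rw [ht.gen_eq_secSum hp2 ha]
  exact neg_ne_zero.mpr (secSum_ne_zero h1 h2 h3 h4 h5 h6 h7 (natCast_mul_im_pos p τ))

theorem BalancedQuad.hasDerivAt_gen {a : ZMod p} (ha : a ≠ 0) (τ : ℍ) :
    HasDerivAt (fun τ => -secSum p (t 0 * a⁻¹) (t 1 * a⁻¹) (t 2 * a⁻¹) (p * τ))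
      (2 * Real.pi * I * (-secSum p (t 0 * a⁻¹) (t 1 * a⁻¹) (t 2 * a⁻¹) (p * τ) *
        (p / 2 * (thetaT (p * τ) + quadSum (fun k => levelJ p (k * a⁻¹) τ)
          (fun k => secP p (k * a⁻¹) (p * τ)) t)))) τ := by
  obtain ⟨⟨h1, h2, h3, h4⟩, h5, h6, h7⟩ := ht.secSum_conditions (inv_ne_zero ha)
  have h := ((hasDerivAt_secSum h1 h2 h3 h4 h5 h6 h7 (natCast_mul_im_pos p τ)).comp_natCast_mul p).neg
  refine h.congr_deriv ?_
  have e := (zetaData_level τ (inv_ne_zero ha)).sq_sub (t 0 + t 1 + t 2) (t 3)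
    ⟨ht.ne_zero 3, Or.inr (by linear_combination ht.sum_eq)⟩
  simp only [quadSum, Matrix.cons_val, add_mul, levelJ] at e ⊢
  rw [e]
  ring

theorem BalancedQuad.holo_gen (hp2 : p ≠ 2) {a : ZMod p} (ha : a ≠ 0) : Holo (gen p a) :=
  holo_of_differentiableAt (ht.gen_eq_secSum hp2 ha) fun τ => (ht.hasDerivAt_gen ha τ).differentiableAt

theorem BalancedQuad.qDiff_gen (hp2 : p ≠ 2) {a : ZMod p} (ha : a ≠ 0) (τ : ℍ) :
    qDiff (gen p a) τ = gen p a τ * (p / 2 * (thetaT (p * τ) +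
      quadSum (fun k => levelJ p (k * a⁻¹) τ) (fun k => secP p (k * a⁻¹) (p * τ)) t)) := by
  rw [qDiff_eq (ht.gen_eq_secSum hp2 ha) (ht.hasDerivAt_gen ha τ), ht.gen_eq_secSum hp2 ha]

omit ht in
theorem eisTwo_nome_pow (τ : ℍ) : eisTwo (nome τ ^ p) = 4 * thetaT (p * τ) := by
  rw [thetaT_eq_eisTwo (natCast_mul_im_pos p τ), nome, ← Complex.exp_nat_mul]
  ring_nf

end Generators

/-- The differential equation of level `p`. -/
theorem gen_system (p : ℕ) [hp : Fact p.Prime] (h5 : 5 ≤ p) (h19 : p ≤ 19) {a : ZMod p}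
    (ha : a ≠ 0) (τ : ℍ) : systemLHS p a τ = systemRHS p a τ := by
  obtain ⟨t, ht, hQ⟩ := exists_balancedQuad p h5 h19
  have hp2 : p ≠ 2 := by omega
  have h := hQ (zetaData_level τ (inv_ne_zero ha))
    (x := fun k => gen p (a * (genIndex p k : ZMod p)) τ) fun k v hv => by
      rw [ht.gen_apply hp2 (mul_ne_zero ha (left_ne_zero_of_mul_eq_one hv)), Finset.sum_neg_distrib,
        mul_inv, inv_eq_of_mul_eq_one_right hv]
      simp only [mul_assoc, mul_comm v]
  -- With T = `thetaT (p * τ)` and Q the value of `quadSum`, what remains is 12 (p/2)(T + Q) - 4pT =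
  -- 2p(T + 3Q).
  rw [systemRHS, h, systemLHS, ht.qDiff_gen hp2 ha, eisTwo_nome_pow]
  have := ht.gen_ne_zero hp2 ha τ
  field_simp
  ring

/-! ### The action of `Γ₀(p)` on the systems -/

/-- The primes between `5` and `19`. -/
def SmallPrime (p : ℕ) : Prop := p = 5 ∨ p = 7 ∨ p = 11 ∨ p = 13 ∨ p = 17 ∨ p = 19

theorem smallPrime_of_le (p : ℕ) [hp : Fact p.Prime] (h5 : 5 ≤ p) (h19 : p ≤ 19) :
    SmallPrime p := by
  have hpr := hp.out
  rw [SmallPrime]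
  interval_cases p <;> first
    | (simp; done)
    | (exfalso; revert hpr; norm_num)

/-- With `genIndex_injective` and `genIndex_ne_zero`, this says that the a_k represent the nonzero
residues modulo ±1 exactly once each. -/
theorem exists_genIndex {p : ℕ} (hp : SmallPrime p) :
    ∀ d : ZMod p, d ≠ 0 → ∃ k : Fin ((p - 1) / 2),
      d = (genIndex p (k + 1) : ZMod p) ∨ d = -(genIndex p (k + 1) : ZMod p) := by
  rcases hp with rfl | rfl | rfl | rfl | rfl | rfl <;> decide

theorem genIndex_injective {p : ℕ} (hp : SmallPrime p) :
    ∀ j k : Fin ((p - 1) / 2), ((genIndex p (j + 1) : ZMod p) = genIndex p (k + 1) ∨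
      (genIndex p (j + 1) : ZMod p) = -(genIndex p (k + 1) : ZMod p)) → j = k := by
  rcases hp with rfl | rfl | rfl | rfl | rfl | rfl <;> decide

theorem genIndex_ne_zero {p : ℕ} (hp : SmallPrime p) :
    ∀ k : Fin ((p - 1) / 2), (genIndex p (k + 1) : ZMod p) ≠ 0 := by
  rcases hp with rfl | rfl | rfl | rfl | rfl | rfl <;> decide

theorem genIndex_one {p : ℕ} (hp : SmallPrime p) :
    genIndex p 1 = 1 := by
  rcases hp with rfl | rfl | rfl | rfl | rfl | rfl <;> rfl

/-- Homogeneity of degree two, with the hypothesis restricted to the variables that occur. The case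
c = 1 shows that the remaining coordinates are irrelevant. -/
theorem quadForm_mul_sq {p : ℕ} (hp : SmallPrime p) {x y : ℕ → ℂ} {c : ℂ}
    (h : ∀ k ∈ Finset.Icc 1 ((p - 1) / 2), y k = x k * c) :
    quadForm p y = quadForm p x * c ^ 2 := by
  rcases hp with rfl | rfl | rfl | rfl | rfl | rfl
  · simp only [quadForm, h 1 (by decide), h 2 (by decide)]
    ring
  · simp only [quadForm, h 1 (by decide), h 2 (by decide), h 3 (by decide)]
    ring
  · simp only [quadForm, h 1 (by decide), h 2 (by decide), h 3 (by decide), h 4 (by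
      decide), h 5 (by decide)]
    ring
  · simp only [quadForm, h 1 (by decide), h 2 (by decide), h 3 (by decide), h 4 (by
      decide), h 5 (by decide), h 6 (by decide)]
    ring
  · simp only [quadForm, h 1 (by decide), h 2 (by decide), h 3 (by decide), h 4 (by
      decide), h 5 (by decide), h 6 (by decide), h 7 (by decide), h 8 (by decide)]
    ring
  · simp only [quadForm, h 1 (by decide), h 2 (by decide), h 3 (by decide), h 4 (by
      decide), h 5 (by decide), h 6 (by decide), h 7 (by decide), h 8 (by decide), h 9 (by
      decide)]
    ring

theorem tendsto_quadForm {X : Type*} {l : Filter X} {p : ℕ}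
    (hp : SmallPrime p) {x : ℕ → X → ℂ} {y : ℕ → ℂ}
    (h : ∀ k ∈ Finset.Icc 1 ((p - 1) / 2), Tendsto (x k) l (𝓝 (y k))) :
    Tendsto (fun t => quadForm p fun k => x k t) l (𝓝 (quadForm p y)) := by
  have hcont : Continuous fun y : ℕ → ℂ => quadForm p y := by
      rcases hp with rfl | rfl | rfl | rfl | rfl | rfl <;> first
        | (simp only [quadForm]; fun_prop)
  -- Nothing is known about coordinates outside the range, so they are replaced by their would-be
  -- limits before continuity in the product topology is used.
  set z : ℕ → X → ℂ := fun k t => if k ∈ Finset.Icc 1 ((p - 1) / 2) then x k t else y k with hz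
  have hzt : Tendsto (fun t k => z k t) l (𝓝 y) := by
    rw [tendsto_pi_nhds]
    intro k
    by_cases hk : k ∈ Finset.Icc 1 ((p - 1) / 2)
    · simpa only [hz, hk, if_true] using h k hk
    · simp only [hz, hk, if_false]
      exact tendsto_const_nhds
  refine ((hcont.tendsto y).comp hzt).congr fun t => ?_
  have := quadForm_mul_sq hp (x := fun k => x k t) (y := fun k => z k t) (c := 1)
    fun k hk => by simp only [hz, hk, if_true, mul_one]
  simpa using this

/-- With a single nonzero variable of square 1 the form reduces to a diagonal coefficient, and -p
occurs among these only at x₁². -/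
theorem eq_one_of_quadForm_eq {p : ℕ} (hp : SmallPrime p) {x : ℕ → ℂ}
    {k : ℕ} (hk : k ∈ Finset.Icc 1 ((p - 1) / 2)) (hx : x k ^ 2 = 1)
    (h : ∀ j ∈ Finset.Icc 1 ((p - 1) / 2), j ≠ k → x j = 0) (hq : quadForm p x = -p) : k = 1 := by
  by_contra hne
  rw [Finset.mem_Icc] at hk
  obtain ⟨hk1, hk2⟩ := hk
  rcases hp with rfl | rfl | rfl | rfl | rfl | rfl <;> 
    norm_num at hk2 <;> interval_cases k <;> first
      | exact hne rfl
      | (simp [quadForm, h, hx] at hq; done)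
      | (simp [quadForm, h, hx] at hq; norm_num at hq)

theorem quadForm_eq_of_single {p : ℕ} (hp : SmallPrime p) {x : ℕ → ℂ}
    (hx : x 1 ^ 2 = 1) (h : ∀ j ∈ Finset.Icc 1 ((p - 1) / 2), j ≠ 1 → x j = 0) :
    quadForm p x = -p := by
  rcases hp with rfl | rfl | rfl | rfl | rfl | rfl <;> simp [quadForm, h, hx]

section Action

variable {p : ℕ} [hp : Fact p.Prime]

theorem slash_two_apply (f : ℍ → ℂ) (γ : SL(2, ℤ)) (τ : ℍ) :
    (f ∣[(2 : ℤ)] γ) τ =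
      f (γ • τ) * ((UpperHalfPlane.denom (γ : GL (Fin 2) ℝ) τ) ^ (-1 : ℤ)) ^ 2 := by
  rw [ModularForm.SL_slash_apply, ← zpow_natCast, ← zpow_mul]
  norm_num

theorem genIndex_ne_zero_of_mem (hs : SmallPrime p) {k : ℕ} (hk : k ∈ Finset.Icc 1 ((p - 1) / 2)) :
    (genIndex p k : ZMod p) ≠ 0 := by
  rw [Finset.mem_Icc] at hk
  have := genIndex_ne_zero hs ⟨k - 1, by omega⟩
  rwa [Nat.sub_add_cancel hk.1] at this

variable (h5 : 5 ≤ p) (h19 : p ≤ 19)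

include h5 h19

theorem systemRHS_slash {γ : SL(2, ℤ)} (hγ : γ ∈ CongruenceSubgroup.Gamma0 p) {a : ZMod p}
    (ha : a ≠ 0) :
    systemRHS p a ∣[(2 : ℤ)] γ = systemRHS p (a * ((γ 1 1 : ℤ) : ZMod p)) := by
  obtain ⟨t, ht, -⟩ := exists_balancedQuad p h5 h19
  have hp2 : p ≠ 2 := by omega
  have hs := smallPrime_of_le p h5 h19
  ext τ
  rw [slash_two_apply, systemRHS, systemRHS]
  refine (quadForm_mul_sq hs fun k hk => ?_).symm
  have h := congrFun (ht.gen_slash hp2 hγ (mul_ne_zero ha (genIndex_ne_zero_of_mem hs hk))) τ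
  rw [ModularForm.SL_slash_apply] at h
  rw [mul_right_comm]
  exact h.symm

theorem systemLHS_eq {a : ZMod p} (ha : a ≠ 0) : systemLHS p a = systemRHS p a :=
  funext fun τ => gen_system p h5 h19 ha τ

theorem systemRHS_neg {a : ZMod p} (ha : a ≠ 0) : systemRHS p (-a) = systemRHS p a := by
  obtain ⟨t, ht, -⟩ := exists_balancedQuad p h5 h19
  have hp2 : p ≠ 2 := by omega
  have hs := smallPrime_of_le p h5 h19
  ext τ
  have h := quadForm_mul_sq hs (x := fun k => gen p (a * (genIndex p k : ZMod p)) τ)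
    (y := fun k => gen p (-a * (genIndex p k : ZMod p)) τ) (c := -1) fun k hk => by
      rw [neg_mul, ht.gen_neg hp2 (mul_ne_zero ha (genIndex_ne_zero_of_mem hs hk)), Pi.neg_apply]
      ring
  rw [systemRHS, systemRHS, h]
  ring

theorem tendsto_systemRHS {a : ZMod p} (ha : a ≠ 0) :
    Tendsto (systemRHS p a) UpperHalfPlane.atImInfty (𝓝 (quadForm p fun k =>
      (if a * genIndex p k = 1 then 1 else 0) - (if a * genIndex p k = -1 then 1 else 0))) := by
  obtain ⟨t, ht, -⟩ := exists_balancedQuad p h5 h19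
  have hs := smallPrime_of_le p h5 h19
  exact tendsto_quadForm hs fun k hk =>
    ht.tendsto_gen (by omega) (mul_ne_zero ha (genIndex_ne_zero_of_mem hs hk))

/-- The form attached to a class has the leading constant term `-p` only for the classes `± 1`. -/
theorem eq_of_systemRHS_eq_one {c : ZMod p} (hc : c ≠ 0) (h : systemRHS p 1 = systemRHS p c) :
    c = 1 ∨ c = -1 := by
  have hs := smallPrime_of_le p h5 h19
  have h1 : (1 : ZMod p) ≠ -1 := by
    have : Fact (2 < p) := ⟨by omega⟩
    exact (ZMod.neg_one_ne_one).symm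
  have hinj := genIndex_injective hs
  -- At infinity the only variable of the equation for c that survives is the one whose index
  -- represents ±c⁻¹, and its limit is ±1.
  have hval : ∀ {c : ZMod p}, c ≠ 0 → ∀ k : Fin ((p - 1) / 2),
      (c⁻¹ = genIndex p (k + 1) ∨ c⁻¹ = -(genIndex p (k + 1) : ZMod p)) →
      ((((if c * genIndex p (k + 1) = 1 then 1 else 0) -
        (if c * genIndex p (k + 1) = -1 then 1 else 0) : ℂ) ^ 2 = 1) ∧
      ∀ j ∈ Finset.Icc 1 ((p - 1) / 2), j ≠ k + 1 →
        ((if c * genIndex p j = 1 then 1 else 0) -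
        (if c * genIndex p j = -1 then 1 else 0) : ℂ) = 0) := by
    intro c hc k hk
    refine ⟨?_, fun j hj hjk => ?_⟩
    · rcases hk with hk | hk
      · rw [← hk, mul_inv_cancel₀ hc, if_pos rfl, if_neg h1]
        norm_num
      · rw [eq_neg_iff_add_eq_zero, add_comm, ← eq_neg_iff_add_eq_zero] at hk
        rw [hk, mul_neg, mul_inv_cancel₀ hc, if_neg h1.symm, if_pos rfl]
        norm_num
    · rw [Finset.mem_Icc] at hj
      have e : j - 1 + 1 = j := Nat.sub_add_cancel hj.1
      have hne : ¬((genIndex p j : ZMod p) = genIndex p (k + 1) ∨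
          (genIndex p j : ZMod p) = -(genIndex p (k + 1) : ZMod p)) := by
        intro hcon
        have := hinj ⟨j - 1, by omega⟩ k (by simpa only [e] using hcon)
        apply hjk
        rw [← this]
        exact e.symm
      rw [if_neg, if_neg, sub_zero]
      · intro h2
        have h3 : (genIndex p j : ZMod p) = -c⁻¹ := by
          rw [← mul_right_inj' hc, h2, mul_neg, mul_inv_cancel₀ hc]
        apply hne
        rcases hk with hk | hk
        · exact Or.inr (by rw [h3, hk])
        · exact Or.inl (by rw [h3, hk, neg_neg])
      · intro h2
        have h3 : (genIndex p j : ZMod p) = c⁻¹ := by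
          rw [← mul_right_inj' hc, h2, mul_inv_cancel₀ hc]
        exact hne (by rwa [h3])
  have hpos : 0 < (p - 1) / 2 := by omega
  have e1 := quadForm_eq_of_single hs (hval one_ne_zero ⟨0, hpos⟩
    (Or.inl (by rw [inv_one, zero_add, genIndex_one hs, Nat.cast_one]))).1
    (hval one_ne_zero ⟨0, hpos⟩
      (Or.inl (by rw [inv_one, zero_add, genIndex_one hs, Nat.cast_one]))).2
  have hlim := tendsto_nhds_unique (h ▸ tendsto_systemRHS h5 h19 hc)
    (tendsto_systemRHS h5 h19 one_ne_zero)
  rw [e1] at hlim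
  obtain ⟨k, hk⟩ := exists_genIndex hs c⁻¹ (inv_ne_zero hc)
  have hk1 := eq_one_of_quadForm_eq hs (k := k + 1) (Finset.mem_Icc.mpr ⟨by omega, by omega⟩)
    (hval hc k hk).1 (hval hc k hk).2 hlim
  rw [hk1, genIndex_one hs, Nat.cast_one] at hk
  rcases hk with hk | hk
  · exact Or.inl (by rw [← inv_inv c, hk, inv_one])
  · exact Or.inr (by rw [← inv_inv c, hk, inv_neg, inv_one])

/-- Slashing with a matrix for a⁻¹ moves the pair (a, b) to (1, b a⁻¹), where the limits at infinity
decide. -/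
theorem systemRHS_eq_iff {a b : ZMod p} (ha : a ≠ 0) (hb : b ≠ 0) :
    systemRHS p a = systemRHS p b ↔ b = a ∨ b = -a := by
  constructor
  · intro h
    obtain ⟨h1, h2⟩ := diamondRep_spec p (Units.mk0 a⁻¹ (inv_ne_zero ha))
    rw [Units.val_mk0] at h1 h2
    have h3 := congrArg (· ∣[(2 : ℤ)] diamondRep p a⁻¹) h
    simp only [systemRHS_slash h5 h19 h1 ha, systemRHS_slash h5 h19 h1 hb, h2,
      mul_inv_cancel₀ ha] at h3
    rcases eq_of_systemRHS_eq_one h5 h19 (mul_ne_zero hb (inv_ne_zero ha)) h3 with h4 | h4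
    · left
      rwa [mul_inv_eq_one₀ ha] at h4
    · right
      rw [mul_inv_eq_iff_eq_mul₀ ha] at h4
      rw [h4, neg_one_mul]
  · rintro (rfl | rfl)
    · rfl
    · exact (systemRHS_neg h5 h19 ha).symm

/-- The permutation representation of `(ℤ / p)ˣ` on the indices of the generators. -/
theorem exists_permRep : ∃ ρ : (ZMod p)ˣ →* Equiv.Perm (Fin ((p - 1) / 2)),
    (∀ d : (ZMod p)ˣ, ρ d = 1 ↔ d = 1 ∨ d = -1) ∧
    ∀ (d : (ZMod p)ˣ) (k : Fin ((p - 1) / 2)),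
      (genIndex p (k + 1) : ZMod p) * d = genIndex p (ρ d k + 1) ∨
      (genIndex p (k + 1) : ZMod p) * d = -(genIndex p (ρ d k + 1) : ZMod p) := by
  have hs := smallPrime_of_le p h5 h19
  have hex : ∀ (d : (ZMod p)ˣ) (k : Fin ((p - 1) / 2)), ∃ j : Fin ((p - 1) / 2),
      (genIndex p (k + 1) : ZMod p) * d = genIndex p (j + 1) ∨
      (genIndex p (k + 1) : ZMod p) * d = -(genIndex p (j + 1) : ZMod p) := fun d k =>
    exists_genIndex hs _ (mul_ne_zero (genIndex_ne_zero hs k) d.ne_zero)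
  choose r hr using hex
  have huniq : ∀ (d : (ZMod p)ˣ) (k j : Fin ((p - 1) / 2)),
      ((genIndex p (k + 1) : ZMod p) * d = genIndex p (j + 1) ∨
      (genIndex p (k + 1) : ZMod p) * d = -(genIndex p (j + 1) : ZMod p)) → r d k = j := by
    intro d k j h
    apply genIndex_injective hs
    rcases hr d k with h1 | h1 <;> rcases h with h2 | h2
    · exact Or.inl (by rw [← h1, h2])
    · exact Or.inr (by rw [← h1, h2])
    · exact Or.inr (by rw [← h2, h1, neg_neg])
    · exact Or.inl (by rw [← neg_inj, ← h1, h2])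
  have hone : r 1 = id := funext fun k => huniq 1 k k (Or.inl (by rw [Units.val_one, mul_one]))
  have hmul : ∀ d e, r (d * e) = r d ∘ r e := by
    intro d e
    funext k
    refine huniq _ _ _ ?_
    rw [Units.val_mul, mul_comm (d : ZMod p), ← mul_assoc]
    simp only [Function.comp_apply]
    rcases hr e k with h1 | h1 <;> rcases hr d (r e k) with h2 | h2 <;> rw [h1]
    · exact Or.inl h2
    · exact Or.inr h2
    · exact Or.inr (by rw [neg_mul, h2])
    · exact Or.inl (by rw [neg_mul, h2, neg_neg])
  let f : (ZMod p)ˣ →* Function.End (Fin ((p - 1) / 2)) :=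
    { toFun := r, map_one' := hone, map_mul' := hmul }
  have hf : ∀ d k, MonoidHom.toHomPerm f d k = r d k := fun d k => rfl
  refine ⟨MonoidHom.toHomPerm f, fun d => ⟨fun h => ?_, fun h => ?_⟩, fun d k => ?_⟩
  · have h0 := hr d ⟨0, by omega⟩
    rw [← hf, h, Equiv.Perm.one_apply] at h0
    simp only [zero_add, genIndex_one hs, Nat.cast_one, one_mul] at h0
    rcases h0 with h0 | h0
    · exact Or.inl (Units.ext (by rw [h0, Units.val_one]))
    · exact Or.inr (Units.ext (by rw [h0, Units.val_neg, Units.val_one]))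
  · ext k
    rw [hf, Equiv.Perm.one_apply, huniq d k k]
    rcases h with rfl | rfl
    · exact Or.inl (by rw [Units.val_one, mul_one])
    · exact Or.inr (by rw [Units.val_neg, Units.val_one, mul_neg, mul_one])
  · rw [hf]
    exact hr d k

end Action

/-! ### Product formulas for the generators -/

/-- The odd theta function at the section `k τ` for the modulus `p τ`. -/
def levelTheta (p : ℕ) (k : ℤ) (τ : ℍ) : ℂ := theta 0 (k * τ) (p * τ)

/-- The product `(q ^ k, q ^ (p - k); q ^ p)_∞`. -/
def levelPoch (p k : ℕ) (τ : ℍ) : ℂ :=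
  qPoch (nome τ ^ k) (nome τ ^ p) * qPoch (nome τ ^ (p - k)) (nome τ ^ p)

theorem levelTheta_neg (p : ℕ) (k : ℤ) (τ : ℍ) : levelTheta p (-k) τ = -levelTheta p k τ := by
  rw [levelTheta, Int.cast_neg, neg_mul, theta_neg, levelTheta]
  ring

theorem norm_nome_pow_lt_one (p : ℕ) [hp : NeZero p] (τ : ℍ) : ‖nome τ ^ p‖ < 1 := by
  rw [norm_pow]
  exact pow_lt_one₀ (norm_nonneg _) (norm_nome_lt_one τ) hp.out

/-- The outer minus sign comes from 1 - q^(-k) = -q^(-k) (1 - q^k). The prefactor is written as a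
k-th power of exp(-πiτ), so that in theta quotients the exponential factors cancel as powers of one
symbol. -/
theorem levelTheta_eq {p : ℕ} [hp : NeZero p] {k : ℕ} (hk : k ≤ p) (τ : ℍ) :
    levelTheta p k τ = -(cexp (Real.pi * I * (p * τ / 4)) * cexp (-(Real.pi * I * τ)) ^ k *
      qPoch (nome τ ^ p) (nome τ ^ p) * levelPoch p k τ) := by
  have hσ := natCast_mul_im_pos p τ
  have hQ := norm_nome_pow_lt_one p τ
  have hq0 := nome_ne_zero τ
  have eQ : cexp (2 * Real.pi * I * (p * τ)) = nome τ ^ p := by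
    rw [nome, ← Complex.exp_nat_mul]
    congr 1
    ring
  have ew : cexp (2 * Real.pi * I * (((k : ℤ) : ℂ) * τ)) = nome τ ^ k := by
    rw [nome, ← Complex.exp_nat_mul]
    congr 1
    push_cast
    ring
  have e1 : (nome τ ^ k)⁻¹ * nome τ ^ p = nome τ ^ (p - k) := by
    rw [inv_mul_eq_iff_eq_mul₀ (pow_ne_zero _ hq0), ← pow_add, Nat.add_sub_cancel' hk]
  have e2 : cexp (Real.pi * I * (((k : ℤ) : ℂ) * τ + p * τ / 4)) * (1 - (nome τ ^ k)⁻¹) =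
      -(cexp (Real.pi * I * (p * τ / 4)) * cexp (-(Real.pi * I * τ)) ^ k * (1 - nome τ ^ k)) := by
    have e3 : cexp (Real.pi * I * (((k : ℤ) : ℂ) * τ + p * τ / 4)) =
        cexp (Real.pi * I * (p * τ / 4)) * cexp (-(Real.pi * I * τ)) ^ k * nome τ ^ k := by
      rw [← ew, ← Complex.exp_nat_mul, ← Complex.exp_add, ← Complex.exp_add]
      congr 1
      push_cast
      ring
    rw [e3]
    field_simp
    ring
  rw [levelTheta, theta_eq_prod _ hσ, eQ, ew, qPoch_eq_mul (nome τ ^ k)⁻¹ hQ, e1, levelPoch,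
    qPoch_eq_mul (nome τ ^ k) hQ]
  linear_combination qPoch (nome τ ^ p) (nome τ ^ p) * qPoch (nome τ ^ k * nome τ ^ p) (nome τ ^ p) *
    qPoch (nome τ ^ (p - k)) (nome τ ^ p) * e2

theorem levelPoch_ne_zero {p : ℕ} [hp : NeZero p] {k : ℕ} (hk0 : k ≠ 0) (hk : k < p) (τ : ℍ) :
    levelPoch p k τ ≠ 0 := by
  have hQ := norm_nome_pow_lt_one p τ
  have h : ∀ m : ℕ, m ≠ 0 → qPoch (nome τ ^ m) (nome τ ^ p) ≠ 0 := fun m hm =>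
    qPoch_ne_zero hQ fun j => by
      rw [← pow_mul, ← pow_add]
      exact one_sub_pow_ne_zero (norm_nome_lt_one τ) (by omega)
  exact mul_ne_zero (h _ hk0) (h _ (by omega))

theorem levelPoch_symm {p k : ℕ} (hk : k ≤ p) (τ : ℍ) : levelPoch p (p - k) τ = levelPoch p k τ := by
  rw [levelPoch, levelPoch, Nat.sub_sub_self hk, mul_comm]

theorem theta_one_zero_level {p : ℕ} [hp : NeZero p] (τ : ℍ) :
    theta 1 0 (p * τ) =
      cexp (Real.pi * I * (p * τ / 4)) * qPoch (nome τ ^ p) (nome τ ^ p) ^ 3 := by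
  have eQ : cexp (2 * Real.pi * I * (p * τ)) = nome τ ^ p := by
    rw [nome, ← Complex.exp_nat_mul]
    congr 1
    ring
  rw [theta_one_zero (natCast_mul_im_pos p τ), eQ]

/-- The product formula for arbitrary integer lifts of the residues rather than the canonical ones,
so that each quotient can be written with small, possibly negative, indices. -/
theorem levelJ_sum_eq {p : ℕ} [hp : NeZero p] {k l m : ℤ} (hk : (k : ZMod p) ≠ 0)
    (hl : (l : ZMod p) ≠ 0) (hm : (m : ZMod p) ≠ 0) (hs : ((k + l + m : ℤ) : ZMod p) ≠ 0) (τ : ℍ) :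
    levelJ p k τ + levelJ p l τ + levelJ p m τ - levelJ p ((k + l + m : ℤ) : ZMod p) τ =
      theta 1 0 (p * τ) * levelTheta p (k + l) τ * levelTheta p (l + m) τ * levelTheta p (m + k) τ /
      (levelTheta p k τ * levelTheta p l τ * levelTheta p m τ * levelTheta p (k + l + m) τ) := by
  have hσ := natCast_mul_im_pos p τ
  have hp0 : (p : ℂ) ≠ 0 := by exact_mod_cast hp.out
  have e : ∀ k : ℤ, (k / p : ℂ) * (p * τ) = k * τ := fun k => by field_simp
  have hne : ∀ {k : ℤ}, (k : ZMod p) ≠ 0 → theta 0 (k * τ) (p * τ) ≠ 0 := fun {k} h => by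
    have := theta_sec_ne_zero hσ h
    rwa [e] at this
  have hJ : ∀ {k : ℤ}, (k : ZMod p) ≠ 0 → levelJ p k τ = thetaJ (k * τ) (p * τ) + k / p :=
    fun {k} h => by rw [levelJ, ← secJ_intCast hσ h rfl, e]
  have h := thetaJ_add_add hσ (hne hk) (hne hl) (hne hm) (by
    have := hne hs
    push_cast at this
    rwa [add_mul, add_mul] at this)
  rw [hJ hk, hJ hl, hJ hm, hJ hs]
  simp only [levelTheta]
  push_cast
  simp only [add_mul]
  rw [← h]
  ring

/-- Partial products of length 5n are grouped by the exponent modulo 5, and n tends to infinity. -/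
theorem qPoch_self_five {q : ℂ} (hq : ‖q‖ < 1) :
    qPoch q q = qPoch q (q ^ 5) * qPoch (q ^ 2) (q ^ 5) * qPoch (q ^ 3) (q ^ 5) *
      qPoch (q ^ 4) (q ^ 5) * qPoch (q ^ 5) (q ^ 5) := by
  have hq5 : ‖q ^ 5‖ < 1 := by
    rw [norm_pow]
    exact pow_lt_one₀ (norm_nonneg _) hq (by norm_num)
  have h1 := (tendsto_qPoch q hq).comp (tendsto_id.const_mul_atTop' (show 0 < 5 by norm_num))
  have h2 := ((((tendsto_qPoch q hq5).mul (tendsto_qPoch (q ^ 2) hq5)).mul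
    (tendsto_qPoch (q ^ 3) hq5)).mul (tendsto_qPoch (q ^ 4) hq5)).mul (tendsto_qPoch (q ^ 5) hq5)
  refine tendsto_nhds_unique h1 (h2.congr fun n => ?_)
  simp only [Function.comp_apply, id]
  induction n with
  | zero => simp
  | succ n ih =>
    rw [show 5 * (n + 1) = 5 * n + 1 + 1 + 1 + 1 + 1 by ring]
    simp only [Finset.prod_range_succ]
    rw [← ih]
    ring

theorem nome_eq_exp_sq (τ : ℍ) : nome τ * cexp (-(Real.pi * I * τ)) ^ 2 = 1 := by
  rw [nome, ← Complex.exp_nat_mul, ← Complex.exp_add, ← Complex.exp_zero]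
  congr 1
  push_cast
  ring

section Tuple

variable {p : ℕ} [hp : Fact p.Prime] {t : Fin 4 → ZMod p}

theorem BalancedQuad.gen_eq_of (ht : BalancedQuad p t) (hp2 : p ≠ 2) (τ : ℍ)
    (d u r₀ r₁ r₂ r₃ : ZMod p)
    (h : d * u = 1 ∧ t 0 * u = r₀ ∧ t 1 * u = r₁ ∧ t 2 * u = r₂ ∧ t 3 * u = r₃) :
    gen p d τ = -(levelJ p r₀ τ + levelJ p r₁ τ + levelJ p r₂ τ + levelJ p r₃ τ) := by
  obtain ⟨hd, rfl, rfl, rfl, rfl⟩ := h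
  rw [ht.gen_apply hp2 (left_ne_zero_of_mul_eq_one hd), Fin.sum_univ_four,
    inv_eq_of_mul_eq_one_right hd]
  ring

theorem levelJ_neg {a : ZMod p} (ha : a ≠ 0) (τ : ℍ) : levelJ p (-a) τ = -levelJ p a τ :=
  secJ_neg (natCast_mul_im_pos p τ) ha

end Tuple

/-! ### The generators of levels 5 and 7 as infinite products -/

theorem fact_prime_five : Fact (Nat.Prime 5) := ⟨by norm_num⟩

theorem fact_prime_seven : Fact (Nat.Prime 7) := ⟨by norm_num⟩

attribute [local instance] fact_prime_five fact_prime_seven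

/-- In this and the next four formulas, k, l, m and -(k + l + m) are integer lifts of the residues
t_i d⁻¹, in a suitable order. Such lifts exist because the t_i sum to zero. -/
theorem gen_five_one_theta (τ : ℍ) : gen 5 1 τ = -(theta 1 0 ((5 : ℕ) * τ) * levelTheta 5 2 τ ^ 3 /
    (levelTheta 5 1 τ ^ 3 * levelTheta 5 3 τ)) := by
  have h := levelJ_sum_eq (p := 5) (k := 1) (l := 1) (m := 1) (by decide) (by decide) (by decide)
    (by decide) τ
  have hg := balancedQuad_five.gen_eq_of (by norm_num) τ 1 1 1 1 1 (-3) (by decide)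
  rw [levelJ_neg (by decide)] at hg
  norm_num at h ⊢
  rw [hg, ← sub_eq_add_neg, h]
  ring

theorem gen_five_two_theta (τ : ℍ) : gen 5 2 τ = -(theta 1 0 ((5 : ℕ) * τ) * levelTheta 5 1 τ *
    levelTheta 5 (-1) τ * levelTheta 5 4 τ /
    (levelTheta 5 3 τ * levelTheta 5 (-2) τ * levelTheta 5 1 τ * levelTheta 5 2 τ)) := by
  have h := levelJ_sum_eq (p := 5) (k := 3) (l := -2) (m := 1) (by decide) (by decide) (by decide)
    (by decide) τ
  have hg := balancedQuad_five.gen_eq_of (by norm_num) τ 2 3 3 (-2) (-2) 1 (by decide)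
  nth_rw 2 [levelJ_neg (by decide)] at hg
  norm_num at h ⊢
  rw [hg, ← h]
  ring

theorem gen_seven_one_theta (τ : ℍ) : gen 7 1 τ = -(theta 1 0 ((7 : ℕ) * τ) * levelTheta 7 2 τ *
    levelTheta 7 3 τ * levelTheta 7 3 τ /
    (levelTheta 7 1 τ * levelTheta 7 1 τ * levelTheta 7 2 τ * levelTheta 7 4 τ)) := by
  have h := levelJ_sum_eq (p := 7) (k := 1) (l := 1) (m := 2) (by decide) (by decide) (by decide)
    (by decide) τ
  have hg := balancedQuad_seven.gen_eq_of (by norm_num) τ 1 1 1 1 2 (-4) (by decide)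
  rw [levelJ_neg (by decide)] at hg
  norm_num at h ⊢
  rw [hg, ← sub_eq_add_neg, h]

theorem gen_seven_two_theta (τ : ℍ) : gen 7 2 τ = -(theta 1 0 ((7 : ℕ) * τ) * levelTheta 7 1 τ *
    levelTheta 7 (-2) τ * levelTheta 7 5 τ /
    (levelTheta 7 4 τ * levelTheta 7 (-3) τ * levelTheta 7 1 τ * levelTheta 7 2 τ)) := by
  have h := levelJ_sum_eq (p := 7) (k := 4) (l := -3) (m := 1) (by decide) (by decide) (by decide)
    (by decide) τ
  have hg := balancedQuad_seven.gen_eq_of (by norm_num) τ 2 4 4 (-3) 1 (-2) (by decide)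
  rw [levelJ_neg (a := 2) (by decide)] at hg
  norm_num at h ⊢
  rw [hg, ← sub_eq_add_neg, h]

theorem gen_seven_four_theta (τ : ℍ) : gen 7 4 τ = -(theta 1 0 ((7 : ℕ) * τ) * levelTheta 7 4 τ *
    levelTheta 7 (-1) τ * levelTheta 7 (-1) τ /
    (levelTheta 7 2 τ * levelTheta 7 2 τ * levelTheta 7 (-3) τ * levelTheta 7 1 τ)) := by
  have h := levelJ_sum_eq (p := 7) (k := 2) (l := 2) (m := -3) (by decide) (by decide) (by decide)
    (by decide) τ
  have hg := balancedQuad_seven.gen_eq_of (by norm_num) τ 4 2 2 2 (-3) (-1) (by decide)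
  rw [levelJ_neg (a := 1) (by decide)] at hg
  norm_num at h ⊢
  rw [hg, ← sub_eq_add_neg, h]

theorem prodB5_eq : prodB5 = gen 5 1 := by
  ext τ
  have hq := norm_nome_lt_one τ
  have h1 := levelPoch_ne_zero (p := 5) (k := 1) (by norm_num) (by norm_num) τ
  have h2 := levelPoch_ne_zero (p := 5) (k := 2) (by norm_num) (by norm_num) τ
  have h3 := levelPoch_symm (p := 5) (k := 2) (by norm_num) τ
  have hQ := qPoch_self_ne_zero (norm_nome_pow_lt_one 5 τ)
  have e1 := levelTheta_eq (p := 5) (k := 1) (by norm_num) τ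
  have e2 := levelTheta_eq (p := 5) (k := 2) (by norm_num) τ
  have e3 := levelTheta_eq (p := 5) (k := 3) (by norm_num) τ
  have l1 : levelPoch 5 1 τ = qPochList [nome τ, nome τ ^ 4] (nome τ ^ 5) := by
    simp [levelPoch, qPochList]
  have hself : qPoch (nome τ) (nome τ) = levelPoch 5 1 τ * levelPoch 5 2 τ *
      qPoch (nome τ ^ 5) (nome τ ^ 5) := by
    rw [qPoch_self_five hq, levelPoch, levelPoch, pow_one]
    ring
  norm_num at e1 e2 e3 h3
  rw [h3] at e3
  rw [gen_five_one_theta, theta_one_zero_level, prodB5, ← l1, hself, e1, e2, e3]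
  have hW := Complex.exp_ne_zero (Real.pi * I * ((5 : ℕ) * τ / 4))
  have he := Complex.exp_ne_zero (-(Real.pi * I * τ))
  push_cast at hW ⊢
  generalize cexp (Real.pi * I * (5 * τ / 4)) = W at *
  generalize cexp (-(Real.pi * I * τ)) = e at *
  field_simp

theorem prodA5_eq : prodA5 = gen 5 2 := by
  ext τ
  have hq := norm_nome_lt_one τ
  have h1 := levelPoch_ne_zero (p := 5) (k := 1) (by norm_num) (by norm_num) τ
  have h2 := levelPoch_ne_zero (p := 5) (k := 2) (by norm_num) (by norm_num) τ
  have h3 := levelPoch_symm (p := 5) (k := 2) (by norm_num) τ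
  have h4 := levelPoch_symm (p := 5) (k := 1) (by norm_num) τ
  have hQ := qPoch_self_ne_zero (norm_nome_pow_lt_one 5 τ)
  have e1 := levelTheta_eq (p := 5) (k := 1) (by norm_num) τ
  have e2 := levelTheta_eq (p := 5) (k := 2) (by norm_num) τ
  have e3 := levelTheta_eq (p := 5) (k := 3) (by norm_num) τ
  have e4 := levelTheta_eq (p := 5) (k := 4) (by norm_num) τ
  have l1 : levelPoch 5 2 τ = qPochList [nome τ ^ 2, nome τ ^ 3] (nome τ ^ 5) := by
    simp [levelPoch, qPochList]
  have hself : qPoch (nome τ) (nome τ) = levelPoch 5 1 τ * levelPoch 5 2 τ *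
      qPoch (nome τ ^ 5) (nome τ ^ 5) := by
    rw [qPoch_self_five hq, levelPoch, levelPoch, pow_one]
    ring
  have hn := nome_eq_exp_sq τ
  norm_num at e1 e2 e3 e4 h3 h4
  rw [h3] at e3
  rw [h4] at e4
  rw [gen_five_two_theta, theta_one_zero_level, prodA5, ← l1, hself, levelTheta_neg, levelTheta_neg,
    e1, e2, e3, e4]
  have hW := Complex.exp_ne_zero (Real.pi * I * ((5 : ℕ) * τ / 4))
  have he := Complex.exp_ne_zero (-(Real.pi * I * τ))
  push_cast at hW ⊢
  generalize cexp (Real.pi * I * (5 * τ / 4)) = W at *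
  generalize cexp (-(Real.pi * I * τ)) = e at *
  -- In the theta quotient `e` has exponent 1 + 1 + 4 in the numerator and 3 + 2 + 1 + 2 in the
  -- denominator. The surplus e^(-2) is the factor q of the product.
  rw [eq_inv_of_mul_eq_one_left hn]
  field_simp

theorem sevenZ_eq : sevenZ = gen 7 1 := by
  ext τ
  have h1 := levelPoch_ne_zero (p := 7) (k := 1) (by norm_num) (by norm_num) τ
  have h2 := levelPoch_ne_zero (p := 7) (k := 2) (by norm_num) (by norm_num) τ
  have h3 := levelPoch_ne_zero (p := 7) (k := 3) (by norm_num) (by norm_num) τ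
  have h4 := levelPoch_symm (p := 7) (k := 3) (by norm_num) τ
  have hQ := qPoch_self_ne_zero (norm_nome_pow_lt_one 7 τ)
  have e1 := levelTheta_eq (p := 7) (k := 1) (by norm_num) τ
  have e2 := levelTheta_eq (p := 7) (k := 2) (by norm_num) τ
  have e3 := levelTheta_eq (p := 7) (k := 3) (by norm_num) τ
  have e4 := levelTheta_eq (p := 7) (k := 4) (by norm_num) τ
  have l1 : qPochList [nome τ, nome τ ^ 6] (nome τ ^ 7) = levelPoch 7 1 τ := by
    simp [levelPoch, qPochList]
  have l3 : qPochList [nome τ ^ 3, nome τ ^ 4, nome τ ^ 7, nome τ ^ 7] (nome τ ^ 7) =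
      levelPoch 7 3 τ * qPoch (nome τ ^ 7) (nome τ ^ 7) ^ 2 := by
    simp [levelPoch, qPochList]
    ring
  norm_num at e1 e2 e3 e4 h4
  rw [h4] at e4
  rw [gen_seven_one_theta, theta_one_zero_level, sevenZ, l1, l3, e1, e2, e3, e4]
  have hW := Complex.exp_ne_zero (Real.pi * I * ((7 : ℕ) * τ / 4))
  have he := Complex.exp_ne_zero (-(Real.pi * I * τ))
  push_cast at hW ⊢
  generalize cexp (Real.pi * I * (7 * τ / 4)) = W at *
  generalize cexp (-(Real.pi * I * τ)) = e at *
  field_simp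

theorem sevenX_eq : sevenX = gen 7 2 := by
  ext τ
  have h1 := levelPoch_ne_zero (p := 7) (k := 1) (by norm_num) (by norm_num) τ
  have h2 := levelPoch_ne_zero (p := 7) (k := 2) (by norm_num) (by norm_num) τ
  have h3 := levelPoch_ne_zero (p := 7) (k := 3) (by norm_num) (by norm_num) τ
  have h4 := levelPoch_symm (p := 7) (k := 3) (by norm_num) τ
  have h5 := levelPoch_symm (p := 7) (k := 2) (by norm_num) τ
  have hQ := qPoch_self_ne_zero (norm_nome_pow_lt_one 7 τ)
  have e1 := levelTheta_eq (p := 7) (k := 1) (by norm_num) τ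
  have e2 := levelTheta_eq (p := 7) (k := 2) (by norm_num) τ
  have e3 := levelTheta_eq (p := 7) (k := 3) (by norm_num) τ
  have e4 := levelTheta_eq (p := 7) (k := 4) (by norm_num) τ
  have e5 := levelTheta_eq (p := 7) (k := 5) (by norm_num) τ
  have l1 : qPochList [nome τ ^ 3, nome τ ^ 4] (nome τ ^ 7) = levelPoch 7 3 τ := by
    simp [levelPoch, qPochList]
  have l3 : qPochList [nome τ ^ 2, nome τ ^ 5, nome τ ^ 7, nome τ ^ 7] (nome τ ^ 7) =
      levelPoch 7 2 τ * qPoch (nome τ ^ 7) (nome τ ^ 7) ^ 2 := by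
    simp [levelPoch, qPochList]
    ring
  have hn := nome_eq_exp_sq τ
  norm_num at e1 e2 e3 e4 e5 h4 h5
  rw [h4] at e4
  rw [h5] at e5
  rw [gen_seven_two_theta, theta_one_zero_level, sevenX, l1, l3, levelTheta_neg, levelTheta_neg,
    e1, e2, e3, e4, e5]
  have hW := Complex.exp_ne_zero (Real.pi * I * ((7 : ℕ) * τ / 4))
  have he := Complex.exp_ne_zero (-(Real.pi * I * τ))
  push_cast at hW ⊢
  generalize cexp (Real.pi * I * (7 * τ / 4)) = W at *
  generalize cexp (-(Real.pi * I * τ)) = e at *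
  rw [eq_inv_of_mul_eq_one_left hn]
  field_simp

theorem sevenY_eq : sevenY = gen 7 4 := by
  ext τ
  have h1 := levelPoch_ne_zero (p := 7) (k := 1) (by norm_num) (by norm_num) τ
  have h2 := levelPoch_ne_zero (p := 7) (k := 2) (by norm_num) (by norm_num) τ
  have h3 := levelPoch_ne_zero (p := 7) (k := 3) (by norm_num) (by norm_num) τ
  have h4 := levelPoch_symm (p := 7) (k := 3) (by norm_num) τ
  have hQ := qPoch_self_ne_zero (norm_nome_pow_lt_one 7 τ)
  have e1 := levelTheta_eq (p := 7) (k := 1) (by norm_num) τ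
  have e2 := levelTheta_eq (p := 7) (k := 2) (by norm_num) τ
  have e3 := levelTheta_eq (p := 7) (k := 3) (by norm_num) τ
  have e4 := levelTheta_eq (p := 7) (k := 4) (by norm_num) τ
  have l1 : qPochList [nome τ ^ 2, nome τ ^ 5] (nome τ ^ 7) = levelPoch 7 2 τ := by
    simp [levelPoch, qPochList]
  have l3 : qPochList [nome τ, nome τ ^ 6, nome τ ^ 7, nome τ ^ 7] (nome τ ^ 7) =
      levelPoch 7 1 τ * qPoch (nome τ ^ 7) (nome τ ^ 7) ^ 2 := by
    simp [levelPoch, qPochList]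
    ring
  have hn := nome_eq_exp_sq τ
  norm_num at e1 e2 e3 e4 h4
  rw [h4] at e4
  rw [gen_seven_four_theta, theta_one_zero_level, sevenY, l1, l3, levelTheta_neg, levelTheta_neg,
    e1, e2, e3, e4]
  have hW := Complex.exp_ne_zero (Real.pi * I * ((7 : ℕ) * τ / 4))
  have he := Complex.exp_ne_zero (-(Real.pi * I * τ))
  push_cast at hW ⊢
  generalize cexp (Real.pi * I * (7 * τ / 4)) = W at *
  generalize cexp (-(Real.pi * I * τ)) = e at *
  rw [eq_inv_of_mul_eq_one_left hn]
  field_simp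

/-! ### The derivative of the Eisenstein series of weight two -/

theorem holo_eisTwo (p : ℕ) [hp : Fact p.Prime] {P : ℍ → ℂ} (hP : ∀ τ, P τ = eisTwo (nome τ ^ p))
    {a b : ZMod p} (ha : a ≠ 0) (hb : b ≠ 0) (hab : a + b ≠ 0) : Holo P :=
  holo_of_differentiableAt (fun τ => (hP τ).trans (eisTwo_nome_pow τ)) fun τ =>
    ((hasDerivAt_thetaT_sec (natCast_mul_im_pos p τ) (theta_one_zero_ne_zero
      (natCast_mul_im_pos p τ)) ha hb hab).comp_natCast_mul p).differentiableAt.const_mul 4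

theorem qDiff_eisTwo (p : ℕ) [hp : Fact p.Prime] {P : ℍ → ℂ} (hP : ∀ τ, P τ = eisTwo (nome τ ^ p))
    {a b : ZMod p} (ha : a ≠ 0) (hb : b ≠ 0) (hab : a + b ≠ 0) (τ : ℍ) {σ : ℂ} (hσ : σ = p * τ) :
    qDiff P τ = 4 * p *
      (secP p a σ * secP p b σ + secP p a σ * secP p (a + b) σ + secP p b σ * secP p (a + b) σ -
        (secD p a σ + 2 * (secJ p a σ + secJ p b σ - secJ p (a + b) σ) * secP p a σ) *
          (secJ p a σ + secJ p b σ - secJ p (a + b) σ)) := by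
  have hi := natCast_mul_im_pos p τ
  subst hσ
  refine qDiff_eq (fun τ => (hP τ).trans (eisTwo_nome_pow τ))
    ((((hasDerivAt_thetaT_sec hi (theta_one_zero_ne_zero hi) ha hb hab).comp_natCast_mul
      p).const_mul 4).congr_deriv ?_)
  ring

/-- Up to sign the nonzero residues are 1 and 2, and doubling sends 1 to 2 and 2 to -1. The
duplication relations therefore determine both P's and P' at 1 in terms of G₁, G₂ and T, and a
polynomial identity remains. -/
theorem qDiff_eisTwo_five {P : ℍ → ℂ} (hP : ∀ τ, P τ = eisTwo (nome τ ^ 5)) (τ : ℍ) :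
    qDiff P τ = 5 / 12 * (P τ ^ 2 - gen 5 1 τ ^ 4 + 12 * gen 5 1 τ ^ 3 * gen 5 2 τ
      - 14 * gen 5 1 τ ^ 2 * gen 5 2 τ ^ 2 - 12 * gen 5 1 τ * gen 5 2 τ ^ 3 - gen 5 2 τ ^ 4) := by
  have hi := natCast_mul_im_pos 5 τ
  have h1 := theta_one_zero_ne_zero hi
  have g1 := balancedQuad_five.gen_eq_of (by norm_num) τ 1 1 1 1 1 2 (by decide)
  have g2 := balancedQuad_five.gen_eq_of (by norm_num) τ 2 3 (-2) (-2) (-2) 1 (by decide)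
  rw [levelJ_neg (a := 2) (by decide)] at g2
  have r1 := secJ_add_sq hi h1 (p := 5) (a := 1) (b := 1) (by decide) (by decide) (by decide)
  have r2 := secJ_add_sq hi h1 (p := 5) (a := 2) (b := 2) (by decide) (by decide) (by decide)
  have d1 := secD_left_add hi h1 (p := 5) (a := 1) (b := 1) (by decide) (by decide) (by decide)
  have d2 := secD_left_add hi h1 (p := 5) (a := 2) (b := 2) (by decide) (by decide) (by decide)
  have hq := qDiff_eisTwo 5 hP (a := 1) (b := 1) (by decide) (by decide) (by decide) τ rfl
  rw [show (1 + 1 : ZMod 5) = 2 by decide] at r1 d1 hq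
  rw [show (2 + 2 : ZMod 5) = -1 by decide, secJ_neg hi (by decide), secP_neg hi (by decide)] at r2 d2
  rw [secD_neg hi (by decide)] at d2
  rw [hq, g1, g2, hP, eisTwo_nome_pow]
  simp only [levelJ]
  generalize secJ 5 1 ((5 : ℕ) * τ) = G₁ at *
  generalize secJ 5 2 ((5 : ℕ) * τ) = G₂ at *
  generalize secP 5 1 ((5 : ℕ) * τ) = P₁ at *
  generalize secP 5 2 ((5 : ℕ) * τ) = P₂ at *
  generalize secD 5 1 ((5 : ℕ) * τ) = D₁ at *
  generalize secD 5 2 ((5 : ℕ) * τ) = D₂ at *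
  generalize thetaT ((5 : ℕ) * τ) = T at *
  -- P' is odd, so the two duplication relations read D₁ + D₂ and D₂ - D₁, and their difference
  -- isolates D₁.
  obtain rfl : D₁ = (P₂ - P₁) * (3 * G₁ + G₂) := by linear_combination d1 / 2 - d2 / 2
  obtain rfl : P₁ = (2 * (G₁ + G₁ - G₂) ^ 2 - (G₁ + 2 * G₂) ^ 2 - T) / 3 := by
    linear_combination r2 / 3 - 2 / 3 * r1
  obtain rfl : P₂ = (2 * (G₁ + 2 * G₂) ^ 2 - (G₁ + G₁ - G₂) ^ 2 - T) / 3 := by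
    linear_combination -r1 - (0 : ℂ) * r2
  push_cast
  ring

theorem qDiff_eisTwo_seven {P : ℍ → ℂ} (hP : ∀ τ, P τ = eisTwo (nome τ ^ 7)) {x y z : ℂ} (τ : ℍ)
    (hx : x = gen 7 2 τ) (hy : y = gen 7 4 τ) (hz : z = gen 7 1 τ) :
    qDiff P τ = 7 / 12 * (P τ ^ 2 - x ^ 4 - 4 * x ^ 3 * y - 12 * x * y ^ 3 - y ^ 4
      - 12 * x ^ 3 * z - 4 * y ^ 3 * z - 4 * x * z ^ 3 - 12 * y * z ^ 3 - z ^ 4) := by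
  have hi := natCast_mul_im_pos 7 τ
  have h1 := theta_one_zero_ne_zero hi
  have g1 := balancedQuad_seven.gen_eq_of (by norm_num) τ 1 1 1 1 2 3 (by decide)
  have g2 := balancedQuad_seven.gen_eq_of (by norm_num) τ 2 4 (-3) (-3) 1 (-2) (by decide)
  have g4 := balancedQuad_seven.gen_eq_of (by norm_num) τ 4 2 2 2 (-3) (-1) (by decide)
  rw [levelJ_neg (a := 2) (by decide), levelJ_neg (a := 3) (by decide)] at g2
  rw [levelJ_neg (a := 1) (by decide), levelJ_neg (a := 3) (by decide)] at g4
  have r11 := secJ_add_sq hi h1 (p := 7) (a := 1) (b := 1) (by decide) (by decide) (by decide)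
  have r22 := secJ_add_sq hi h1 (p := 7) (a := 2) (b := 2) (by decide) (by decide) (by decide)
  have r33 := secJ_add_sq hi h1 (p := 7) (a := 3) (b := 3) (by decide) (by decide) (by decide)
  have r12 := secJ_add_sq hi h1 (p := 7) (a := 1) (b := 2) (by decide) (by decide) (by decide)
  have d1 := secD_left_add hi h1 (p := 7) (a := 1) (b := 1) (by decide) (by decide) (by decide)
  have d2 := secD_left_add hi h1 (p := 7) (a := 2) (b := 2) (by decide) (by decide) (by decide)
  have d3 := secD_left_add hi h1 (p := 7) (a := 3) (b := 3) (by decide) (by decide) (by decide)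
  have hq := qDiff_eisTwo 7 hP (a := 1) (b := 1) (by decide) (by decide) (by decide) τ rfl
  rw [show (1 + 1 : ZMod 7) = 2 by decide] at r11 d1 hq
  rw [show (1 + 2 : ZMod 7) = 3 by decide] at r12
  rw [show (2 + 2 : ZMod 7) = -3 by decide, secJ_neg hi (by decide), secP_neg hi (by decide)]
    at r22 d2
  rw [show (3 + 3 : ZMod 7) = -1 by decide, secJ_neg hi (by decide), secP_neg hi (by decide)]
    at r33 d3
  rw [secD_neg hi (by decide)] at d2 d3
  rw [hq, hx, hy, hz, g1, g2, g4, hP, eisTwo_nome_pow]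
  simp only [levelJ]
  generalize secJ 7 1 ((7 : ℕ) * τ) = G₁ at *
  generalize secJ 7 2 ((7 : ℕ) * τ) = G₂ at *
  generalize secJ 7 3 ((7 : ℕ) * τ) = G₃ at *
  generalize secP 7 1 ((7 : ℕ) * τ) = P₁ at *
  generalize secP 7 2 ((7 : ℕ) * τ) = P₂ at *
  generalize secP 7 3 ((7 : ℕ) * τ) = P₃ at *
  generalize secD 7 1 ((7 : ℕ) * τ) = D₁ at *
  generalize secD 7 2 ((7 : ℕ) * τ) = D₂ at *
  generalize secD 7 3 ((7 : ℕ) * τ) = D₃ at *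
  generalize thetaT ((7 : ℕ) * τ) = T at *
  -- The doubling orbit 1, 2, -3, -1 changes sign on closing up, so the alternating combination of
  -- the three relations isolates D₁. The relations r11, r22, r33 determine the three P's in the
  -- same cyclic way.
  obtain rfl : D₁ = (2 * G₁ - G₂) * (P₂ - P₁) - (2 * G₂ + G₃) * (P₃ - P₂) -
      (2 * G₃ + G₁) * (P₁ - P₃) := by linear_combination (d1 - d2 - d3) / 2
  obtain rfl : P₁ = (4 * (2 * G₁ - G₂) ^ 2 - 2 * (2 * G₂ + G₃) ^ 2 + (2 * G₃ + G₁) ^ 2) / 9 -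
      T / 3 := by linear_combination -(4 * r11 - 2 * r22 + r33) / 9
  obtain rfl : P₂ = (2 * G₁ - G₂) ^ 2 - T - 2 *
      ((4 * (2 * G₁ - G₂) ^ 2 - 2 * (2 * G₂ + G₃) ^ 2 + (2 * G₃ + G₁) ^ 2) / 9 - T / 3) := by
    linear_combination -r11
  obtain rfl : P₃ = (2 * G₂ + G₃) ^ 2 - T - 2 * ((2 * G₁ - G₂) ^ 2 - T - 2 *
      ((4 * (2 * G₁ - G₂) ^ 2 - 2 * (2 * G₂ + G₃) ^ 2 + (2 * G₃ + G₁) ^ 2) / 9 - T / 3)) := by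
    linear_combination -r22
  push_cast
  -- After the substitutions T drops out of `r12`, leaving a quadratic relation among G₁, G₂, G₃.
  -- The quartic identity holds only modulo it, and the quadratic cofactor is the multiplier given
  -- here.
  linear_combination 7 / 12 * (71 / 3 * G₁ ^ 2 + 53 / 3 * G₁ * G₂ + 139 / 3 * G₁ * G₃ +
    119 / 3 * G₂ ^ 2 + 43 / 3 * G₂ * G₃ + 239 / 3 * G₃ ^ 2) * r12

/-! ### Roots of nonvanishing holomorphic functions -/

/-- The Cayley transform carries the problem to the unit disc, where holomorphic functions have
primitives. The factor 2i/(1 - w)² is the derivative of the inverse transform. -/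
theorem exists_primitive_upperHalfPlane {f : ℂ → ℂ}
    (hf : DifferentiableOn ℂ f UpperHalfPlane.upperHalfPlaneSet) :
    ∃ L : ℂ → ℂ, ∀ z ∈ UpperHalfPlane.upperHalfPlaneSet, HasDerivAt L (f z) z := by
  have hne : ∀ w ∈ Metric.ball (0 : ℂ) 1, 1 - w ≠ 0 := by
    intro w hw h
    rw [mem_ball_zero_iff] at hw
    rw [← sub_eq_zero.mp h, norm_one] at hw
    exact lt_irrefl _ hw
  have hmem : ∀ w ∈ Metric.ball (0 : ℂ) 1,
      I * (1 + w) / (1 - w) ∈ UpperHalfPlane.upperHalfPlaneSet := by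
    intro w hw
    have h0 := hne w hw
    have hpos : 0 < Complex.normSq (1 - w) := Complex.normSq_pos.mpr h0
    rw [mem_ball_zero_iff] at hw
    have hw2 : Complex.normSq w < 1 := by
      rw [Complex.normSq_eq_norm_sq]
      exact pow_lt_one₀ (norm_nonneg _) hw two_ne_zero
    have e : (I * (1 + w) / (1 - w)).im = (1 - Complex.normSq w) / Complex.normSq (1 - w) := by
      rw [Complex.div_im, Complex.normSq_apply w]
      simp
      field_simp
      ring
    change 0 < (I * (1 + w) / (1 - w)).im
    rw [e]
    exact div_pos (by linarith) hpos
  have hd : DifferentiableOn ℂ (fun w => f (I * (1 + w) / (1 - w)) * (2 * I / (1 - w) ^ 2))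
      (Metric.ball 0 1) := by
    refine DifferentiableOn.mul (hf.comp ?_ hmem) ?_
    · exact DifferentiableOn.div (by fun_prop) (by fun_prop) hne
    · exact DifferentiableOn.div (by fun_prop) (by fun_prop) fun w hw => pow_ne_zero _ (hne w hw)
  obtain ⟨L, hL⟩ := hd.isExactOn_ball
  refine ⟨fun z => L ((z - I) / (z + I)), fun z hz => ?_⟩
  have hz' : 0 < z.im := hz
  have h0 : z + I ≠ 0 := by
    intro h
    have := congrArg Complex.im h
    simp at this
    linarith
  have hball : (z - I) / (z + I) ∈ Metric.ball (0 : ℂ) 1 := by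
    rw [mem_ball_zero_iff, norm_div, div_lt_one (norm_pos_iff.mpr h0)]
    rw [← sq_lt_sq₀ (norm_nonneg _) (norm_nonneg _), ← Complex.normSq_eq_norm_sq,
      ← Complex.normSq_eq_norm_sq, Complex.normSq_apply, Complex.normSq_apply]
    simp
    nlinarith
  have h1 : HasDerivAt (fun z : ℂ => (z - I) / (z + I)) (2 * I / (z + I) ^ 2) z := by
    refine (((hasDerivAt_id z).sub_const I).div ((hasDerivAt_id z).add_const I) h0).congr_deriv ?_
    simp only [id]
    ring
  refine ((hL _ hball).comp z h1).congr_deriv ?_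
  have e1 : 1 - (z - I) / (z + I) = 2 * I / (z + I) := by
    field_simp
    ring
  have e2 : I * (1 + (z - I) / (z + I)) / (1 - (z - I) / (z + I)) = z := by
    rw [e1]
    have := Complex.I_ne_zero
    field_simp
    ring
  beta_reduce
  rw [e2, e1]
  have := Complex.I_ne_zero
  field_simp

/-- A primitive L of F'/F makes F exp(-L) constant on the half plane. An n-th root of that constant
times exp(L/n) is the required root. -/
theorem exists_pow_eq_of_ne_zero {g : ℍ → ℂ} (hg : Holo g) (h0 : ∀ τ, g τ ≠ 0) {n : ℕ}
    (hn : n ≠ 0) : ∃ A : ℍ → ℂ, Holo A ∧ ∀ τ, A τ ^ n = g τ := by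
  set F : ℂ → ℂ := g ∘ UpperHalfPlane.ofComplex with hF
  have hFd : DifferentiableOn ℂ F UpperHalfPlane.upperHalfPlaneSet :=
    UpperHalfPlane.mdifferentiable_iff.mp hg
  have hF0 : ∀ z, F z ≠ 0 := fun z => h0 _
  have hopen := UpperHalfPlane.isOpen_upperHalfPlaneSet
  obtain ⟨L, hL⟩ := exists_primitive_upperHalfPlane
    (DifferentiableOn.div (hFd.deriv hopen) hFd fun z _ => hF0 z)
  have hder : ∀ z ∈ UpperHalfPlane.upperHalfPlaneSet, HasDerivAt (fun z => F z * cexp (-L z)) 0 z := by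
    intro z hz
    have h1 := ((hFd z hz).differentiableAt (hopen.mem_nhds hz)).hasDerivAt
    refine (h1.mul (hL z hz).neg.cexp).congr_deriv ?_
    simp only [Pi.neg_apply, Pi.div_apply]
    have := hF0 z
    field_simp
    ring
  have hpre : IsPreconnected UpperHalfPlane.upperHalfPlaneSet :=
    (convex_halfSpace_im_gt 0).isPreconnected
  have hconst : ∀ z ∈ UpperHalfPlane.upperHalfPlaneSet,
      F z * cexp (-L z) = F I * cexp (-L I) := fun z hz =>
    hopen.is_const_of_deriv_eq_zero hpre
      (fun w hw => (hder w hw).differentiableAt.differentiableWithinAt)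
      (fun w hw => (hder w hw).deriv) hz (by simp [UpperHalfPlane.upperHalfPlaneSet])
  obtain ⟨c, hc⟩ := IsAlgClosed.exists_pow_nat_eq (F I * cexp (-L I)) (Nat.pos_of_ne_zero hn)
  have hn0 : (n : ℂ) ≠ 0 := by exact_mod_cast hn
  refine ⟨fun τ => c * cexp (L τ / n), holo_of_differentiableAt (F := fun z => c * cexp (L z / n))
    (fun τ => rfl) fun τ => ((hL τ τ.im_pos).differentiableAt.div_const _).cexp.const_mul c,
    fun τ => ?_⟩
  rw [mul_pow, hc, ← hconst τ τ.im_pos, ← Complex.exp_nat_mul, mul_div_cancel₀ _ hn0, mul_assoc,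
    ← Complex.exp_add, neg_add_cancel, Complex.exp_zero, mul_one, hF, Function.comp_apply,
    UpperHalfPlane.ofComplex_apply]

theorem qDiff_pow {A : ℍ → ℂ} (hA : Holo A) (n : ℕ) (τ : ℍ) :
    qDiff (fun τ => A τ ^ n) τ = n * A τ ^ (n - 1) * qDiff A τ := by
  have h := (UpperHalfPlane.mdifferentiableAt_iff.mp (hA τ)).hasDerivAt
  have e : ∀ τ : ℍ, A τ = (A ∘ UpperHalfPlane.ofComplex) τ := fun τ => by
    rw [Function.comp_apply, UpperHalfPlane.ofComplex_apply]
  rw [qDiff_eq (F := fun z => (A ∘ UpperHalfPlane.ofComplex) z ^ n) (c := n * A τ ^ (n - 1) * qDiff A τ)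
    (fun τ => by rw [← e])]
  refine (h.fun_pow n).congr_deriv ?_
  rw [← e, qDiff, Derivative.normalizedDerivOfComplex]
  field_simp

end

/-! ### The differential systems of levels 5 and 7 -/

section

attribute [local instance] fact_prime_five fact_prime_seven

theorem holo_gen_five {a : ZMod 5} (ha : a ≠ 0) : Holo (gen 5 a) :=
  balancedQuad_five.holo_gen (by norm_num) ha

theorem gen_five_ne_zero {a : ZMod 5} (ha : a ≠ 0) (τ : ℍ) : gen 5 a τ ≠ 0 :=
  balancedQuad_five.gen_ne_zero (by norm_num) ha τ

theorem holo_gen_seven {a : ZMod 7} (ha : a ≠ 0) : Holo (gen 7 a) :=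
  balancedQuad_seven.holo_gen (by norm_num) ha

theorem holo_eisTwo_five {P : ℍ → ℂ} (hP : ∀ τ, P τ = eisTwo (nome τ ^ 5)) : Holo P :=
  holo_eisTwo 5 hP (a := 1) (b := 1) (by decide) (by decide) (by decide)

theorem holo_eisTwo_seven {P : ℍ → ℂ} (hP : ∀ τ, P τ = eisTwo (nome τ ^ 7)) : Holo P :=
  holo_eisTwo 7 hP (a := 1) (b := 1) (by decide) (by decide) (by decide)

theorem fifthRoot_system {A B P : ℍ → ℂ} (hA : Holo A) (hB : Holo B) (hA5 : ∀ τ, A τ ^ 5 = gen 5 2 τ)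
    (hB5 : ∀ τ, B τ ^ 5 = gen 5 1 τ) (hP : ∀ τ, P τ = eisTwo (nome τ ^ 5)) (τ : ℍ) :
    qDiff A τ = 1 / 60 * A τ *
      (-5 * A τ ^ 10 - 66 * A τ ^ 5 * B τ ^ 5 + 7 * B τ ^ 10 + 5 * P τ) ∧
    qDiff B τ = 1 / 60 * B τ *
      (-5 * B τ ^ 10 + 66 * A τ ^ 5 * B τ ^ 5 + 7 * A τ ^ 10 + 5 * P τ) := by
  have n1 := balancedQuad_five.gen_ne_zero (by norm_num) (a := 1) (by decide) τ
  have n2 := balancedQuad_five.gen_ne_zero (by norm_num) (a := 2) (by decide) τ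
  have s1 := gen_system 5 (by norm_num) (by norm_num) (a := 1) (by decide) τ
  have s2 := gen_system 5 (by norm_num) (by norm_num) (a := 2) (by decide) τ
  have e4 := congrFun (balancedQuad_five.gen_neg (by norm_num) (a := 1) (by decide)) τ
  have qA := qDiff_pow hA 5 τ
  have qB := qDiff_pow hB 5 τ
  rw [funext hA5] at qA
  rw [funext hB5] at qB
  simp only [systemLHS, systemRHS, quadForm, genIndex, ← hP] at s1 s2
  norm_num at s1 s2 qA qB
  -- For a = 2 the second variable has index 4 = -1, so it is minus the first generator. Hence the
  -- cross term 66 enters with opposite signs in the two equations.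
  rw [show (4 : ZMod 5) = -1 by decide, e4, Pi.neg_apply] at s2
  rw [show A τ ^ 10 = gen 5 2 τ ^ 2 by rw [← hA5]; ring,
    show B τ ^ 10 = gen 5 1 τ ^ 2 by rw [← hB5]; ring, hA5, hB5]
  have a0 : A τ ≠ 0 := fun h => n2 (by rw [← hA5, h]; norm_num)
  have b0 : B τ ≠ 0 := fun h => n1 (by rw [← hB5, h]; norm_num)
  constructor
  · have : 12 / gen 5 2 τ * qDiff (gen 5 2) τ = 60 * qDiff A τ / A τ := by
      rw [show qDiff (gen 5 2) τ = _ from qA, ← hA5]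
      field_simp
      ring
    rw [this] at s2
    field_simp at s2
    linear_combination s2 / 60
  · have : 12 / gen 5 1 τ * qDiff (gen 5 1) τ = 60 * qDiff B τ / B τ := by
      rw [show qDiff (gen 5 1) τ = _ from qB, ← hB5]
      field_simp
      ring
    rw [this] at s1
    field_simp at s1
    linear_combination s1 / 60

theorem seven_system {P : ℍ → ℂ} (hP : ∀ τ, P τ = eisTwo (nome τ ^ 7)) (τ : ℍ) {x y z : ℂ}
    (hx : x = gen 7 2 τ) (hy : y = gen 7 4 τ) (hz : z = gen 7 1 τ) :
    qDiff (gen 7 2) τ = x / 12 *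
      (5 * y ^ 2 + 5 * z ^ 2 - 7 * x ^ 2 + 20 * y * z + 52 * x * y + 7 * P τ) ∧
    qDiff (gen 7 4) τ = y / 12 *
      (5 * z ^ 2 + 5 * x ^ 2 - 7 * y ^ 2 + 20 * x * z + 52 * y * z + 7 * P τ) ∧
    qDiff (gen 7 1) τ = z / 12 *
      (5 * x ^ 2 + 5 * y ^ 2 - 7 * z ^ 2 + 20 * x * y + 52 * x * z + 7 * P τ) := by
  have n1 := balancedQuad_seven.gen_ne_zero (by norm_num) (a := 1) (by decide) τ
  have n2 := balancedQuad_seven.gen_ne_zero (by norm_num) (a := 2) (by decide) τ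
  have n4 := balancedQuad_seven.gen_ne_zero (by norm_num) (a := 4) (by decide) τ
  have s1 := gen_system 7 (by norm_num) (by norm_num) (a := 1) (by decide) τ
  have s2 := gen_system 7 (by norm_num) (by norm_num) (a := 2) (by decide) τ
  have s4 := gen_system 7 (by norm_num) (by norm_num) (a := 4) (by decide) τ
  have e1 := congrFun (balancedQuad_seven.gen_neg (by norm_num) (a := 1) (by decide)) τ
  have e2 := congrFun (balancedQuad_seven.gen_neg (by norm_num) (a := 2) (by decide)) τ
  have e4 := congrFun (balancedQuad_seven.gen_neg (by norm_num) (a := 4) (by decide)) τ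
  simp only [systemLHS, systemRHS, quadForm, genIndex, ← hP] at s1 s2 s4
  norm_num at s1 s2 s4
  -- All indices are expressed up to sign by 1, 2, 4. In each equation exactly one of the three
  -- variables changes sign, the third for each a, and this turns -20 into +20.
  rw [show (3 : ZMod 7) = -4 by decide, e4, Pi.neg_apply] at s1
  rw [show (6 : ZMod 7) = -1 by decide, e1, Pi.neg_apply] at s2
  rw [show (8 : ZMod 7) = 1 by decide, show (12 : ZMod 7) = -2 by decide, e2, Pi.neg_apply] at s4
  rw [← hx] at n2
  rw [← hy] at n4
  rw [← hz] at n1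
  simp only [← hx, ← hy, ← hz] at s1 s2 s4
  field_simp at s1 s2 s4
  refine ⟨?_, ?_, ?_⟩
  · linear_combination s2 / 12
  · linear_combination s4 / 12
  · linear_combination s1 / 12

end

/-! ### Assembly of the three parts -/

theorem mainTheorem7 :
    -- the systems of level `5 ≤ p ≤ 19`
    (∀ (p : ℕ) [Fact p.Prime], 5 ≤ p → p ≤ 19 →
      -- the differential equations
      (∀ a : (ZMod p)ˣ, Holo (gen p a) ∧ ∀ τ : ℍ, gen p a τ ≠ 0 ∧
        12 / gen p a τ * qDiff (gen p a) τ =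
          quadForm p (fun k => gen p (a * (genIndex p k : ZMod p)) τ)
            + p * eisTwo (nome τ ^ p)) ∧
      -- the action of `Γ₀(p)` on the generators, and on both sides of the equations (weight two)
      (∀ γ ∈ CongruenceSubgroup.Gamma0 p,
        eisSum p ∣[(1 : ℤ)] γ = gen p ((γ 1 1 : ℤ) : ZMod p) ∧
        ∀ a : (ZMod p)ˣ,
          gen p a ∣[(1 : ℤ)] γ = gen p (a * ((γ 1 1 : ℤ) : ZMod p)) ∧
          systemLHS p a ∣[(2 : ℤ)] γ = systemLHS p (a * ((γ 1 1 : ℤ) : ZMod p)) ∧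
          systemRHS p a ∣[(2 : ℤ)] γ = systemRHS p (a * ((γ 1 1 : ℤ) : ZMod p))) ∧
      -- the equations for `a` and `b` coincide exactly when `b = ± a`
      (∀ a : (ZMod p)ˣ, gen p (-a : ZMod p) = -gen p (a : ZMod p)) ∧
      (∀ a b : (ZMod p)ˣ,
        (systemLHS p a = systemLHS p b ∧ systemRHS p a = systemRHS p b) ↔ b = a ∨ b = -a) ∧
      -- the system of the `(p - 1) / 2` equations for the generators is permuted by `Γ₀(p)`
      -- through a faithful representation of `(ℤ/pℤ)ˣ / {±1}`
      (∃ ρ : (ZMod p)ˣ →* Equiv.Perm (Fin ((p - 1) / 2)),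
        (∀ d : (ZMod p)ˣ, ρ d = 1 ↔ d = 1 ∨ d = -1) ∧
        ∀ γ ∈ CongruenceSubgroup.Gamma0 p, ∀ d : (ZMod p)ˣ, ((γ 1 1 : ℤ) : ZMod p) = d →
          ∀ k : Fin ((p - 1) / 2),
            (gen p (genIndex p (k + 1)) ∣[(1 : ℤ)] γ = gen p (genIndex p (ρ d k + 1)) ∨
              gen p (genIndex p (k + 1)) ∣[(1 : ℤ)] γ = -gen p (genIndex p (ρ d k + 1))) ∧
            systemLHS p (genIndex p (k + 1)) ∣[(2 : ℤ)] γ =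
              systemLHS p (genIndex p (ρ d k + 1)) ∧
            systemRHS p (genIndex p (k + 1)) ∣[(2 : ℤ)] γ =
              systemRHS p (genIndex p (ρ d k + 1)))) ∧
    -- the system of level five
    (prodA5 = gen 5 2 ∧ prodB5 = gen 5 1 ∧
      (∃ A B : ℍ → ℂ, Holo A ∧ Holo B ∧ (∀ τ, A τ ^ 5 = prodA5 τ) ∧ ∀ τ, B τ ^ 5 = prodB5 τ) ∧
      ∀ A B P : ℍ → ℂ, Holo A → Holo B →
        (∀ τ, A τ ^ 5 = prodA5 τ) → (∀ τ, B τ ^ 5 = prodB5 τ) →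
        (∀ τ, P τ = eisTwo (nome τ ^ 5)) →
        Holo P ∧ ∀ τ,
          qDiff A τ = 1 / 60 * A τ *
            (-5 * A τ ^ 10 - 66 * A τ ^ 5 * B τ ^ 5 + 7 * B τ ^ 10 + 5 * P τ) ∧
          qDiff B τ = 1 / 60 * B τ *
            (-5 * B τ ^ 10 + 66 * A τ ^ 5 * B τ ^ 5 + 7 * A τ ^ 10 + 5 * P τ) ∧
          qDiff P τ = 5 / 12 *
            (P τ ^ 2 - B τ ^ 20 + 12 * B τ ^ 15 * A τ ^ 5 - 14 * B τ ^ 10 * A τ ^ 10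
              - 12 * B τ ^ 5 * A τ ^ 15 - A τ ^ 20)) ∧
    -- the system of level seven
    (sevenX = gen 7 2 ∧ sevenY = gen 7 4 ∧ sevenZ = gen 7 1 ∧
      ∀ x y z P : ℍ → ℂ, x = sevenX → y = sevenY → z = sevenZ →
        (∀ τ, P τ = eisTwo (nome τ ^ 7)) →
        Holo x ∧ Holo y ∧ Holo z ∧ Holo P ∧ ∀ τ,
          qDiff x τ = x τ / 12 *
            (5 * y τ ^ 2 + 5 * z τ ^ 2 - 7 * x τ ^ 2 + 20 * y τ * z τ + 52 * x τ * y τ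
              + 7 * P τ) ∧
          qDiff y τ = y τ / 12 *
            (5 * z τ ^ 2 + 5 * x τ ^ 2 - 7 * y τ ^ 2 + 20 * x τ * z τ + 52 * y τ * z τ
              + 7 * P τ) ∧
          qDiff z τ = z τ / 12 *
            (5 * x τ ^ 2 + 5 * y τ ^ 2 - 7 * z τ ^ 2 + 20 * x τ * y τ + 52 * x τ * z τ
              + 7 * P τ) ∧
          qDiff P τ = 7 / 12 *
            (P τ ^ 2 - x τ ^ 4 - 4 * x τ ^ 3 * y τ - 12 * x τ * y τ ^ 3 - y τ ^ 4
              - 12 * x τ ^ 3 * z τ - 4 * y τ ^ 3 * z τ - 4 * x τ * z τ ^ 3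
              - 12 * y τ * z τ ^ 3 - z τ ^ 4)) := by
  refine ⟨fun p hp h5 h19 => ?_, ?_, ?_⟩
  · obtain ⟨t, ht, -⟩ := exists_balancedQuad p h5 h19
    have hp2 : p ≠ 2 := by omega
    have hs := smallPrime_of_le p h5 h19
    have hLHS : ∀ {γ : SL(2, ℤ)}, γ ∈ CongruenceSubgroup.Gamma0 p → ∀ {a : ZMod p}, a ≠ 0 →
        systemLHS p a ∣[(2 : ℤ)] γ = systemLHS p (a * ((γ 1 1 : ℤ) : ZMod p)) :=
      fun {γ} hγ {a} ha => by
        rw [systemLHS_eq h5 h19 ha,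
          systemLHS_eq h5 h19 (mul_ne_zero ha (gamma0_lower_right_ne_zero hγ)),
          systemRHS_slash h5 h19 hγ ha]
    refine ⟨fun a => ⟨ht.holo_gen hp2 a.ne_zero, fun τ => ⟨ht.gen_ne_zero hp2 a.ne_zero τ, ?_⟩⟩,
      fun γ hγ => ⟨ht.eisSum_slash hp2 hγ, fun a => ⟨ht.gen_slash hp2 hγ a.ne_zero,
        hLHS hγ a.ne_zero, systemRHS_slash h5 h19 hγ a.ne_zero⟩⟩,
      fun a => ht.gen_neg hp2 a.ne_zero, fun a b => ?_, ?_⟩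
    · exact sub_eq_iff_eq_add.mp (gen_system p h5 h19 a.ne_zero τ)
    · rw [systemLHS_eq h5 h19 a.ne_zero, systemLHS_eq h5 h19 b.ne_zero, and_self,
        systemRHS_eq_iff h5 h19 a.ne_zero b.ne_zero, Units.ext_iff, Units.ext_iff, Units.val_neg]
    · obtain ⟨ρ, hker, hρ⟩ := exists_permRep h5 h19
      refine ⟨ρ, hker, fun γ hγ d hd k => ?_⟩
      have h0 := genIndex_ne_zero hs k
      have h1 := genIndex_ne_zero hs (ρ d k)
      rw [ht.gen_slash hp2 hγ h0, hLHS hγ h0, systemRHS_slash h5 h19 hγ h0, hd]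
      rcases hρ d k with h | h
      · rw [h]
        exact ⟨Or.inl rfl, rfl, rfl⟩
      · rw [h]
        refine ⟨Or.inr (ht.gen_neg hp2 h1), ?_, systemRHS_neg h5 h19 h1⟩
        rw [systemLHS_eq h5 h19 (neg_ne_zero.mpr h1), systemLHS_eq h5 h19 h1,
          systemRHS_neg h5 h19 h1]
  · refine ⟨prodA5_eq, prodB5_eq, ?_, ?_⟩
    · obtain ⟨A, hA, hA5⟩ := exists_pow_eq_of_ne_zero (holo_gen_five (a := 2) (by decide))
        (gen_five_ne_zero (by decide)) (n := 5) (by norm_num)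
      obtain ⟨B, hB, hB5⟩ := exists_pow_eq_of_ne_zero (holo_gen_five (a := 1) (by decide))
        (gen_five_ne_zero (by decide)) (n := 5) (by norm_num)
      exact ⟨A, B, hA, hB, fun τ => by rw [hA5, prodA5_eq], fun τ => by rw [hB5, prodB5_eq]⟩
    · intro A B P hA hB hA5 hB5 hP
      rw [prodA5_eq] at hA5
      rw [prodB5_eq] at hB5
      refine ⟨holo_eisTwo_five hP, fun τ => ?_⟩
      obtain ⟨q1, q2⟩ := fifthRoot_system hA hB hA5 hB5 hP τ
      refine ⟨q1, q2, ?_⟩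
      rw [qDiff_eisTwo_five hP, ← hA5, ← hB5]
      ring
  · refine ⟨sevenX_eq, sevenY_eq, sevenZ_eq, ?_⟩
    rintro x y z P rfl rfl rfl hP
    rw [sevenX_eq, sevenY_eq, sevenZ_eq]
    refine ⟨holo_gen_seven (by decide), holo_gen_seven (by decide), holo_gen_seven (by decide),
      holo_eisTwo_seven hP, fun τ => ?_⟩
    obtain ⟨q1, q2, q3⟩ := seven_system hP τ rfl rfl rfl
    exact ⟨q1, q2, q3, qDiff_eisTwo_seven hP τ rfl rfl rfl⟩
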